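/- On the phase space of $\mathbb{R}^3$ with its canonical Poisson bracket $\{F,G\}=\sum_k(\partial_{x_k}F\,\partial_{p_k}G-\partial_{x_k}G\,\partial_{p_k}F)$ consider the Hamiltonians $H=\frac12(\vec p+\vec A(\vec x))^2+W(\vec x)$ with smooth $\vec A$, $W$ on $\mathbb{R}^3$ and magnetic field $\vec B=\nabla\times\vec A$. Put $p_i^A=p_i+A_i$, $l_i^A=\sum_{j,k}\varepsilon_{ijk}x_jp_k^A$. A quadratic integral is a function $X=\sum_{1\le i\le j\le 6}\alpha_{ij}T^A_iT^A_j+\sum_k\sigma_k(\vec x)p^A_k+\mu(\vec x)$, with $T^A=(p_1^A,p_2^A,p_3^A,l_1^A,l_2^A,l_3^A)$, real constants $\alpha_{ij}$ and smooth $\sigma_k,\mu$, such that $\{X,H\}=0$. Functions are called functionally independent if their differentials are linearly independent at the points of a dense set, and functionally dependent if their differentials are linearly independent at no point. For $a,b\in\mathbb{R}$, an $(a,b)$-pair is a pair of quadratic integrals with $\{X_1,X_2\}=0$ of the form $$X_1=l_3^Ap_3^A+a(p_1^A)^2+b\,p_1^Ap_2^A+\sum_j s_j(\vec x)p_j^A+m(\vec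 x),\qquad X_2=(p_3^A)^2+\sum_j S_j(\vec x)p_j^A+M(\vec x).$$ A system belongs to a class if it has commuting quadratic integrals with leading terms $Q_1,Q_2$ such that some Euclidean transformation carries $\mathrm{span}\{\frac12\vec p^{\,2},Q_1,Q_2\}$, as functions on phase space with $\vec l=\vec x\times\vec p$, to $\mathrm{span}\{\frac12\vec p^{\,2},N_1,N_2\}$, where $(N_1,N_2)$ is one of the pairs (real parameters) of that class in the following list: (a) $l_1^2+l_2^2+l_3^2+\alpha l_3p_3+\beta p_3^2,\ l_3^2$; (b) $l_1^2+l_2^2+l_3^2+\beta(\alpha p_2^2+p_3^2),\ \alpha l_2^2+l_3^2-\alpha\beta p_1^2$, with $0<\alpha\le\frac12$; (c) $l_1^2+l_2^2+l_3^2+2\beta(l_1p_1-(3\alpha-1)l_2p_2-2l_3p_3)+3\beta^2((1-4\alpha)p_1^2-(3\alpha^2-2\alpha-1)p_2^2+2(\alpha-1)p_3^2),\ \alpha l_2^2+l_3^2+6\alpha\beta l_1p_1+9\alpha\beta^2(\alpha p_3^2+p_2^2)$, with $0<\alpha\le\frac12$, $\beta\ne0$; (d) $l_3^2,\ l_1p_2-l_2p_1+\alpha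 l_3p_3$, with $\alpha\ge0$; (e) $l_3^2+2\alpha(l_1p_1-l_2p_2)+\alpha^2p_3^2,\ l_1p_2-l_2p_1-\alpha p_1p_2$, with $\alpha>0$; (f) $l_3^2+\alpha l_3p_3+\beta p_1^2+\gamma p_1p_3+\delta p_2p_3,\ p_3^2$, with $\gamma,\delta\ge0$; (g) $l_3^2+\alpha p_3^2,\ l_3p_3+\beta p_3^2$; (h) $l_1p_1+\alpha l_2p_2-(\alpha+1)l_3p_3+\beta p_2^2,\ p_1^2+\frac{2\alpha+1}{\alpha+2}p_2^2$, with $-\frac12<\alpha\le0$; (i) $l_1p_1+\alpha p_2^2+\beta p_2p_3,\ p_1^2$, with $\beta\ge0$; (j) $l_1p_1+\alpha l_2p_2-(\alpha+1)l_3p_3+\omega(l_1p_3-l_3p_1)+2\beta p_1p_2+\gamma(p_2^2-p_3^2),\ p_1^2+\frac{6\omega}{4\alpha-1}p_1p_3+\frac{\alpha+2}{4\alpha-1}p_2^2-\frac{5\alpha+1}{4\alpha-1}p_3^2$, with $-\frac12<\alpha\le0$, $\beta\ge0$, $\omega=\sqrt{1+\alpha-2\alpha^2}$; (k) $p_1^2+\alpha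 p_2^2,\ p_2^2+\beta p_1p_2+\gamma p_1p_3+\delta p_2p_3$, with $0\le\alpha\le\frac12$, $\beta,\gamma\ge0$. For real $a,b,b_\phi,b_Z,w_1,w_2,w_3$ consider the family $$\vec B=(-b_\phi y,\,b_\phi x,\,b_Z),$$ $$W=b_\phi\Big(-\tfrac18b_\phi(x^2+y^2)^2+w_3(x^2+y^2)-b_Z\big(\tfrac a2(x^2-y^2)+bxy\big)+w_1x+w_2y\Big).$$ 1. (Existence) The field $\vec B$ has a smooth vector potential, for instance $\vec A=(-\frac12b_Zy,\frac12b_Zx,-\frac12b_\phi(x^2+y^2))$, and for every smooth vector potential $\vec A$ of $\vec B$ the system has an $(a,b)$-pair $X_1,X_2$ such that $H,X_1,X_2$ are functionally independent. 2. (Uniqueness) If a system with $\vec B\not\equiv0$ has an $(a,b)$-pair, then, for suitable $b_\phi,b_Z,w_1,w_2,w_3$ and up to an additive constant in $W$, its fields $\vec B$, $W$ are those of the family with these $a,b$; or else $a=b=0$ and the system is of standard cylindrical type: it has two commuting integrals $l_3^A+f(\vec x)$ and $p_3^A+g(\vec x)$ with smooth $f,g$. 3. (Generic parameters) If $b_\phi\ne0$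 and $b_Z\neq0$, any four quadratic integrals of a system of the family are functionally dependent. If moreover $(a,b,w_1,w_2)\ne(0,0,0,0)$, the system belongs to class (i) and to no other class. 4. (Limit $b_Z=0$) Let $b_Z=0$, $b_\phi\ne0$, $s\in\mathbb{R}$, $r^2=x^2+y^2$. Then $P=p_3^A+\frac12b_\phi r^2$, $X^a=(p_1^A)^2-b_\phi x^2p_3^A-\frac12b_\phi^2x^2r^2+2b_\phi w_3x^2+2b_\phi w_1x$, $X^b=p_1^Ap_2^A-b_\phi xy\,p_3^A-\frac12b_\phi^2xyr^2+2b_\phi w_3xy+b_\phi w_2x+b_\phi w_1y$, $X^c=l_3^Ap_3^A+w_2p_1^A-w_1p_2^A+(\frac12b_\phi r^2-2w_3)l_3^A+s\,p_3^A+\frac12b_\phi s\,r^2$ are quadratic integrals; $H,X^a,X^b,P$ are functionally independent, and so are $H,X^a,X^c,P$. The system is quadratically minimally superintegrable (there are functionally independent $H,X_1,X_2,X_3$ with quadratic integrals $X_i$ and $\{X_1,X_2\}=0$, and any five quadratic integrals are functionally dependent), and it belongs to the classes (i) and (k). Moreover $$\{X^a,X^b\}=2b_\phi(sP-X^c),\qquad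 \{X^a,X^c\}=-2(P-2w_3)X^b+2b_\phi w_1w_2,$$ $$\{X^b,X^c\}=(P-2w_3)(P^2+2X^a-2H)+b_\phi(w_2^2-w_1^2),\qquad \{X^a,P\}=\{X^b,P\}=\{X^c,P\}=0.$$ If in addition $w_1=w_2=0$, then the system also belongs to class (f), $L=l_3^A$ is an integral, $H,X^a,P,L$ are functionally independent, and $\{P,L\}=\{L,X^c\}=0$, $\{L,X^a\}=2X^b$, $\{L,X^b\}=-(P^2-2H)-2X^a$, $X^c=PL-2w_3L+sP$, $(X^b)^2=(2H-P^2-X^a)X^a+b_\phi(P-2w_3)L^2$. 5. (Limit $b_\phi=0$) If $b_\phi=0$ and $b_Z\ne0$ (so that $W=0$), the system is quadratically minimally superintegrable and belongs to the classes (i), (k) and (f). -/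

import Mathlib

open scoped ContDiff

noncomputable section

namespace MagneticHamiltonian

/-- Points of, and vectors in, three-dimensional space; the coordinates `x, y, z` are the entries
`0, 1, 2`. -/
abbrev Vec : Type := Fin 3 → ℝ

/-- Phase space, with points `(x, p)`. -/
abbrev Phase : Type := Vec × Vec

/-- The partial derivative `∂ f / ∂ x_k`. -/
def partialX (k : Fin 3) (f : Vec → ℝ) (x : Vec) : ℝ :=
  fderiv ℝ f x (Pi.single k 1)

/-- The magnetic field `∇ × A` of a vector potential `A`. -/
def curl (A : Vec → Vec) (x : Vec) : Vec :=
  ![partialX 1 (fun y => A y 2) x - partialX 2 (fun y => A y 1) x,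
    partialX 2 (fun y => A y 0) x - partialX 0 (fun y => A y 2) x,
    partialX 0 (fun y => A y 1) x - partialX 1 (fun y => A y 0) x]

/-- The canonical Poisson bracket `∑ k, (∂F/∂x_k ∂G/∂p_k - ∂G/∂x_k ∂F/∂p_k)`. -/
def poisson (F G : Phase → ℝ) (ξ : Phase) : ℝ :=
  ∑ k : Fin 3,
    (fderiv ℝ F ξ (Pi.single k 1, 0) * fderiv ℝ G ξ (0, Pi.single k 1)
      - fderiv ℝ G ξ (Pi.single k 1, 0) * fderiv ℝ F ξ (0, Pi.single k 1))

/-- The component `p_i` of the linear momentum. -/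
def mom (i : Fin 3) (ξ : Phase) : ℝ := ξ.2 i

/-- The component `l_i` of the angular momentum `l = x × p`. -/
def ang (i : Fin 3) (ξ : Phase) : ℝ := crossProduct ξ.1 ξ.2 i

/-- `(x, p) ↦ (x, p + A(x))`. Composition with this map turns an expression in `p_i`, `l_i` into the
same expression in the covariant momenta `p_i^A = p_i + A_i`, `l_i^A = ∑ ε_ijk x_j p_k^A`. -/
def covShift (A : Vec → Vec) (ξ : Phase) : Phase := (ξ.1, ξ.2 + A ξ.1)

/-- The covariant linear momentum `p_i^A`. -/
def covMom (A : Vec → Vec) (i : Fin 3) (ξ : Phase) : ℝ := mom i (covShift A ξ)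

/-- The covariant angular momentum `l_i^A`. -/
def covAng (A : Vec → Vec) (i : Fin 3) (ξ : Phase) : ℝ := ang i (covShift A ξ)

/-- The free Hamiltonian `p² / 2`. -/
def freeHam (ξ : Phase) : ℝ := (1 / 2) * ∑ i : Fin 3, mom i ξ ^ 2

/-- The Hamiltonian `(p + A)² / 2 + W`. -/
def ham (A : Vec → Vec) (W : Vec → ℝ) (ξ : Phase) : ℝ :=
  (1 / 2) * ∑ i : Fin 3, (ξ.2 i + A ξ.1 i) ^ 2 + W ξ.1

/-- `X` is an integral of motion of the Hamiltonian `(p + A)² / 2 + W`. -/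
def IsIntegral (A : Vec → Vec) (W : Vec → ℝ) (X : Phase → ℝ) : Prop :=
  ∀ ξ, poisson X (ham A W) ξ = 0

/-- `F` and `G` are in involution. -/
def InInvolution (F G : Phase → ℝ) : Prop := ∀ ξ, poisson F G ξ = 0

/-- The six generators `(p_1, p_2, p_3, l_1, l_2, l_3)`. -/
def gen (ξ : Phase) : Fin 6 → ℝ :=
  ![mom 0 ξ, mom 1 ξ, mom 2 ξ, ang 0 ξ, ang 1 ξ, ang 2 ξ]

/-- `Q = ∑_{i ≤ j} α_ij T_i T_j` with `T = (p, l)` and real constants `α_ij`. As a function on phase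
space, so that the relation `p ⋅ l = 0` is built in. -/
def IsQuadraticElement (Q : Phase → ℝ) : Prop :=
  ∃ α : Fin 6 → Fin 6 → ℝ, ∀ ξ,
    Q ξ = ∑ i : Fin 6, ∑ j ∈ Finset.Ici i, α i j * gen ξ i * gen ξ j

/-- `X = Q(x, p^A) + ∑ k, σ_k(x) p_k^A + μ(x)` for some smooth functions `σ_k`, `μ`. -/
def HasLeadingTerm (A : Vec → Vec) (Q X : Phase → ℝ) : Prop :=
  ∃ (σ : Vec → Vec) (μ : Vec → ℝ), ContDiff ℝ ∞ σ ∧ ContDiff ℝ ∞ μ ∧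
    ∀ ξ, X ξ = Q (covShift A ξ) + ∑ k : Fin 3, σ ξ.1 k * covMom A k ξ + μ ξ.1

/-- An integral of motion that is a polynomial of degree at most two in the momenta, of the form
`∑_{i ≤ j} α_ij T_i^A T_j^A + ∑ σ_k(x) p_k^A + μ(x)`. -/
def IsQuadraticIntegral (A : Vec → Vec) (W : Vec → ℝ) (X : Phase → ℝ) : Prop :=
  (∃ Q, IsQuadraticElement Q ∧ HasLeadingTerm A Q X) ∧ IsIntegral A W X

/-- Functional independence: the Jacobian matrix has maximal rank on a dense set. -/
def FunctionallyIndependent {n : ℕ} (F : Fin n → Phase → ℝ) : Prop :=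
  Dense {ξ : Phase | LinearIndependent ℝ (fun i => fderiv ℝ (F i) ξ)}

/-- Functional dependence: the Jacobian matrix has maximal rank nowhere. -/
def FunctionallyDependent {n : ℕ} (F : Fin n → Phase → ℝ) : Prop :=
  ∀ ξ : Phase, ¬ LinearIndependent ℝ (fun i => fderiv ℝ (F i) ξ)

/-- Among the quadratic integrals (the Hamiltonian is one of them) there are no `n` functionally
independent ones. -/
def NoIndependentQuadratic (n : ℕ) (A : Vec → Vec) (W : Vec → ℝ) : Prop :=
  ∀ F : Fin n → Phase → ℝ, (∀ i, IsQuadraticIntegral A W (F i)) → FunctionallyDependent F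

/-- Quadratic minimal superintegrability: `H`, a commuting pair `X₁, X₂` of quadratic integrals and
one further quadratic integral are functionally independent, and there are no five functionally
independent quadratic integrals. -/
def QuadraticallyMinimallySuperintegrable (A : Vec → Vec) (W : Vec → ℝ) : Prop :=
  (∃ X₁ X₂ X₃ : Phase → ℝ,
    IsQuadraticIntegral A W X₁ ∧ IsQuadraticIntegral A W X₂ ∧ IsQuadraticIntegral A W X₃ ∧
    InInvolution X₁ X₂ ∧ FunctionallyIndependent ![ham A W, X₁, X₂, X₃]) ∧
  NoIndependentQuadratic 5 A W

/-! ### The classes of commuting pairs of quadratic elements -/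

/-- Labels of the eleven classes of three-dimensional Abelian spaces `span {p²/2, X₁, X₂}` of
quadratic elements of the enveloping algebra of the Euclidean algebra. -/
inductive PairClass : Type
  | a | b | c | d | e | f | g | h | i | j | k

/-- The normal forms `(X₁, X₂)` of each class (as commutative polynomials in `p`, `l`). -/
def IsNormalForm : PairClass → (Phase → ℝ) → (Phase → ℝ) → Prop
  | .a, X₁, X₂ => ∃ a b : ℝ,
      (∀ ξ, X₁ ξ = ang 0 ξ ^ 2 + ang 1 ξ ^ 2 + ang 2 ξ ^ 2 + a * ang 2 ξ * mom 2 ξ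
        + b * mom 2 ξ ^ 2) ∧
      (∀ ξ, X₂ ξ = ang 2 ξ ^ 2)
  | .b, X₁, X₂ => ∃ a b : ℝ, 0 < a ∧ a ≤ 1 / 2 ∧
      (∀ ξ, X₁ ξ = ang 0 ξ ^ 2 + ang 1 ξ ^ 2 + ang 2 ξ ^ 2
        + b * (a * mom 1 ξ ^ 2 + mom 2 ξ ^ 2)) ∧
      (∀ ξ, X₂ ξ = a * ang 1 ξ ^ 2 + ang 2 ξ ^ 2 - a * b * mom 0 ξ ^ 2)
  | .c, X₁, X₂ => ∃ a b : ℝ, 0 < a ∧ a ≤ 1 / 2 ∧ b ≠ 0 ∧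
      (∀ ξ, X₁ ξ = ang 0 ξ ^ 2 + ang 1 ξ ^ 2 + ang 2 ξ ^ 2
        + 2 * b * (ang 0 ξ * mom 0 ξ - (3 * a - 1) * ang 1 ξ * mom 1 ξ
          - 2 * ang 2 ξ * mom 2 ξ)
        + 3 * b ^ 2 * ((1 - 4 * a) * mom 0 ξ ^ 2 - (3 * a ^ 2 - 2 * a - 1) * mom 1 ξ ^ 2
          + 2 * (a - 1) * mom 2 ξ ^ 2)) ∧
      (∀ ξ, X₂ ξ = a * ang 1 ξ ^ 2 + ang 2 ξ ^ 2 + 6 * a * b * ang 0 ξ * mom 0 ξ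
        + 9 * a * b ^ 2 * (a * mom 2 ξ ^ 2 + mom 1 ξ ^ 2))
  | .d, X₁, X₂ => ∃ a : ℝ, 0 ≤ a ∧
      (∀ ξ, X₁ ξ = ang 2 ξ ^ 2) ∧
      (∀ ξ, X₂ ξ = ang 0 ξ * mom 1 ξ - ang 1 ξ * mom 0 ξ + a * ang 2 ξ * mom 2 ξ)
  | .e, X₁, X₂ => ∃ a : ℝ, 0 < a ∧
      (∀ ξ, X₁ ξ = ang 2 ξ ^ 2 + 2 * a * (ang 0 ξ * mom 0 ξ - ang 1 ξ * mom 1 ξ)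
        + a ^ 2 * mom 2 ξ ^ 2) ∧
      (∀ ξ, X₂ ξ = ang 0 ξ * mom 1 ξ - ang 1 ξ * mom 0 ξ - a * mom 0 ξ * mom 1 ξ)
  | .f, X₁, X₂ => ∃ a b c d : ℝ, 0 ≤ c ∧ 0 ≤ d ∧
      (∀ ξ, X₁ ξ = ang 2 ξ ^ 2 + a * ang 2 ξ * mom 2 ξ + b * mom 0 ξ ^ 2
        + c * mom 0 ξ * mom 2 ξ + d * mom 1 ξ * mom 2 ξ) ∧
      (∀ ξ, X₂ ξ = mom 2 ξ ^ 2)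
  | .g, X₁, X₂ => ∃ a b : ℝ,
      (∀ ξ, X₁ ξ = ang 2 ξ ^ 2 + a * mom 2 ξ ^ 2) ∧
      (∀ ξ, X₂ ξ = ang 2 ξ * mom 2 ξ + b * mom 2 ξ ^ 2)
  | .h, X₁, X₂ => ∃ a b : ℝ, -(1 / 2) < a ∧ a ≤ 0 ∧
      (∀ ξ, X₁ ξ = ang 0 ξ * mom 0 ξ + a * ang 1 ξ * mom 1 ξ - (a + 1) * ang 2 ξ * mom 2 ξ
        + b * mom 1 ξ ^ 2) ∧
      (∀ ξ, X₂ ξ = mom 0 ξ ^ 2 + (2 * a + 1) / (a + 2) * mom 1 ξ ^ 2)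
  | .i, X₁, X₂ => ∃ a b : ℝ, 0 ≤ b ∧
      (∀ ξ, X₁ ξ = ang 0 ξ * mom 0 ξ + a * mom 1 ξ ^ 2 + b * mom 1 ξ * mom 2 ξ) ∧
      (∀ ξ, X₂ ξ = mom 0 ξ ^ 2)
  | .j, X₁, X₂ => ∃ a b c om : ℝ, -(1 / 2) < a ∧ a ≤ 0 ∧ 0 ≤ b ∧
      om = Real.sqrt (1 + a - 2 * a ^ 2) ∧
      (∀ ξ, X₁ ξ = ang 0 ξ * mom 0 ξ + a * ang 1 ξ * mom 1 ξ - (a + 1) * ang 2 ξ * mom 2 ξ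
        + om * (ang 0 ξ * mom 2 ξ - ang 2 ξ * mom 0 ξ) + 2 * b * mom 0 ξ * mom 1 ξ
        + c * (mom 1 ξ ^ 2 - mom 2 ξ ^ 2)) ∧
      (∀ ξ, X₂ ξ = mom 0 ξ ^ 2 + 6 * om / (4 * a - 1) * mom 0 ξ * mom 2 ξ
        + (a + 2) / (4 * a - 1) * mom 1 ξ ^ 2 - (5 * a + 1) / (4 * a - 1) * mom 2 ξ ^ 2)
  | .k, X₁, X₂ => ∃ a b c d : ℝ, 0 ≤ a ∧ a ≤ 1 / 2 ∧ 0 ≤ b ∧ 0 ≤ c ∧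
      (∀ ξ, X₁ ξ = mom 0 ξ ^ 2 + a * mom 1 ξ ^ 2) ∧
      (∀ ξ, X₂ ξ = mom 1 ξ ^ 2 + b * mom 0 ξ * mom 1 ξ + c * mom 0 ξ * mom 2 ξ
        + d * mom 1 ξ * mom 2 ξ)

/-- The action `(x, p) ↦ (R x + t, R p)` of a Euclidean transformation on phase space. -/
def euclid (R : Matrix.orthogonalGroup (Fin 3) ℝ) (t : Vec) (ξ : Phase) : Phase :=
  ((R : Matrix (Fin 3) (Fin 3) ℝ).mulVec ξ.1 + t, (R : Matrix (Fin 3) (Fin 3) ℝ).mulVec ξ.2)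

/-- The space `span {p²/2, Q₁, Q₂}` is carried by some Euclidean transformation to the span of
`p²/2` and a normal form of the class `κ`. -/
def PairInClass (κ : PairClass) (Q₁ Q₂ : Phase → ℝ) : Prop :=
  ∃ (R : Matrix.orthogonalGroup (Fin 3) ℝ) (t : Vec) (N₁ N₂ : Phase → ℝ),
    IsNormalForm κ N₁ N₂ ∧
    Submodule.span ℝ {freeHam, Q₁ ∘ euclid R t, Q₂ ∘ euclid R t}
      = Submodule.span ℝ {freeHam, N₁, N₂}

/-- The system belongs to the class `κ`: it has a commuting pair of quadratic integrals whose leading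
terms are in the class `κ`. -/
def BelongsToClass (κ : PairClass) (A : Vec → Vec) (W : Vec → ℝ) : Prop :=
  ∃ X₁ X₂ Q₁ Q₂ : Phase → ℝ,
    IsQuadraticElement Q₁ ∧ HasLeadingTerm A Q₁ X₁ ∧ IsIntegral A W X₁ ∧
    IsQuadraticElement Q₂ ∧ HasLeadingTerm A Q₂ X₂ ∧ IsIntegral A W X₂ ∧
    InInvolution X₁ X₂ ∧ PairInClass κ Q₁ Q₂

/-! ### The pair under consideration and the family of systems -/

/-- The leading term `l_3 p_3 + a p_1² + b p_1 p_2`. -/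
def lead₁ (a b : ℝ) (ξ : Phase) : ℝ :=
  ang 2 ξ * mom 2 ξ + a * mom 0 ξ ^ 2 + b * mom 0 ξ * mom 1 ξ

/-- The leading term `p_3²`. -/
def lead₂ (ξ : Phase) : ℝ := mom 2 ξ ^ 2

/-- `X₁, X₂` are integrals in involution of the forms `l_3^A p_3^A + a (p_1^A)² + b p_1^A p_2^A + …`
and `(p_3^A)² + …`. -/
def IsPair (a b : ℝ) (A : Vec → Vec) (W : Vec → ℝ) (X₁ X₂ : Phase → ℝ) : Prop :=
  HasLeadingTerm A (lead₁ a b) X₁ ∧ HasLeadingTerm A lead₂ X₂ ∧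
  IsIntegral A W X₁ ∧ IsIntegral A W X₂ ∧ InInvolution X₁ X₂

/-- The standard cylindrical case: there are two commuting first order integrals
`l_3^A + f(x)` and `p_3^A + g(x)`. -/
def HasCylindricalIntegrals (A : Vec → Vec) (W : Vec → ℝ) : Prop :=
  ∃ f g : Vec → ℝ, ContDiff ℝ ∞ f ∧ ContDiff ℝ ∞ g ∧
    IsIntegral A W (fun ξ => covAng A 2 ξ + f ξ.1) ∧
    IsIntegral A W (fun ξ => covMom A 2 ξ + g ξ.1) ∧
    InInvolution (fun ξ => covAng A 2 ξ + f ξ.1) (fun ξ => covMom A 2 ξ + g ξ.1)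

/-- The magnetic field `(-b_φ y, b_φ x, b_Z)`. -/
def famB (bφ bZ : ℝ) (x : Vec) : Vec := ![-(bφ * x 1), bφ * x 0, bZ]

/-- A vector potential of this field. -/
def famA (bφ bZ : ℝ) (x : Vec) : Vec :=
  ![-(1 / 2 * bZ * x 1), 1 / 2 * bZ * x 0, -(1 / 2 * bφ * (x 0 ^ 2 + x 1 ^ 2))]

/-- The electrostatic potential of the family. -/
def famW (a b bφ bZ w₁ w₂ w₃ : ℝ) (x : Vec) : ℝ :=
  bφ * (-(1 / 8) * bφ * (x 0 ^ 2 + x 1 ^ 2) ^ 2 + w₃ * (x 0 ^ 2 + x 1 ^ 2)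
    - bZ * (a / 2 * (x 0 ^ 2 - x 1 ^ 2) + b * x 0 * x 1) + w₁ * x 0 + w₂ * x 1)

/-! ### The additional integrals for `b_Z = 0` -/

/-- `p_3^A + b_φ (x² + y²) / 2`. -/
def intP (bφ : ℝ) (A : Vec → Vec) (ξ : Phase) : ℝ :=
  covMom A 2 ξ + 1 / 2 * bφ * (ξ.1 0 ^ 2 + ξ.1 1 ^ 2)

/-- The integral with leading term `(p_1^A)²`. -/
def intA (bφ w₁ w₃ : ℝ) (A : Vec → Vec) (ξ : Phase) : ℝ :=
  covMom A 0 ξ ^ 2 - bφ * ξ.1 0 ^ 2 * covMom A 2 ξ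
    - 1 / 2 * bφ ^ 2 * ξ.1 0 ^ 2 * (ξ.1 0 ^ 2 + ξ.1 1 ^ 2)
    + 2 * bφ * w₃ * ξ.1 0 ^ 2 + 2 * bφ * w₁ * ξ.1 0

/-- The integral with leading term `p_1^A p_2^A`. -/
def intB (bφ w₁ w₂ w₃ : ℝ) (A : Vec → Vec) (ξ : Phase) : ℝ :=
  covMom A 0 ξ * covMom A 1 ξ - bφ * ξ.1 0 * ξ.1 1 * covMom A 2 ξ
    - 1 / 2 * bφ ^ 2 * ξ.1 0 * ξ.1 1 * (ξ.1 0 ^ 2 + ξ.1 1 ^ 2)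
    + 2 * bφ * w₃ * ξ.1 0 * ξ.1 1 + bφ * w₂ * ξ.1 0 + bφ * w₁ * ξ.1 1

/-- The integral with leading term `l_3^A p_3^A`; `s` is an arbitrary constant. -/
def intC (bφ w₁ w₂ w₃ s : ℝ) (A : Vec → Vec) (ξ : Phase) : ℝ :=
  covAng A 2 ξ * covMom A 2 ξ + w₂ * covMom A 0 ξ - w₁ * covMom A 1 ξ
    + (1 / 2 * bφ * (ξ.1 0 ^ 2 + ξ.1 1 ^ 2) - 2 * w₃) * covAng A 2 ξ
    + s * covMom A 2 ξ + 1 / 2 * bφ * s * (ξ.1 0 ^ 2 + ξ.1 1 ^ 2)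

end MagneticHamiltonian

end

/-! In the covariant momenta the Poisson bracket of two polynomials of degree at most two in the
momenta has coefficients that involve the vector potential only through its curl
(`Quad.poisson_fn`). Every condition `{F, G} = 0` is therefore a list of differential equations for
smooth coefficients, treated as identities in the ring `Sm` of smooth functions with three commuting
derivations. This ring has zero divisors, so a vanishing product does not split by itself. One
either cancels a factor that is analytic and not identically zero (`Sm.Regular`), or differentiates
the product and uses that the ring is reduced.

Uniqueness. The bracket `{X₁, X₂}` forces the planar part of the linear term of `X₂` to be an
infinitesimal plane motion, a rotation `w` plus a translation `σ`, with `a w = b w = 0`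
(`PairSystem.exists_S`). If `w ≠ 0`, the system is cylindrical. If `w = 0` and `σ ≠ 0`, the magnetic
field vanishes. Otherwise all coefficients that matter are independent of `z` and a planar problem
remains. There the planar field is azimuthal with rotation invariant size `T = x B₂ - y B₁`. Put `U
= x s₁ + y s₂`, `V = x s₂ - y s₁`, and let `eul`, `rot` be the Euler and rotation fields. Then `Z =
ρ eul W + T V` satisfies `U Z = 0` and `rot Z = (eul T - 2 T) U`, so `rot Z` vanishes, and with it
`(eul T - 2 T) U` (`PlanarSystem.kappa_U`). From this, `T` is a multiple of `ρ = x² + y²`, `B₃` is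
constant and the gradient of `W` is expressed by `s₁, s₂` (`PlanarSystem.linear_of_ne`,
`PlanarSystem.linear_or_of_eq`); the one alternative, for `a = b = 0`, is again cylindrical.

Members of the family. Adding `b_φ ρ / 2` to `A₃` makes the field homogeneous, makes the third
momentum `c` conserved and absorbs the quartic term of `W`, so that `H = (π² + c²) / 2 + V c + U`
with quadratic polynomials `V, U` in `x, y`. Explicit integrals are then polynomial identities.

All integrals. The leading coefficients are polynomials of degree at most two in `z`, hence every
quadratic integral is a polynomial in `z`. The `z`-derivative of a solution of the determining
equations is again a solution, and a solution affine in `z` is constant in `z`; descending, all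
quadratic integrals are invariant under `z`-translations. Five such integrals are dependent, since
`{·, H} = 0` is one more linear relation among the five remaining components of a differential. If
`b_φ` and `b_Z` are both non-zero, the determining equations can be solved
(`AxialSystem.exists_form`): generically only combinations of `H`, `X₁`, `c²`, `c` and constants
survive, and in the axially symmetric case only polynomials in `H`, `c` and the rotation integral.

Classes. Generically the leading terms lie in `span {p²/2, lead₁, lead₂}`. In every Euclidean frame
an element of this span is affine in the position, and its part linear in the position is a multiple
of one product `(n·l)(n·p)`. This rank one property (`frameForm_rank_one`) excludes all classes but
(i). -/

noncomputable section

namespace MagneticHamiltonian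

/-! ### The differential ring of smooth functions. -/

/-- The algebra of smooth real functions on space. -/
def smoothSubalgebra : Subalgebra ℝ (Vec → ℝ) where
  carrier := {f | ContDiff ℝ ∞ f}
  mul_mem' := by
    intro f g hf hg
    exact ContDiff.mul (Set.mem_ofPred.1 hf) (Set.mem_ofPred.1 hg)
  add_mem' := by
    intro f g hf hg
    exact ContDiff.add (Set.mem_ofPred.1 hf) (Set.mem_ofPred.1 hg)
  algebraMap_mem' := by
    intro r
    exact Set.mem_ofPred.2 contDiff_const

/-- Smooth functions on space, as a type. -/
def Sm : Type := smoothSubalgebra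

namespace Sm

instance : CommRing Sm := inferInstanceAs (CommRing (smoothSubalgebra))

/-- The underlying function. -/
def toFun (f : Sm) : Vec → ℝ := Subtype.val (p := fun g => g ∈ smoothSubalgebra) f

instance : CoeFun Sm (fun _ => Vec → ℝ) := ⟨toFun⟩

/-- Bundling of a smooth function. -/
def mk (f : Vec → ℝ) (hf : ContDiff ℝ ∞ f) : Sm := ⟨f, hf⟩

@[simp] lemma mk_apply (f : Vec → ℝ) (hf : ContDiff ℝ ∞ f) (x : Vec) : mk f hf x = f x := rfl

lemma contDiff (f : Sm) : ContDiff ℝ ∞ (f : Vec → ℝ) := f.2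

lemma differentiable (f : Sm) : Differentiable ℝ (f : Vec → ℝ) :=
  f.contDiff.differentiable (by simp)

@[ext] lemma ext {f g : Sm} (h : ∀ x, f x = g x) : f = g := Subtype.ext (funext h)

@[simp] lemma add_apply (f g : Sm) (x : Vec) : (f + g) x = f x + g x := rfl
@[simp] lemma sub_apply (f g : Sm) (x : Vec) : (f - g) x = f x - g x := rfl
@[simp] lemma mul_apply (f g : Sm) (x : Vec) : (f * g) x = f x * g x := rfl
@[simp] lemma neg_apply (f : Sm) (x : Vec) : (-f) x = -f x := rfl
@[simp] lemma zero_apply (x : Vec) : (0 : Sm) x = 0 := rfl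
@[simp] lemma one_apply (x : Vec) : (1 : Sm) x = 1 := rfl
@[simp] lemma pow_apply (f : Sm) (n : ℕ) (x : Vec) : (f ^ n) x = f x ^ n := rfl
@[simp] lemma natCast_apply (n : ℕ) (x : Vec) : (n : Sm) x = n := rfl
@[simp] lemma ofNat_apply (n : ℕ) [n.AtLeastTwo] (x : Vec) :
    (ofNat(n) : Sm) x = OfNat.ofNat n := rfl

/-- Constant functions. -/
def C : ℝ →+* Sm := algebraMap ℝ (smoothSubalgebra)

@[simp] lemma C_apply (a : ℝ) (x : Vec) : C a x = a := rfl

/-- Coordinate functions. -/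
def X (i : Fin 3) : Sm := mk (fun x => x i) (contDiff_apply ℝ ℝ i)

@[simp] lemma X_apply (i : Fin 3) (x : Vec) : X i x = x i := rfl

/-- Partial derivatives of smooth functions. -/
def d (i : Fin 3) (f : Sm) : Sm :=
  mk (partialX i f) (by
    have h : ContDiff ℝ ∞ (fderiv ℝ (f : Vec → ℝ)) := f.contDiff.fderiv_right (by simp)
    exact h.clm_apply contDiff_const)

lemma d_apply (i : Fin 3) (f : Sm) (x : Vec) : d i f x = fderiv ℝ f x (Pi.single i 1) := rfl

@[simp] lemma d_add (i : Fin 3) (f g : Sm) : d i (f + g) = d i f + d i g := by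
  ext x
  change fderiv ℝ ((f : Vec → ℝ) + (g : Vec → ℝ)) x _ = _
  rw [fderiv_add (f.differentiable x) (g.differentiable x)]; rfl

@[simp] lemma d_C (i : Fin 3) (a : ℝ) : d i (C a) = 0 := by
  ext x
  change fderiv ℝ (fun _ => a) x _ = _
  simp

@[simp] lemma d_mul (i : Fin 3) (f g : Sm) : d i (f * g) = d i f * g + f * d i g := by
  ext x
  change fderiv ℝ ((f : Vec → ℝ) * (g : Vec → ℝ)) x _ = _
  rw [fderiv_mul (f.differentiable x) (g.differentiable x)]
  simp [d_apply]; ring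

@[simp] lemma d_zero (i : Fin 3) : d i 0 = 0 := by simpa using d_C i 0
@[simp] lemma d_one (i : Fin 3) : d i 1 = 0 := by simpa using d_C i 1
@[simp] lemma d_ofNat (i : Fin 3) (n : ℕ) [n.AtLeastTwo] : d i (ofNat(n) : Sm) = 0 := by
  have h := d_C i (OfNat.ofNat n)
  rwa [map_ofNat] at h
@[simp] lemma d_neg (i : Fin 3) (f : Sm) : d i (-f) = -d i f := by
  have := d_mul i (-1) f
  have h := d_C i (-1)
  simp only [map_neg, map_one] at h
  simpa [h] using this
@[simp] lemma d_sub (i : Fin 3) (f g : Sm) : d i (f - g) = d i f - d i g := by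
  simp [sub_eq_add_neg]
@[simp] lemma d_pow (i : Fin 3) (f : Sm) (n : ℕ) : d i (f ^ n) = n * f ^ (n - 1) * d i f := by
  induction n with
  | zero => simp
  | succ n ih =>
    rw [pow_succ, d_mul, ih]
    rcases n with _ | n
    · simp
    · simp only [Nat.add_sub_cancel]; push_cast; ring
lemma d_sum {ι : Type*} (i : Fin 3) (s : Finset ι) (f : ι → Sm) :
    d i (∑ j ∈ s, f j) = ∑ j ∈ s, d i (f j) := by
  classical
  induction s using Finset.induction_on with
  | empty => simp
  | insert a s ha ih => simp [Finset.sum_insert ha, ih]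

lemma d_X (i j : Fin 3) : d i (X j) = if i = j then 1 else 0 := by
  ext x
  change fderiv ℝ (fun x : Vec => x j) x _ = _
  rw [(hasFDerivAt_apply (𝕜 := ℝ) j x).fderiv]
  by_cases h : i = j
  · subst h; simp
  · simp [h, Ne.symm h]

@[simp] lemma d_X_self (i : Fin 3) : d i (X i) = 1 := by simp [d_X]
@[simp] lemma d_X_01 : d 0 (X 1) = 0 := by simp [d_X]
@[simp] lemma d_X_10 : d 1 (X 0) = 0 := by simp [d_X]
@[simp] lemma d_X_20 : d 2 (X 0) = 0 := by simp [d_X]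
@[simp] lemma d_X_21 : d 2 (X 1) = 0 := by simp [d_X]

lemma d_comm (i j : Fin 3) (f : Sm) : d i (d j f) = d j (d i f) := by
  have key : ∀ (u v w x : Vec),
      fderiv ℝ (fun y => fderiv ℝ (f : Vec → ℝ) y v) x u = fderiv ℝ (fderiv ℝ (f : Vec → ℝ)) x u v := by
    intro u v w x
    have h : DifferentiableAt ℝ (fderiv ℝ (f : Vec → ℝ)) x :=
      ((f.contDiff.fderiv_right (m := ∞) (by simp)).differentiable (by simp)) x
    rw [fderiv_clm_apply h (differentiableAt_const _)]
    simp
  ext x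
  change fderiv ℝ (fun y => fderiv ℝ (f : Vec → ℝ) y _) x _ =
    fderiv ℝ (fun y => fderiv ℝ (f : Vec → ℝ) y _) x _
  rw [key _ _ 0, key _ _ 0]
  have : IsSymmSndFDerivAt ℝ (f : Vec → ℝ) x :=
    (f.contDiff.contDiffAt).isSymmSndFDerivAt (by
      simp only [minSmoothness_of_isRCLikeNormedField]
      exact WithTop.coe_le_coe.2 le_top)
  exact this _ _

-- Fixes a normal form for mixed derivatives, with the smaller index outermost, so that after `simp`
-- equal mixed derivatives are the same atom for `linear_combination`.
@[simp] lemma d10 (f : Sm) : d 1 (d 0 f) = d 0 (d 1 f) := d_comm _ _ _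
@[simp] lemma d20 (f : Sm) : d 2 (d 0 f) = d 0 (d 2 f) := d_comm _ _ _
@[simp] lemma d21 (f : Sm) : d 2 (d 1 f) = d 1 (d 2 f) := d_comm _ _ _

lemma eq_C_of_d_eq_zero (f : Sm) (h : ∀ i, d i f = 0) : f = C (f 0) := by
  ext x
  refine is_const_of_fderiv_eq_zero (𝕜 := ℝ) f.differentiable (fun y => ?_) x 0
  ext v
  have : v = ∑ i, v i • (Pi.single i 1 : Vec) := by
    ext j; simp [Finset.sum_apply, Pi.single_apply]
  rw [this, map_sum]
  refine Finset.sum_eq_zero fun i _ => ?_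
  rw [map_smul, ← d_apply, h i]; simp

lemma exists_C_of_d {f : Sm} (h0 : d 0 f = 0) (h1 : d 1 f = 0) (h2 : d 2 f = 0) :
    ∃ c, f = C c :=
  ⟨_, eq_C_of_d_eq_zero f (by intro i; fin_cases i <;> assumption)⟩

/-- The substitute for cancellation in a ring with zero divisors: to see that a function vanishes,
it suffices to produce a power of it as a combination of vanishing expressions. -/
lemma eq_zero_of_pow {f : Sm} {n : ℕ} (h : f ^ n = 0) : f = 0 := by
  ext x
  exact eq_zero_of_pow_eq_zero (congrArg (fun g : Sm => g x) h)

end Sm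
lemma Sm.fderiv_eq (f : Sm) (x v : Vec) :
    fderiv ℝ (f : Vec → ℝ) x v = v 0 * Sm.d 0 f x + v 1 * Sm.d 1 f x + v 2 * Sm.d 2 f x := by
  have : v = ∑ i, v i • (Pi.single i 1 : Vec) := by
    ext j; simp [Finset.sum_apply, Pi.single_apply]
  conv_lhs => rw [this, map_sum]
  simp only [map_smul, ← Sm.d_apply, Fin.sum_univ_three, smul_eq_mul]

/-- The components of a smooth vector field. -/
def comp (A : Vec → Vec) (hA : ContDiff ℝ ∞ A) (i : Fin 3) : Sm :=
  Sm.mk (fun x => A x i) (contDiff_pi.1 hA i)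

@[simp] lemma comp_apply (A : Vec → Vec) (hA : ContDiff ℝ ∞ A) (i : Fin 3) (x : Vec) :
    comp A hA i x = A x i := rfl

lemma d_comp (A : Vec → Vec) (hA : ContDiff ℝ ∞ A) (i j : Fin 3) (x : Vec) :
    Sm.d j (comp A hA i) x = partialX j (fun y => A y i) x := rfl

/-! ### Polynomials in the momenta and their magnetic Poisson bracket. -/

/-- Polynomials of degree at most two in the momenta with smooth coefficients. -/
@[ext] structure Quad where
  (k11 k12 k22 u1 u2 f t1 t2 h n : Sm)

namespace Quad

/-- The value of a polynomial at a point of phase space. -/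
def eval (q : Quad) (η : Phase) : ℝ :=
  q.k11 η.1 * η.2 0 ^ 2 + q.k12 η.1 * (η.2 0 * η.2 1) + q.k22 η.1 * η.2 1 ^ 2
    + q.u1 η.1 * (η.2 0 * η.2 2) + q.u2 η.1 * (η.2 1 * η.2 2) + q.f η.1 * η.2 2 ^ 2
    + q.t1 η.1 * η.2 0 + q.t2 η.1 * η.2 1 + q.h η.1 * η.2 2 + q.n η.1

/-- The polynomial in covariant momenta. -/
def fn (q : Quad) (A : Vec → Vec) (ξ : Phase) : ℝ := q.eval (covShift A ξ)

/-- The derivative of the coefficients. -/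
def dx (i : Fin 3) (q : Quad) : Quad :=
  ⟨Sm.d i q.k11, Sm.d i q.k12, Sm.d i q.k22, Sm.d i q.u1, Sm.d i q.u2, Sm.d i q.f,
    Sm.d i q.t1, Sm.d i q.t2, Sm.d i q.h, Sm.d i q.n⟩

/-- The derivatives with respect to the momenta. -/
def dp (q : Quad) (i : Fin 3) (η : Phase) : ℝ :=
  ![2 * q.k11 η.1 * η.2 0 + q.k12 η.1 * η.2 1 + q.u1 η.1 * η.2 2 + q.t1 η.1,
    q.k12 η.1 * η.2 0 + 2 * q.k22 η.1 * η.2 1 + q.u2 η.1 * η.2 2 + q.t2 η.1,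
    q.u1 η.1 * η.2 0 + q.u2 η.1 * η.2 1 + 2 * q.f η.1 * η.2 2 + q.h η.1] i

lemma hasFDerivAt_coeff (f : Sm) (ξ : Phase) :
    HasFDerivAt (fun ξ : Phase => f ξ.1)
      ((fderiv ℝ (f : Vec → ℝ) ξ.1).comp (ContinuousLinearMap.fst ℝ Vec Vec)) ξ :=
  (f.differentiable ξ.1).hasFDerivAt.comp ξ hasFDerivAt_fst

lemma hasFDerivAt_mom (A : Vec → Vec) (hA : ContDiff ℝ ∞ A) (i : Fin 3) (ξ : Phase) :
    HasFDerivAt (fun ξ : Phase => (covShift A ξ).2 i)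
      ((ContinuousLinearMap.proj i : Vec →L[ℝ] ℝ).comp (ContinuousLinearMap.snd ℝ Vec Vec) +
      (fderiv ℝ (comp A hA i : Vec → ℝ) ξ.1).comp (ContinuousLinearMap.fst ℝ Vec Vec)) ξ :=
  ((hasFDerivAt_apply (𝕜 := ℝ) i ξ.2).comp ξ hasFDerivAt_snd).add
    (hasFDerivAt_coeff (comp A hA i) ξ)

lemma exists_hasFDerivAt (q : Quad) (A : Vec → Vec) (hA : ContDiff ℝ ∞ A) (ξ : Phase) :
    ∃ L : Phase →L[ℝ] ℝ, HasFDerivAt (q.fn A) L ξ ∧ ∀ v, L v =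
      (v.1 0 * (q.dx 0).eval (covShift A ξ) + v.1 1 * (q.dx 1).eval (covShift A ξ)
        + v.1 2 * (q.dx 2).eval (covShift A ξ))
      + ∑ i, q.dp i (covShift A ξ) * (v.2 i + (v.1 0 * partialX 0 (fun y => A y i) ξ.1
        + v.1 1 * partialX 1 (fun y => A y i) ξ.1 + v.1 2 * partialX 2 (fun y => A y i) ξ.1)) := by
  have hc := fun f : Sm => hasFDerivAt_coeff f ξ
  have hP := fun i => hasFDerivAt_mom A hA i ξ
  refine ⟨_, ((((((((((hc q.k11).mul ((hP 0).pow 2)).add ((hc q.k12).mul ((hP 0).mul (hP 1)))).add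
    ((hc q.k22).mul ((hP 1).pow 2))).add ((hc q.u1).mul ((hP 0).mul (hP 2)))).add
    ((hc q.u2).mul ((hP 1).mul (hP 2)))).add ((hc q.f).mul ((hP 2).pow 2))).add
    ((hc q.t1).mul (hP 0))).add ((hc q.t2).mul (hP 1))).add ((hc q.h).mul (hP 2))).add (hc q.n),
    fun v => ?_⟩
  simp only [add_apply, smul_apply, Pi.mul_apply,
    ContinuousLinearMap.comp_apply, ContinuousLinearMap.coe_fst', ContinuousLinearMap.coe_snd',
    ContinuousLinearMap.proj_apply, Sm.fderiv_eq, d_comp, smul_eq_mul, Fin.sum_univ_three, eval, dx,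
    dp, Matrix.cons_val_zero, Matrix.cons_val_one, Matrix.cons_val]
  simp only [covShift, nsmul_eq_mul]
  push_cast
  ring

lemma fderiv_fn (q : Quad) {A : Vec → Vec} (hA : ContDiff ℝ ∞ A) (ξ v : Phase) :
    fderiv ℝ (q.fn A) ξ v =
      (v.1 0 * (q.dx 0).eval (covShift A ξ) + v.1 1 * (q.dx 1).eval (covShift A ξ)
        + v.1 2 * (q.dx 2).eval (covShift A ξ))
      + ∑ i, q.dp i (covShift A ξ) * (v.2 i + (v.1 0 * partialX 0 (fun y => A y i) ξ.1
        + v.1 1 * partialX 1 (fun y => A y i) ξ.1 + v.1 2 * partialX 2 (fun y => A y i) ξ.1)) := by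
  obtain ⟨L, hL, h⟩ := q.exists_hasFDerivAt A hA ξ
  rw [hL.fderiv, h]

/-- The bracket of two polynomials in the covariant momenta of the field `B`. -/
def bracket (B : Vec → Vec) (F G : Quad) (η : Phase) : ℝ :=
  ((F.dx 0).eval η * G.dp 0 η + (F.dx 1).eval η * G.dp 1 η + (F.dx 2).eval η * G.dp 2 η)
  - ((G.dx 0).eval η * F.dp 0 η + (G.dx 1).eval η * F.dp 1 η + (G.dx 2).eval η * F.dp 2 η)
  - (B η.1 0 * (F.dp 1 η * G.dp 2 η - F.dp 2 η * G.dp 1 η)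
    + B η.1 1 * (F.dp 2 η * G.dp 0 η - F.dp 0 η * G.dp 2 η)
    + B η.1 2 * (F.dp 0 η * G.dp 1 η - F.dp 1 η * G.dp 0 η))

/-- Position derivatives of the covariant momenta produce derivatives of `A`. In the antisymmetric
bracket only their antisymmetric combinations survive, and these are the components of the curl. -/
lemma poisson_fn {A B : Vec → Vec} (hA : ContDiff ℝ ∞ A) (hB : ∀ x, curl A x = B x) (F G : Quad)
    (ξ : Phase) : poisson (F.fn A) (G.fn A) ξ = bracket B F G (covShift A ξ) := by
  have hx : (covShift A ξ).1 = ξ.1 := rfl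
  simp only [poisson, fderiv_fn _ hA, Fin.sum_univ_three, bracket, hx, ← hB]
  simp [curl]
  ring

end Quad

lemma covShift_surjective (A : Vec → Vec) (η : Phase) : ∃ ξ, covShift A ξ = η :=
  ⟨(η.1, η.2 - A η.1), by simp [covShift]⟩

lemma Quad.bracket_eq_zero {A B : Vec → Vec} (hA : ContDiff ℝ ∞ A) (hB : ∀ x, curl A x = B x)
    {F G : Quad} : (∀ ξ, poisson (F.fn A) (G.fn A) ξ = 0) ↔ ∀ η, bracket B F G η = 0 := by
  constructor
  · intro h η
    obtain ⟨ξ, rfl⟩ := covShift_surjective A η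
    rw [← Quad.poisson_fn hA hB, h]
  · intro h ξ
    rw [Quad.poisson_fn hA hB, h]

/-! ### Comparison of coefficients and zero sets of analytic functions. -/

lemma cubic_coeff_one {a b c d : ℝ} (h : ∀ t : ℝ, a + b * t + c * t ^ 2 + d * t ^ 3 = 0) :
    a = 0 ∧ b = 0 ∧ c = 0 ∧ d = 0 := by
  have h0 := h 0; have h1 := h 1; have h2 := h (-1); have h3 := h 2
  refine ⟨?_, ?_, ?_, ?_⟩ <;> linarith

/-- Brackets of polynomials of degree two have degree at most three in the momenta, so this one
statement extracts all determining equations. -/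
lemma cubic_coeff {c000 c100 c010 c001 c200 c110 c101 c020 c011 c002
    c300 c210 c201 c120 c111 c102 c030 c021 c012 c003 : ℝ}
    (h : ∀ p q r : ℝ, c000 + c100 * p + c010 * q + c001 * r + c200 * p ^ 2 + c110 * p * q
      + c101 * p * r + c020 * q ^ 2 + c011 * q * r + c002 * r ^ 2 + c300 * p ^ 3 + c210 * p ^ 2 * q
      + c201 * p ^ 2 * r + c120 * p * q ^ 2 + c111 * p * q * r + c102 * p * r ^ 2 + c030 * q ^ 3
      + c021 * q ^ 2 * r + c012 * q * r ^ 2 + c003 * r ^ 3 = 0) :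
    (c000 = 0 ∧ c100 = 0 ∧ c010 = 0 ∧ c001 = 0) ∧
    (c200 = 0 ∧ c110 = 0 ∧ c101 = 0 ∧ c020 = 0 ∧ c011 = 0 ∧ c002 = 0) ∧
    (c300 = 0 ∧ c210 = 0 ∧ c201 = 0 ∧ c120 = 0 ∧ c111 = 0 ∧ c102 = 0 ∧ c030 = 0 ∧ c021 = 0 ∧
      c012 = 0 ∧ c003 = 0) := by
  have h1 : ∀ q r : ℝ, _ := fun q r => cubic_coeff_one (a := c000 + c010 * q + c001 * r
    + c020 * q ^ 2 + c011 * q * r + c002 * r ^ 2 + c030 * q ^ 3 + c021 * q ^ 2 * r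
    + c012 * q * r ^ 2 + c003 * r ^ 3)
    (b := c100 + c110 * q + c101 * r + c120 * q ^ 2 + c111 * q * r + c102 * r ^ 2)
    (c := c200 + c210 * q + c201 * r) (d := c300)
    (fun p => by linear_combination h p q r)
  have ha : ∀ r : ℝ, _ := fun r => cubic_coeff_one (a := c000 + c001 * r + c002 * r ^ 2
    + c003 * r ^ 3) (b := c010 + c011 * r + c012 * r ^ 2) (c := c020 + c021 * r) (d := c030)
    (fun q => by linear_combination (h1 q r).1)
  have hb : ∀ r : ℝ, _ := fun r => cubic_coeff_one (a := c100 + c101 * r + c102 * r ^ 2)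
    (b := c110 + c111 * r) (c := c120) (d := 0) (fun q => by linear_combination (h1 q r).2.1)
  have hc : ∀ r : ℝ, _ := fun r => cubic_coeff_one (a := c200 + c201 * r)
    (b := c210) (c := 0) (d := 0) (fun q => by linear_combination (h1 q r).2.2.1)
  have a1 := cubic_coeff_one fun r => (ha r).1
  have a2 := cubic_coeff_one (a := c010) (b := c011) (c := c012) (d := 0)
    fun r => by linear_combination (ha r).2.1
  have a3 := cubic_coeff_one (a := c020) (b := c021) (c := 0) (d := 0)
    fun r => by linear_combination (ha r).2.2.1
  have b1 := cubic_coeff_one (a := c100) (b := c101) (c := c102) (d := 0)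
    fun r => by linear_combination (hb r).1
  have b2 := cubic_coeff_one (a := c110) (b := c111) (c := 0) (d := 0)
    fun r => by linear_combination (hb r).2.1
  have c1 := cubic_coeff_one (a := c200) (b := c201) (c := 0) (d := 0)
    fun r => by linear_combination (hc r).1
  exact ⟨⟨a1.1, b1.1, a2.1, a1.2.1⟩,
    ⟨c1.1, b2.1, b1.2.1, a3.1, a2.2.1, a1.2.2.1⟩,
    ⟨(h1 0 0).2.2.2, (hc 0).2.1, c1.2.1, (hb 0).2.2.1, b2.2.1, b1.2.2.1, (ha 0).2.2.2, a3.2.1,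
      a2.2.2.1, a1.2.2.2⟩⟩

/-- The identity theorem: an analytic function vanishing on a non-empty open set vanishes
everywhere. -/
lemma dense_ne_zero_of_analytic {V : Type*} [NormedAddCommGroup V] [NormedSpace ℝ V]
    {f : V → ℝ} (hf : ContDiff ℝ ω f) {x₀ : V} (h0 : f x₀ ≠ 0) :
    Dense {x | f x ≠ 0} := by
  rw [dense_iff_inter_open]
  rintro U hU ⟨y, hy⟩
  by_contra hne
  have hz : f =ᶠ[nhds y] 0 := by
    filter_upwards [hU.mem_nhds hy] with z hz
    by_contra hfz
    exact hne ⟨z, hz, hfz⟩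
  exact h0 (congrFun (AnalyticOnNhd.eq_of_eventuallyEq (fun x _ => hf.contDiffAt.analyticAt)
    (fun x _ => analyticAt_const) hz) x₀)

/-! ### Euler and rotation fields in the plane, cancellation of regular factors. -/

namespace Sm

/-- The Euler field `x ∂_x + y ∂_y`. -/
def eul (f : Sm) : Sm := X 0 * d 0 f + X 1 * d 1 f

/-- The rotation field `x ∂_y - y ∂_x`. -/
def rot (f : Sm) : Sm := X 0 * d 1 f - X 1 * d 0 f

@[simp] lemma eul_add (f g : Sm) : eul (f + g) = eul f + eul g := by simp [eul]; ring
@[simp] lemma eul_sub (f g : Sm) : eul (f - g) = eul f - eul g := by simp [eul]; ring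
@[simp] lemma eul_neg (f : Sm) : eul (-f) = -eul f := by simp [eul]; ring
@[simp] lemma eul_mul (f g : Sm) : eul (f * g) = eul f * g + f * eul g := by simp [eul]; ring
@[simp] lemma eul_C (a : ℝ) : eul (C a) = 0 := by simp [eul]
@[simp] lemma eul_zero : eul 0 = 0 := by simp [eul]
@[simp] lemma eul_pow (f : Sm) (n : ℕ) : eul (f ^ n) = n * f ^ (n - 1) * eul f := by
  simp [eul]; ring
@[simp] lemma eul_X0 : eul (X 0) = X 0 := by simp [eul]
@[simp] lemma eul_X1 : eul (X 1) = X 1 := by simp [eul]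
@[simp] lemma rot_add (f g : Sm) : rot (f + g) = rot f + rot g := by simp [rot]; ring
@[simp] lemma rot_sub (f g : Sm) : rot (f - g) = rot f - rot g := by simp [rot]; ring
@[simp] lemma rot_mul (f g : Sm) : rot (f * g) = rot f * g + f * rot g := by simp [rot]; ring
@[simp] lemma rot_C (a : ℝ) : rot (C a) = 0 := by simp [rot]
@[simp] lemma rot_zero : rot 0 = 0 := by simp [rot]
@[simp] lemma rot_ofNat (n : ℕ) [n.AtLeastTwo] : rot (ofNat(n) : Sm) = 0 := by simp [rot]
@[simp] lemma rot_pow (f : Sm) (n : ℕ) : rot (f ^ n) = n * f ^ (n - 1) * rot f := by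
  simp [rot]; ring
@[simp] lemma rot_X0 : rot (X 0) = -X 1 := by simp [rot]
@[simp] lemma rot_X1 : rot (X 1) = X 0 := by simp [rot]
lemma rot_eul (f : Sm) : rot (eul f) = eul (rot f) := by simp [rot, eul]; ring

/-- The square of the distance from the axis. -/
def rho : Sm := X 0 ^ 2 + X 1 ^ 2

@[simp] lemma eul_rho : eul rho = 2 * rho := by simp [rho]; ring
@[simp] lemma rot_rho : rot rho = 0 := by simp [rho]; ring

lemma rho_d0 (f : Sm) : rho * d 0 f = X 0 * eul f - X 1 * rot f := by simp [rho, eul, rot]; ring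
lemma rho_d1 (f : Sm) : rho * d 1 f = X 1 * eul f + X 0 * rot f := by simp [rho, eul, rot]; ring

/-- Smooth functions which vanish on no non-empty open set. -/
def Regular (p : Sm) : Prop := ∀ f : Sm, p * f = 0 → f = 0

lemma regular_of_dense {p : Sm} (hp : Dense {x | p x ≠ 0}) : p.Regular := by
  intro f h
  ext x
  have : (f : Vec → ℝ) = fun _ => 0 := by
    refine Continuous.ext_on hp f.contDiff.continuous continuous_const fun y hy => ?_
    exact (mul_eq_zero.1 (congrArg (fun g : Sm => g y) h)).resolve_left hy
  exact congrFun this x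

lemma regular_of_analytic {p : Sm} (hp : ContDiff ℝ ω (p : Vec → ℝ)) {x₀ : Vec}
    (h : p x₀ ≠ 0) : p.Regular :=
  regular_of_dense (dense_ne_zero_of_analytic hp h)

lemma regular_two : Regular 2 := regular_of_analytic (x₀ := 0) contDiff_const (show (2 : ℝ) ≠ 0 by norm_num)

lemma regular_rho : rho.Regular :=
  regular_of_analytic (x₀ := ![1, 0, 0])
    (show ContDiff ℝ ω (fun x : Vec => x 0 ^ 2 + x 1 ^ 2) by fun_prop) (by simp [rho])

end Sm
namespace Sm

/-- Apply the Euler field to the hypothesis and multiply by `eul f`: the other term contains `f *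
eul f`, so the cube of `eul f` vanishes. -/
lemma eul_eq_zero_of_mul {f : Sm} (h : f * eul f = 0) : eul f = 0 := by
  have h' := congrArg eul h
  simp only [eul_mul, eul_zero] at h'
  apply eq_zero_of_pow (n := 3)
  linear_combination eul f * h' - eul (eul f) * h

lemma rot_eq_zero_of_mul {f : Sm} (h : f * rot f = 0) : rot f = 0 := by
  have h' := congrArg rot h
  simp only [rot_mul, rot_zero] at h'
  apply eq_zero_of_pow (n := 3)
  linear_combination rot f * h' - rot (rot f) * h

lemma eq_zero_of_rho {f : Sm} (h : rho * f = 0) : f = 0 := regular_rho f h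

lemma eq_of_rho {f g : Sm} (h : rho * f = rho * g) : f = g :=
  sub_eq_zero.1 (regular_rho _ (by linear_combination h))

lemma eq_of_two {f g : Sm} (h : 2 * f = 2 * g) : f = g :=
  sub_eq_zero.1 (regular_two _ (by linear_combination h))

lemma exists_C_of_eul_rot {f : Sm} (he : eul f = 0) (hr : rot f = 0) (hz : d 2 f = 0) :
    ∃ c, f = C c := by
  refine exists_C_of_d (eq_zero_of_rho ?_) (eq_zero_of_rho ?_) hz
  · rw [rho_d0, he, hr]; ring
  · rw [rho_d1, he, hr]; ring

/-- A smooth rotation-invariant planar function that is homogeneous of degree two is a multiple of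
`x² + y²`. -/
lemma exists_rho_of_eul_rot {f : Sm} (he : eul f = 2 * f) (hr : rot f = 0) (hz : d 2 f = 0) :
    ∃ c, f = C c * rho := by
  have h0 : rho * d 0 f = 2 * X 0 * f := by rw [rho_d0, he, hr]; ring
  have h1 : rho * d 1 f = 2 * X 1 * f := by rw [rho_d1, he, hr]; ring
  have h01 := congrArg (d 1) h0
  have h11 := congrArg (d 1) h1
  have h00 := congrArg (d 0) h0
  simp [rho] at h01 h11 h00
  -- Away from the axis `f` can only be a multiple of `ρ` on each ray. The aim is to show that the
  -- Hessian is a constant multiple of the identity: first the mixed derivative vanishes, then the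
  -- two pure ones agree, hence they have zero gradient.
  have k01 : d 0 (d 1 f) = 0 := by
    apply regular_rho; apply regular_rho
    simp only [rho] at *
    linear_combination (X 0 ^ 2 + X 1 ^ 2) * h01 + 2 * X 0 * h1 - 2 * X 1 * h0
  have k00 : rho * rho * d 0 (d 0 f) = 2 * rho * f := by
    simp only [rho] at *
    linear_combination (X 0 ^ 2 + X 1 ^ 2) * h00
  have k11 : rho * rho * d 1 (d 1 f) = 2 * rho * f := by
    simp only [rho] at *
    linear_combination (X 0 ^ 2 + X 1 ^ 2) * h11
  have kk : d 0 (d 0 f) = d 1 (d 1 f) := eq_of_rho (eq_of_rho (by linear_combination k00 - k11))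
  obtain ⟨c, hc⟩ : ∃ c, d 0 (d 0 f) = C c := by
    refine exists_C_of_d ?_ ?_ ?_
    · rw [kk]
      have := congrArg (d 1) k01
      simpa using this
    · have := congrArg (d 0) k01
      simpa using this
    · simp [hz]
  refine ⟨c / 2, eq_of_two (eq_of_rho (eq_of_rho ?_))⟩
  have : (2 : Sm) * C (c / 2) = C c := by
    rw [show (2 : Sm) = C 2 from (map_ofNat C 2).symm, ← map_mul]; congr 1; ring
  rw [hc] at k00
  linear_combination -rho * k00 - rho ^ 3 * this

/-- The real part of `(a - i b) (x + i y)²`. -/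
def quadRe (a b : ℝ) : Sm := C a * (X 0 ^ 2 - X 1 ^ 2) + 2 * C b * (X 0 * X 1)

/-- The imaginary part of `(a - i b) (x + i y)²`. -/
def quadIm (a b : ℝ) : Sm := 2 * C a * (X 0 * X 1) - C b * (X 0 ^ 2 - X 1 ^ 2)

lemma regular_quadIm {a b : ℝ} (h : ¬(a = 0 ∧ b = 0)) : (quadIm a b).Regular := by
  have hp : ContDiff ℝ ω (quadIm a b : Vec → ℝ) :=
    show ContDiff ℝ ω (fun x : Vec => 2 * a * (x 0 * x 1) - b * (x 0 ^ 2 - x 1 ^ 2)) by fun_prop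
  by_cases ha : a = 0
  · refine regular_of_analytic hp (x₀ := ![1, 0, 0]) ?_
    simpa [quadIm, ha] using h
  · exact regular_of_analytic hp (x₀ := ![1, 1, 0]) (by simp [quadIm, ha])

end Sm

open Sm

/-! ### The planar problem. -/

/-- The equations to which the determining equations reduce when the integrals are invariant under
translations along the axis. -/
structure PlanarSystem (a b : ℝ) (B1 B2 B3 W s1 s2 : Sm) : Prop where
  z1 : d 2 B1 = 0
  z2 : d 2 B2 = 0
  z3 : d 2 B3 = 0
  zW : d 2 W = 0
  zs1 : d 2 s1 = 0
  zs2 : d 2 s2 = 0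
  div : d 0 B1 + d 1 B2 = 0
  rad : X 0 * B1 + X 1 * B2 = 0
  e11 : d 0 s1 = -(X 1 * B2) - C b * B3
  e22 : d 1 s2 = -(X 0 * B1) + C b * B3
  e12 : d 0 s2 + d 1 s1 = X 1 * B1 + X 0 * B2 + 2 * C a * B3
  e3 : C b * (d 1 B1 + d 0 B2) - 2 * C a * d 1 B2 = rot B3
  eW : rot W = s1 * B2 - s2 * B1
  e0 : s1 * d 0 W + s2 * d 1 W = 0
  em : 2 * C a * d 0 (d 1 W) + C b * (d 1 (d 1 W) - d 0 (d 0 W)) + C b * (B1 ^ 2 - B2 ^ 2)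
    - 2 * C a * (B1 * B2) = s1 * d 0 B3 + s2 * d 1 B3

namespace PlanarSystem

variable {a b : ℝ} {B1 B2 B3 W s1 s2 : Sm}

lemma rho_B1 (H : PlanarSystem a b B1 B2 B3 W s1 s2) :
    rho * B1 = -(X 1 * (X 0 * B2 - X 1 * B1)) := by
  simp only [rho]; linear_combination X 0 * H.rad

lemma rho_B2 (H : PlanarSystem a b B1 B2 B3 W s1 s2) :
    rho * B2 = X 0 * (X 0 * B2 - X 1 * B1) := by
  simp only [rho]; linear_combination X 1 * H.rad

/-- The field has no radial component, so its vanishing planar divergence is a statement about the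
angular derivative of its azimuthal component. -/
lemma rot_T (H : PlanarSystem a b B1 B2 B3 W s1 s2) : rot (X 0 * B2 - X 1 * B1) = 0 := by
  have h0 := congrArg (d 0) H.rad
  have h1 := congrArg (d 1) H.rad
  simp at h0 h1
  simp [rot]
  linear_combination -X 1 * h1 - X 0 * h0 + (X 0 ^ 2 + X 1 ^ 2) * H.div

/-- The symmetrised gradient of `(s1, s2)` is given by `e11`, `e22`, `e12`. Here it is contracted
twice with the position vector. Contracting twice with the tangential vector gives `rot_V`, and
contracting once with each gives `eul_V`. -/
lemma eul_U (H : PlanarSystem a b B1 B2 B3 W s1 s2) :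
    eul (X 0 * s1 + X 1 * s2) = X 0 * s1 + X 1 * s2 + quadIm a b * B3 := by
  simp [eul, quadIm]
  linear_combination X 0 ^ 2 * H.e11 + X 1 ^ 2 * H.e22 + X 0 * X 1 * H.e12

lemma rot_V (H : PlanarSystem a b B1 B2 B3 W s1 s2) :
    rot (X 0 * s2 - X 1 * s1) = -(X 0 * s1 + X 1 * s2) - quadIm a b * B3 := by
  simp [rot, quadIm]
  linear_combination X 0 ^ 2 * H.e22 + X 1 ^ 2 * H.e11 - X 0 * X 1 * H.e12
    - (X 0 ^ 2 + X 1 ^ 2) * H.rad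

lemma eul_V (H : PlanarSystem a b B1 B2 B3 W s1 s2) :
    eul (X 0 * s2 - X 1 * s1) + rot (X 0 * s1 + X 1 * s2) = 2 * (X 0 * s2 - X 1 * s1)
      + rho * (X 0 * B2 - X 1 * B1) + 2 * quadRe a b * B3 := by
  simp [rot, eul, quadRe, rho]
  linear_combination 2 * X 0 * X 1 * (H.e22 - H.e11) + (X 0 ^ 2 - X 1 ^ 2) * H.e12

/-- Insert `rho_B1` and `rho_B2` into `e3`. As `T` is rotation invariant, only its Euler derivative
remains, and it enters through the defect `eul T - 2 T` from homogeneity of degree two. -/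
lemma rot_B3 (H : PlanarSystem a b B1 B2 B3 W s1 s2) {T : Sm} (hT : T = X 0 * B2 - X 1 * B1) :
    rho * (rho * rot B3) = -((eul T - 2 * T) * quadIm a b) := by
  have hr := H.rot_T
  have h1 := H.rho_B1
  have h2 := H.rho_B2
  rw [← hT] at hr h1 h2
  have i1 := congrArg (d 1) h1
  have i2 := congrArg (d 0) h2
  have i3 := congrArg (d 1) h2
  have t0 := rho_d0 T
  have t1 := rho_d1 T
  rw [hr] at t0 t1
  rw [← H.e3]
  simp [rho] at i1 i2 i3
  simp only [rho, quadIm] at *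
  linear_combination (X 0 ^ 2 + X 1 ^ 2) * (C b * (i1 + i2) - 2 * C a * i3)
    - C b * (2 * X 1 * h1 + 2 * X 0 * h2 + X 1 * t1 - X 0 * t0)
    + 2 * C a * (2 * X 1 * h2 - X 0 * t1)

lemma rho_rot_W (H : PlanarSystem a b B1 B2 B3 W s1 s2) :
    rho * rot W = (X 0 * B2 - X 1 * B1) * (X 0 * s1 + X 1 * s2) := by
  rw [H.eW]
  linear_combination s1 * H.rho_B2 - s2 * H.rho_B1

/-- `e0` says that `(s1, s2)` is orthogonal to the gradient of `W`. In polar components this is `U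
eul W + V rot W = 0`, and `rho_rot_W` eliminates `rot W`. -/
lemma U_mul_Z (H : PlanarSystem a b B1 B2 B3 W s1 s2) : (X 0 * s1 + X 1 * s2) *
    (rho * eul W + (X 0 * B2 - X 1 * B1) * (X 0 * s2 - X 1 * s1)) = 0 := by
  have h := H.rho_rot_W
  have h0 := H.e0
  simp only [rho, rot, eul] at *
  linear_combination -(X 0 * s2 - X 1 * s1) * h + (X 0 ^ 2 + X 1 ^ 2) * (X 0 ^ 2 + X 1 ^ 2) * h0

/-- With `Z = ρ eul W + T V`, commuting `rot` past `eul` and using `rho_rot_W`, `eul_U`, `rot_V`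
gives `rot Z = (eul T - 2 T) U`. Since `U Z = 0`, this yields `Z rot Z = 0`, and
`rot_eq_zero_of_mul` makes both sides vanish. -/
lemma kappa_U (H : PlanarSystem a b B1 B2 B3 W s1 s2) {T : Sm} (hT : T = X 0 * B2 - X 1 * B1) :
    (eul T - 2 * T) * (X 0 * s1 + X 1 * s2) = 0 ∧
    rot (rho * eul W + T * (X 0 * s2 - X 1 * s1)) = 0 := by
  have hr := H.rot_T
  have hW := H.rho_rot_W
  have hUZ := H.U_mul_Z
  have hU := H.eul_U
  have hV := H.rot_V
  rw [← hT] at hr hW hUZ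
  set U := X 0 * s1 + X 1 * s2
  set V := X 0 * s2 - X 1 * s1
  have e1 := congrArg eul hW
  simp only [eul_mul, eul_rho, hU] at e1
  have hZ : rot (rho * eul W + T * V) = (eul T - 2 * T) * U := by
    simp only [rot_add, rot_mul, rot_rho, rot_eul, hr, hV]
    linear_combination e1 - 2 * hW
  have h0 : rot (rho * eul W + T * V) = 0 := by
    apply rot_eq_zero_of_mul
    rw [hZ]
    linear_combination (eul T - 2 * T) * hUZ
  exact ⟨by rw [← hZ, h0], h0⟩

lemma exists_bphi (H : PlanarSystem a b B1 B2 B3 W s1 s2)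
    (h : eul (X 0 * B2 - X 1 * B1) = 2 * (X 0 * B2 - X 1 * B1)) :
    ∃ k, B1 = -(C k * X 1) ∧ B2 = C k * X 0 := by
  obtain ⟨k, hk⟩ := exists_rho_of_eul_rot h H.rot_T (by simp [H.z1, H.z2])
  refine ⟨k, eq_of_rho ?_, eq_of_rho ?_⟩
  · rw [H.rho_B1, hk]; ring
  · rw [H.rho_B2, hk]; ring

/-- The conclusion in the case of linear fields. -/
def Linear (B1 B2 B3 W s1 s2 : Sm) : Prop :=
  ∃ k k₀ z₀ : ℝ, B1 = -(C k * X 1) ∧ B2 = C k * X 0 ∧ B3 = C k₀ ∧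
    d 0 W = C z₀ * X 0 - C k * s2 ∧ d 1 W = C z₀ * X 1 + C k * s1 ∧
    C z₀ * (X 0 * s1 + X 1 * s2) = 0

lemma linear_of (H : PlanarSystem a b B1 B2 B3 W s1 s2) {k : ℝ} (h1 : B1 = -(C k * X 1))
    (h2 : B2 = C k * X 0) (hB : eul B3 = 0) (hr : rot B3 = 0)
    (hZ : eul (eul W + C k * (X 0 * s2 - X 1 * s1)) = 2 * (eul W + C k * (X 0 * s2 - X 1 * s1)))
    (hZr : rot (eul W + C k * (X 0 * s2 - X 1 * s1)) = 0)
    (hU : (X 0 * s1 + X 1 * s2) * (eul W + C k * (X 0 * s2 - X 1 * s1)) = 0) :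
    Linear B1 B2 B3 W s1 s2 := by
  obtain ⟨k₀, hk₀⟩ := exists_C_of_eul_rot hB hr H.z3
  obtain ⟨z₀, hz₀⟩ := exists_rho_of_eul_rot hZ hZr (by simp [eul, H.zW, H.zs1, H.zs2])
  have hW := H.eW
  rw [h1, h2] at hW
  refine ⟨k, k₀, z₀, h1, h2, hk₀, eq_of_rho ?_, eq_of_rho ?_, eq_zero_of_rho ?_⟩
  · rw [rho_d0]
    simp only [rho] at *
    linear_combination X 0 * hz₀ - X 1 * hW
  · rw [rho_d1]
    simp only [rho] at *
    linear_combination X 1 * hz₀ + X 0 * hW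
  · rw [hz₀] at hU
    linear_combination hU

/-- Writes the second order part of `em` in the polar fields, in which the derivatives of `W` are
known through `Z`, `U` and `V`. -/
lemma rho_lap (a b : ℝ) (W : Sm) :
    rho ^ 2 * (2 * C a * d 0 (d 1 W) + C b * (d 1 (d 1 W) - d 0 (d 0 W))) =
    quadIm a b * (eul (eul W) - rot (rot W) - 2 * eul W) + 2 * quadRe a b *
      (eul (rot W) - rot W) := by
  simp [rho, eul, rot, quadIm, quadRe]; ring

/-- For `(a, b) ≠ 0` the polynomial `quadIm a b` is regular. Each equation `U * f = 0` is
differentiated along the Euler field; by `eul_U` this brings in `quadIm a b * B3`, so that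
information about `f * B3` is obtained although `U` itself cannot be cancelled. -/
lemma linear_of_ne (H : PlanarSystem a b B1 B2 B3 W s1 s2) (hab : ¬(a = 0 ∧ b = 0)) :
    Linear B1 B2 B3 W s1 s2 := by
  have hN := regular_quadIm hab
  obtain ⟨hκ, hZr⟩ := H.kappa_U rfl
  have hU := H.eul_U
  have hB := H.rot_B3 rfl
  have hEκ := congrArg eul hκ
  simp only [eul_mul, hU, eul_zero] at hEκ
  -- Multiplying the Euler derivative of `κ U = 0` by `κ B3` and removing multiples of `κ U` leaves
  -- `quadIm a b * (κ B3)²`.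
  have hκB : (eul (X 0 * B2 - X 1 * B1) - 2 * (X 0 * B2 - X 1 * B1)) * B3 = 0 := by
    apply eq_zero_of_pow (n := 2)
    apply hN
    set κ := eul (X 0 * B2 - X 1 * B1) - 2 * (X 0 * B2 - X 1 * B1)
    linear_combination κ * B3 * hEκ - (B3 * eul κ + κ * B3) * hκ
  have hκr : rot (eul (X 0 * B2 - X 1 * B1) - 2 * (X 0 * B2 - X 1 * B1)) = 0 := by
    rw [rot_sub, rot_eul, H.rot_T, rot_mul, H.rot_T]; simp
  -- Since `κ` is rotation invariant, rotating `κ B3 = 0` gives `κ rot B3 = 0`, and `rot_B3` turns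
  -- this into `κ² quadIm a b = 0`.
  have hκ0 : eul (X 0 * B2 - X 1 * B1) - 2 * (X 0 * B2 - X 1 * B1) = 0 := by
    apply eq_zero_of_pow (n := 2)
    apply hN
    have h := congrArg rot hκB
    rw [rot_mul, hκr, rot_zero] at h
    linear_combination -rho ^ 2 * h +
      (eul (X 0 * B2 - X 1 * B1) - 2 * (X 0 * B2 - X 1 * B1)) * hB
  obtain ⟨k, h1, h2⟩ := H.exists_bphi (by linear_combination hκ0)
  have hT : X 0 * B2 - X 1 * B1 = C k * rho := by rw [h1, h2, rho]; ring
  have hUZ := H.U_mul_Z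
  have hV := H.eul_V
  have hW := H.eW
  have hm := congrArg (fun f => rho ^ 2 * f) H.em
  have hrB : rot B3 = 0 := by
    rw [hκ0] at hB
    exact eq_zero_of_rho (eq_zero_of_rho (by rw [hB]; ring))
  rw [hT] at hZr hUZ hV
  set U := X 0 * s1 + X 1 * s2 with hUdef
  set V := X 0 * s2 - X 1 * s1 with hVdef
  set Z := eul W + C k * V with hZdef
  have hZ0 : rot Z = 0 := by
    apply eq_zero_of_rho
    have : rho * eul W + C k * rho * V = rho * Z := by rw [hZdef]; ring
    rw [this] at hZr
    simpa using hZr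
  have hUZ0 : U * Z = 0 := eq_zero_of_rho (by rw [hZdef]; linear_combination hUZ)
  have hWU : rot W = C k * U := by rw [hW, h1, h2, hUdef]; ring
  have hEW : eul W = Z - C k * V := by rw [hZdef]; ring
  have hlap := rho_lap a b W
  have hrV := H.rot_V
  rw [hWU, hEW] at hlap
  simp only [eul_sub, eul_mul, eul_C, rot_mul, rot_C, hU] at hlap
  have hsB : rho * (s1 * d 0 B3 + s2 * d 1 B3) = U * eul B3 := by
    have h0 := rho_d0 B3
    have h1 := rho_d1 B3
    rw [hrB] at h0 h1
    rw [hUdef]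
    linear_combination s1 * h0 + s2 * h1
  -- The integrability condition `em` of the scalar term, multiplied by `ρ²`, with all second
  -- derivatives of `W` replaced by means of `rot W = k U` and `eul W = Z - k V`.
  have key : quadIm a b * (eul Z - 2 * Z) = rho * (U * eul B3) := by
    simp only [h1, h2] at hm
    have hq : C b * ((-(C k * X 1)) ^ 2 - (C k * X 0) ^ 2) - 2 * C a * (-(C k * X 1) * (C k * X 0))
        = C k ^ 2 * quadIm a b := by rw [quadIm]; ring
    linear_combination hm - hlap - rho ^ 2 * hq + rho * hsB + C k * quadIm a b * hV
  -- From here the chain is: `U Z = 0` gives `U eul Z = 0`; then `key` times `U eul B3` gives `U eul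
  -- B3 = 0`; differentiating once more gives `B3 eul B3 = 0`, so `B3` is constant.
  have hUE : U * eul Z = 0 := by
    apply eq_zero_of_pow (n := 2)
    have h := congrArg eul hUZ0
    simp only [eul_mul, hU, eul_zero] at h
    linear_combination U * eul Z * h - (U + quadIm a b * B3) * eul Z * hUZ0
  have hUB : U * eul B3 = 0 := by
    apply eq_zero_of_pow (n := 2)
    apply eq_zero_of_rho
    linear_combination -U * eul B3 * key + quadIm a b * eul B3 * (hUE - 2 * hUZ0)
  have hEB : eul B3 = 0 := by
    apply eul_eq_zero_of_mul
    apply eq_zero_of_pow (n := 2)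
    apply hN
    have h := congrArg eul hUB
    simp only [eul_mul, hU, eul_zero] at h
    linear_combination B3 * eul B3 * h - (eul B3 * B3 + B3 * eul (eul B3)) * hUB
  refine H.linear_of h1 h2 hEB hrB ?_ hZ0 hUZ0
  have := hN _ (by rw [key, hUB, mul_zero] : quadIm a b * (eul Z - 2 * Z) = 0)
  linear_combination this

/-- A planar function that is homogeneous of degree one is linear. -/
lemma exists_linear {f : Sm} (he : eul f = f) (hr : rot (rot f) = -f) (hz : d 2 f = 0) :
    ∃ p q, f = C p * X 0 + C q * X 1 := by
  have h0 : rho * d 0 f = X 0 * f - X 1 * rot f := by rw [rho_d0, he]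
  have h1 : rho * d 1 f = X 1 * f + X 0 * rot f := by rw [rho_d1, he]
  have g0 : rho * d 0 (rot f) = X 0 * rot f + X 1 * f := by
    rw [rho_d0, ← rot_eul, he, hr]; ring
  have g1 : rho * d 1 (rot f) = X 1 * rot f - X 0 * f := by
    rw [rho_d1, ← rot_eul, he, hr]; ring
  have h01 := congrArg (d 1) h0
  have h11 := congrArg (d 1) h1
  have h00 := congrArg (d 0) h0
  simp only [rho] at *
  simp only [d_sub, d_mul, d_add, d_pow, d_X_self, d_X_01, d_X_10, d10] at h01 h11 h00
  norm_num at h01 h11 h00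
  have k01 : d 0 (d 1 f) = 0 := by
    apply regular_rho; apply regular_rho
    simp only [rho] at *
    linear_combination (X 0 ^ 2 + X 1 ^ 2) * h01 - 2 * X 1 * h0 + X 0 * h1 - X 1 * g1
  have k00 : d 0 (d 0 f) = 0 := by
    apply regular_rho; apply regular_rho
    simp only [rho] at *
    linear_combination (X 0 ^ 2 + X 1 ^ 2) * h00 - X 0 * h0 - X 1 * g0
  have k11 : d 1 (d 1 f) = 0 := by
    apply regular_rho; apply regular_rho
    simp only [rho] at *
    linear_combination (X 0 ^ 2 + X 1 ^ 2) * h11 - X 1 * h1 + X 0 * g1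
  obtain ⟨p, hp⟩ := exists_C_of_d k00 (by simpa using k01) (by simp [hz])
  obtain ⟨q, hq⟩ := exists_C_of_d k01 k11 (by simp [hz])
  exact ⟨p, q, by rw [← he, eul, hp, hq]; ring⟩

/-- Now `quadIm` vanishes, but the equations for `U` become homogeneous and make it a linear form.
Either it is zero, which gives rotational symmetry, or it is regular and can be cancelled from every
product. -/
lemma linear_or_of_eq (H : PlanarSystem 0 0 B1 B2 B3 W s1 s2) :
    Linear B1 B2 B3 W s1 s2 ∨ (rot W = 0 ∧ rot B3 = 0) := by
  have hrB : rot B3 = 0 := by have := H.e3; simpa using this.symm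
  obtain ⟨hκ, hZr⟩ := H.kappa_U rfl
  have hUZ := H.U_mul_Z
  have hU := H.eul_U
  have hV := H.eul_V
  have hrV := H.rot_V
  have hT := H.rot_T
  have hN : quadIm 0 0 = 0 := by simp [quadIm]
  have hQ : quadRe 0 0 = 0 := by simp [quadRe]
  have hm := H.em
  simp only [hN, hQ, map_zero, mul_zero, zero_mul, add_zero, sub_zero] at hU hV hrV hm
  -- Rotating `eul_V` eliminates `V` through `rot_V`.
  have hrr : rot (rot (X 0 * s1 + X 1 * s2)) = -(X 0 * s1 + X 1 * s2) := by
    have h := congrArg rot hV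
    rw [rot_add (eul _), rot_eul, hrV, rot_add (2 * _), rot_mul 2, hrV, rot_mul rho, hT, eul_neg, hU] at h
    simp only [rot_ofNat, rot_rho] at h
    linear_combination h
  obtain ⟨p, q, hpq⟩ := exists_linear hU hrr (by simp [H.zs1, H.zs2])
  by_cases h : p = 0 ∧ q = 0
  · right
    refine ⟨eq_zero_of_rho ?_, hrB⟩
    rw [H.rho_rot_W, hpq, h.1, h.2]; simp
  left
  have hreg : (X 0 * s1 + X 1 * s2).Regular := by
    rw [hpq]
    have hp : ContDiff ℝ ω ((C p * X 0 + C q * X 1 : Sm) : Vec → ℝ) :=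
      show ContDiff ℝ ω (fun x : Vec => p * x 0 + q * x 1) by fun_prop
    by_cases h0 : p = 0
    · exact regular_of_analytic hp (x₀ := ![0, 1, 0]) (by simpa [h0] using h)
    · exact regular_of_analytic hp (x₀ := ![1, 0, 0]) (by simpa using h0)
  have hκ0 := hreg _ (by rw [mul_comm]; exact hκ)
  obtain ⟨k, h1, h2⟩ := H.exists_bphi (by linear_combination hκ0)
  have hEB : eul B3 = 0 := by
    apply hreg
    have h0 := rho_d0 B3
    have h1 := rho_d1 B3
    rw [hrB] at h0 h1
    linear_combination rho * -hm - s1 * h0 - s2 * h1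
  have hT : X 0 * B2 - X 1 * B1 = C k * rho := by rw [h1, h2, rho]; ring
  have hZ := hreg _ hUZ
  rw [hT] at hZ
  have hZ0 : eul W + C k * (X 0 * s2 - X 1 * s1) = 0 :=
    eq_zero_of_rho (by linear_combination hZ)
  exact H.linear_of h1 h2 hEB hrB (by simp only [hZ0]; simp) (by simp only [hZ0]; simp)
    (by rw [hZ0]; simp)

end PlanarSystem

open Sm

/-! ### The determining equations of a commuting pair. -/

/-- The vector field with the given components. -/
def field (B1 B2 B3 : Sm) (x : Vec) : Vec := ![B1 x, B2 x, B3 x]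

/-- The Hamiltonian `p² / 2 + W`. -/
def quadHam (W : Sm) : Quad := ⟨C (1 / 2), 0, C (1 / 2), 0, 0, C (1 / 2), 0, 0, 0, W⟩

/-- The polynomial `l_3 p_3 + a p_1² + b p_1 p_2 + s ⋅ p + m`. -/
def quadLead₁ (a b : ℝ) (s1 s2 s3 m : Sm) : Quad :=
  ⟨C a, C b, 0, -X 1, X 0, 0, s1, s2, s3, m⟩

/-- The polynomial `p_3² + s ⋅ p + m`. -/
def quadLead₂ (s1 s2 s3 m : Sm) : Quad := ⟨0, 0, 0, 0, 0, 1, s1, s2, s3, m⟩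

lemma quadHam_fn (W : Sm) (A : Vec → Vec) : (quadHam W).fn A = ham A (W : Vec → ℝ) := by
  funext ξ
  simp [Quad.fn, Quad.eval, quadHam, ham, covShift, Fin.sum_univ_three]
  ring

/-- The equations satisfied by the coefficients of a commuting pair of integrals. -/
structure PairSystem (a b : ℝ) (B1 B2 B3 W S1 S2 S3 M s1 s2 s3 m : Sm) : Prop where
  div : d 0 B1 + d 1 B2 + d 2 B3 = 0
  a00 : d 0 S1 = 0
  a01 : d 0 S2 + d 1 S1 = 0
  a11 : d 1 S2 = 0
  a02 : d 0 S3 + d 2 S1 = 2 * B2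
  a12 : d 1 S3 + d 2 S2 = -(2 * B1)
  a22 : d 2 S3 = 0
  aM0 : d 0 M = B2 * S3 - B3 * S2
  aM1 : d 1 M = B3 * S1 - B1 * S3
  aM2 : d 2 M = 2 * d 2 W + (B1 * S2 - B2 * S1)
  aW : S1 * d 0 W + S2 * d 1 W + S3 * d 2 W = 0
  b00 : d 0 s1 = -(X 1 * B2) - C b * B3
  b11 : d 1 s2 = -(X 0 * B1) + C b * B3
  b22 : d 2 s3 = X 0 * B1 + X 1 * B2
  b01 : d 0 s2 + d 1 s1 = X 1 * B1 + X 0 * B2 + 2 * C a * B3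
  b02 : d 0 s3 + d 2 s1 = C b * B1 - 2 * C a * B2 - X 0 * B3
  b12 : d 1 s3 + d 2 s2 = -(C b * B2) - X 1 * B3
  bm0 : d 0 m = 2 * C a * d 0 W + C b * d 1 W - X 1 * d 2 W + (B2 * s3 - B3 * s2)
  bm1 : d 1 m = C b * d 0 W + X 0 * d 2 W + (B3 * s1 - B1 * s3)
  bm2 : d 2 m = X 0 * d 1 W - X 1 * d 0 W + (B1 * s2 - B2 * s1)
  bW : s1 * d 0 W + s2 * d 1 W + s3 * d 2 W = 0
  c00 : 2 * C a * d 0 S1 + C b * d 1 S1 - X 1 * d 2 S1 = 0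
  c11 : C b * d 0 S2 + X 0 * d 2 S2 = 0
  c01 : 2 * C a * d 0 S2 + C b * d 0 S1 + C b * d 1 S2 + X 0 * d 2 S1 - X 1 * d 2 S2 = 0
  c22 : 2 * d 2 s3 - (X 0 * d 1 S3 - X 1 * d 0 S3) - 2 * (X 0 * B1 + X 1 * B2) = 0
  c02 : 2 * d 2 s1 - S2 - (-(X 1 * d 0 S1) + X 0 * d 1 S1 + 2 * C a * d 0 S3 + C b * d 1 S3
    - X 1 * d 2 S3) - 2 * (C b * B1 - 2 * C a * B2) = 0
  c12 : 2 * d 2 s2 + S1 - (-(X 1 * d 0 S2) + X 0 * d 1 S2 + C b * d 0 S3 + X 0 * d 2 S3)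
    + 2 * C b * B2 = 0
  cp0 : S1 * d 0 s1 + S2 * d 1 s1 + S3 * d 2 s1 - (s1 * d 0 S1 + s2 * d 1 S1 + s3 * d 2 S1)
    - (2 * C a * d 0 M + C b * d 1 M - X 1 * d 2 M)
    - (B1 * (C b * S3 + X 1 * S2) + B2 * (-(X 1 * S1) - 2 * C a * S3)
      + B3 * (2 * C a * S2 - C b * S1)) = 0
  cp1 : S1 * d 0 s2 + S2 * d 1 s2 + S3 * d 2 s2 - (s1 * d 0 S2 + s2 * d 1 S2 + s3 * d 2 S2)
    - (C b * d 0 M + X 0 * d 2 M)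
    - (-(B1 * (X 0 * S2)) + B2 * (X 0 * S1 - C b * S3) + B3 * (C b * S2)) = 0
  cp2 : 2 * d 2 m + S1 * d 0 s3 + S2 * d 1 s3 + S3 * d 2 s3
    - (s1 * d 0 S3 + s2 * d 1 S3 + s3 * d 2 S3) - (X 0 * d 1 M - X 1 * d 0 M)
    - (2 * (B1 * s2 - B2 * s1) + B1 * (X 0 * S3) + B2 * (X 1 * S3)
      + B3 * (-(X 1 * S2) - X 0 * S1)) = 0

/-- Each bracket is read off pointwise as a cubic polynomial in the momenta. The cubic coefficients
are identically zero because the leading terms commute canonically with one another and with `p²/2`.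
The momentum-free coefficient of `{X₁, X₂}` is not needed. -/
lemma pairSystem_of_bracket {a b : ℝ} {B1 B2 B3 W S1 S2 S3 M s1 s2 s3 m : Sm}
    (hdiv : d 0 B1 + d 1 B2 + d 2 B3 = 0)
    (h2 : ∀ η, (quadLead₂ S1 S2 S3 M).bracket (field B1 B2 B3) (quadHam W) η = 0)
    (h1 : ∀ η, (quadLead₁ a b s1 s2 s3 m).bracket (field B1 B2 B3) (quadHam W) η = 0)
    (h12 : ∀ η, (quadLead₁ a b s1 s2 s3 m).bracket (field B1 B2 B3) (quadLead₂ S1 S2 S3 M) η = 0) :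
    PairSystem a b B1 B2 B3 W S1 S2 S3 M s1 s2 s3 m := by
  have k2 := fun x : Vec => cubic_coeff
    (c000 := -(S1 * d 0 W + S2 * d 1 W + S3 * d 2 W) x)
    (c100 := (d 0 M - (B2 * S3 - B3 * S2)) x) (c010 := (d 1 M - (B3 * S1 - B1 * S3)) x)
    (c001 := (d 2 M - 2 * d 2 W - (B1 * S2 - B2 * S1)) x)
    (c200 := (d 0 S1) x) (c110 := (d 0 S2 + d 1 S1) x) (c020 := (d 1 S2) x)
    (c101 := (d 0 S3 + d 2 S1 - 2 * B2) x) (c011 := (d 1 S3 + d 2 S2 + 2 * B1) x)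
    (c002 := (d 2 S3) x)
    (c300 := 0) (c210 := 0) (c201 := 0) (c120 := 0) (c111 := 0) (c102 := 0) (c030 := 0)
    (c021 := 0) (c012 := 0) (c003 := 0)
    (fun p q r => by
      have := h2 (x, ![p, q, r])
      simp [Quad.bracket, Quad.eval, Quad.dx, Quad.dp, quadLead₂, quadHam, field] at this ⊢
      linear_combination this)
  have k1 := fun x : Vec => cubic_coeff
    (c000 := -(s1 * d 0 W + s2 * d 1 W + s3 * d 2 W) x)
    (c100 := (d 0 m - (2 * C a * d 0 W + C b * d 1 W - X 1 * d 2 W + (B2 * s3 - B3 * s2))) x)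
    (c010 := (d 1 m - (C b * d 0 W + X 0 * d 2 W + (B3 * s1 - B1 * s3))) x)
    (c001 := (d 2 m - (X 0 * d 1 W - X 1 * d 0 W + (B1 * s2 - B2 * s1))) x)
    (c200 := (d 0 s1 + X 1 * B2 + C b * B3) x)
    (c110 := (d 0 s2 + d 1 s1 - (X 1 * B1 + X 0 * B2 + 2 * C a * B3)) x)
    (c020 := (d 1 s2 + X 0 * B1 - C b * B3) x)
    (c101 := (d 0 s3 + d 2 s1 - (C b * B1 - 2 * C a * B2 - X 0 * B3)) x)
    (c011 := (d 1 s3 + d 2 s2 - (-(C b * B2) - X 1 * B3)) x)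
    (c002 := (d 2 s3 - (X 0 * B1 + X 1 * B2)) x)
    (c300 := 0) (c210 := 0) (c201 := 0) (c120 := 0) (c111 := 0) (c102 := 0) (c030 := 0)
    (c021 := 0) (c012 := 0) (c003 := 0)
    (fun p q r => by
      have := h1 (x, ![p, q, r])
      simp [Quad.bracket, Quad.eval, Quad.dx, Quad.dp, quadLead₁, quadHam, field] at this ⊢
      linear_combination this)
  have k12 := fun x : Vec => cubic_coeff
    (c000 := (S1 * d 0 m + S2 * d 1 m + S3 * d 2 m - (s1 * d 0 M + s2 * d 1 M + s3 * d 2 M)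
      - (B1 * (s2 * S3 - s3 * S2) + B2 * (s3 * S1 - s1 * S3) + B3 * (s1 * S2 - s2 * S1))) x)
    (c100 := (S1 * d 0 s1 + S2 * d 1 s1 + S3 * d 2 s1
      - (s1 * d 0 S1 + s2 * d 1 S1 + s3 * d 2 S1)
      - (2 * C a * d 0 M + C b * d 1 M - X 1 * d 2 M)
      - (B1 * (C b * S3 + X 1 * S2) + B2 * (-(X 1 * S1) - 2 * C a * S3)
        + B3 * (2 * C a * S2 - C b * S1))) x)
    (c010 := (S1 * d 0 s2 + S2 * d 1 s2 + S3 * d 2 s2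
      - (s1 * d 0 S2 + s2 * d 1 S2 + s3 * d 2 S2) - (C b * d 0 M + X 0 * d 2 M)
      - (-(B1 * (X 0 * S2)) + B2 * (X 0 * S1 - C b * S3) + B3 * (C b * S2))) x)
    (c001 := (2 * d 2 m + S1 * d 0 s3 + S2 * d 1 s3 + S3 * d 2 s3
      - (s1 * d 0 S3 + s2 * d 1 S3 + s3 * d 2 S3) - (X 0 * d 1 M - X 1 * d 0 M)
      - (2 * (B1 * s2 - B2 * s1) + B1 * (X 0 * S3) + B2 * (X 1 * S3)
        + B3 * (-(X 1 * S2) - X 0 * S1))) x)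
    (c200 := -(2 * C a * d 0 S1 + C b * d 1 S1 - X 1 * d 2 S1) x)
    (c110 := -(2 * C a * d 0 S2 + C b * d 0 S1 + C b * d 1 S2 + X 0 * d 2 S1 - X 1 * d 2 S2) x)
    (c020 := -(C b * d 0 S2 + X 0 * d 2 S2) x)
    (c101 := (2 * d 2 s1 - S2 - (-(X 1 * d 0 S1) + X 0 * d 1 S1 + 2 * C a * d 0 S3 + C b * d 1 S3
      - X 1 * d 2 S3) - 2 * (C b * B1 - 2 * C a * B2)) x)
    (c011 := (2 * d 2 s2 + S1 - (-(X 1 * d 0 S2) + X 0 * d 1 S2 + C b * d 0 S3 + X 0 * d 2 S3)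
      + 2 * C b * B2) x)
    (c002 := (2 * d 2 s3 - (X 0 * d 1 S3 - X 1 * d 0 S3) - 2 * (X 0 * B1 + X 1 * B2)) x)
    (c300 := 0) (c210 := 0) (c201 := 0) (c120 := 0) (c111 := 0) (c102 := 0) (c030 := 0)
    (c021 := 0) (c012 := 0) (c003 := 0)
    (fun p q r => by
      have := h12 (x, ![p, q, r])
      simp [Quad.bracket, Quad.eval, Quad.dx, Quad.dp, quadLead₁, quadLead₂, field] at this ⊢
      linear_combination this)
  exact
    { div := hdiv
      a00 := Sm.ext fun x => (k2 x).2.1.1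
      a01 := Sm.ext fun x => (k2 x).2.1.2.1
      a11 := Sm.ext fun x => (k2 x).2.1.2.2.2.1
      a02 := sub_eq_zero.1 (Sm.ext fun x => (k2 x).2.1.2.2.1)
      a12 := eq_neg_of_add_eq_zero_left (Sm.ext fun x => (k2 x).2.1.2.2.2.2.1)
      a22 := Sm.ext fun x => (k2 x).2.1.2.2.2.2.2
      aM0 := sub_eq_zero.1 (Sm.ext fun x => (k2 x).1.2.1)
      aM1 := sub_eq_zero.1 (Sm.ext fun x => (k2 x).1.2.2.1)
      aM2 := by
        have : d 2 M - 2 * d 2 W - (B1 * S2 - B2 * S1) = 0 := Sm.ext fun x => (k2 x).1.2.2.2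
        linear_combination this
      aW := Sm.ext fun x => neg_eq_zero.1 (k2 x).1.1
      b00 := by
        have : d 0 s1 + X 1 * B2 + C b * B3 = 0 := Sm.ext fun x => (k1 x).2.1.1
        linear_combination this
      b11 := by
        have : d 1 s2 + X 0 * B1 - C b * B3 = 0 := Sm.ext fun x => (k1 x).2.1.2.2.2.1
        linear_combination this
      b22 := sub_eq_zero.1 (Sm.ext fun x => (k1 x).2.1.2.2.2.2.2)
      b01 := sub_eq_zero.1 (Sm.ext fun x => (k1 x).2.1.2.1)
      b02 := sub_eq_zero.1 (Sm.ext fun x => (k1 x).2.1.2.2.1)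
      b12 := sub_eq_zero.1 (Sm.ext fun x => (k1 x).2.1.2.2.2.2.1)
      bm0 := sub_eq_zero.1 (Sm.ext fun x => (k1 x).1.2.1)
      bm1 := sub_eq_zero.1 (Sm.ext fun x => (k1 x).1.2.2.1)
      bm2 := sub_eq_zero.1 (Sm.ext fun x => (k1 x).1.2.2.2)
      bW := Sm.ext fun x => neg_eq_zero.1 (k1 x).1.1
      c00 := Sm.ext fun x => neg_eq_zero.1 (k12 x).2.1.1
      c11 := Sm.ext fun x => neg_eq_zero.1 (k12 x).2.1.2.2.2.1
      c01 := Sm.ext fun x => neg_eq_zero.1 (k12 x).2.1.2.1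
      c22 := Sm.ext fun x => (k12 x).2.1.2.2.2.2.2
      c02 := Sm.ext fun x => (k12 x).2.1.2.2.1
      c12 := Sm.ext fun x => (k12 x).2.1.2.2.2.2.1
      cp0 := Sm.ext fun x => (k12 x).1.2.1
      cp1 := Sm.ext fun x => (k12 x).1.2.2.1
      cp2 := Sm.ext fun x => (k12 x).1.2.2.2 }

namespace Sm

lemma C_injective : Function.Injective C := fun _ _ h => congrArg (fun f : Sm => f 0) h

lemma C_eq_zero {a : ℝ} : C a = 0 ↔ a = 0 := map_eq_zero_iff C C_injective

lemma C_mul_cancel {a : ℝ} (ha : a ≠ 0) {f : Sm} (h : C a * f = 0) : f = 0 := by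
  have : C a⁻¹ * C a = 1 := by rw [← map_mul, inv_mul_cancel₀ ha, map_one]
  linear_combination C a⁻¹ * h - f * this

lemma two_mul_C_half (a : ℝ) : 2 * C (a / 2) = C a := by
  rw [show (2 : Sm) = C 2 from (map_ofNat C 2).symm, ← map_mul]; congr 1; ring

lemma regular_X (i : Fin 3) : (X i).Regular :=
  regular_of_analytic (x₀ := Pi.single i 1)
    (show ContDiff ℝ ω (fun x : Vec => x i) from contDiff_apply ℝ ℝ i) (by simp)

lemma eq_of_d_eq {f g : Sm} (h0 : d 0 f = d 0 g) (h1 : d 1 f = d 1 g) (h2 : d 2 f = d 2 g) :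
    ∃ c, f = g + C c := by
  obtain ⟨c, hc⟩ := exists_C_of_d (f := f - g) (by simp [h0]) (by simp [h1]) (by simp [h2])
  exact ⟨c, by rw [← hc]; ring⟩

/-- Planar Killing vectors. -/
lemma exists_killing {r1 r2 : Sm} (h11 : d 0 r1 = 0) (h22 : d 1 r2 = 0)
    (h12 : d 0 r2 + d 1 r1 = 0) (hz1 : d 2 r1 = 0) (hz2 : d 2 r2 = 0) :
    ∃ t1 t2 t3, r1 = C t1 - C t3 * X 1 ∧ r2 = C t2 + C t3 * X 0 := by
  have e1 := congrArg (d 0) h12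
  have e2 := congrArg (d 1) h12
  have e3 := congrArg (d 1) h11
  have e4 := congrArg (d 0) h22
  simp at e1 e2 e3 e4
  obtain ⟨t3, h3⟩ := exists_C_of_d (f := d 0 r2) (by linear_combination e1 - e3)
    (by simpa using e4) (by simp [hz2])
  obtain ⟨t1, h1⟩ := eq_of_d_eq (f := r1) (g := -(C t3 * X 1)) (by simp [h11])
    (by simp; linear_combination h12 - h3) (by simp [hz1])
  obtain ⟨t2, h2⟩ := eq_of_d_eq (f := r2) (g := C t3 * X 0) (by simp [h3])
    (by simp [h22]) (by simp [hz2])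
  exact ⟨t1, t2, t3, by rw [h1]; ring, by rw [h2]; ring⟩

end Sm

/-- The fields `(-k y, k x, k₀)` and `W` are those of a member of the family. -/
def IsFamily (a b : ℝ) (B1 B2 B3 W : Sm) : Prop :=
  ∃ k k₀ w₁ w₂ w₃ w₀ : ℝ, B1 = -(C k * X 1) ∧ B2 = C k * X 0 ∧ B3 = C k₀ ∧
    ∀ x, W x = famW a b k k₀ w₁ w₂ w₃ x + w₀

/-- The equations for `(s1, s2)` are inhomogeneous Killing equations. Subtracting an explicit
particular solution leaves a plane motion, whose three constants become the parameters `w₁, w₂, w₃`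
upon integrating the gradient of `W`. -/
lemma isFamily_of_linear {a b k k₀ z₀ : ℝ} {W s1 s2 : Sm}
    (hW0 : d 0 W = C z₀ * X 0 - C k * s2) (hW1 : d 1 W = C z₀ * X 1 + C k * s1)
    (hWz : d 2 W = 0) (hz1 : d 2 s1 = 0) (hz2 : d 2 s2 = 0)
    (e11 : d 0 s1 = -(C k * X 0 * X 1) - C b * C k₀)
    (e22 : d 1 s2 = C k * X 0 * X 1 + C b * C k₀)
    (e12 : d 0 s2 + d 1 s1 = C k * (X 0 ^ 2 - X 1 ^ 2) + 2 * C a * C k₀)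
    (hk : k = 0 → z₀ = 0) :
    ∃ w₁ w₂ w₃ w₀, ∀ x, W x = famW a b k k₀ w₁ w₂ w₃ x + w₀ := by
  have hh := two_mul_C_half k
  obtain ⟨t1, t2, t3, h1, h2⟩ := exists_killing
    (r1 := s1 + C (k / 2) * X 1 * rho - C k₀ * (C a * X 1 - C b * X 0))
    (r2 := s2 - C (k / 2) * X 0 * rho - C k₀ * (C a * X 0 + C b * X 1))
    (by simp [rho, e11]; linear_combination X 0 * X 1 * hh)
    (by simp [rho, e22]; linear_combination -X 0 * X 1 * hh)
    (by simp [rho]; linear_combination e12 - (X 0 ^ 2 - X 1 ^ 2) * hh)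
    (by simp [rho, hz1]) (by simp [rho, hz2])
  -- Both the rotation constant `t3` and `z₀` contribute to the coefficient of `ρ` in `W`, and `w₃`
  -- is fixed by `2 k w₃ = z₀ - k t3`. For `k = 0` the value is immaterial, because then `z₀ = 0`.
  set w₃ : ℝ := -t3 / 2 + (if k = 0 then 0 else z₀ / (2 * k)) with hw₃
  have hkw : 2 * (k * w₃) = -(k * t3) + z₀ := by
    rw [hw₃]
    split_ifs with h
    · simp [h, hk h]
    · field_simp
  obtain ⟨w₀, hw₀⟩ := eq_of_d_eq (f := W) (g := C k * (-(C (1 / 8) * C k * rho ^ 2) + C w₃ * rho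
    - C k₀ * (C (a / 2) * (X 0 ^ 2 - X 1 ^ 2) + C b * X 0 * X 1) + C (-t2) * X 0 + C t1 * X 1))
    (by
      ext x
      have h := congrArg (fun f : Sm => f x) h2
      simp [rho, hW0] at h ⊢
      linear_combination -k * h - x 0 * hkw)
    (by
      ext x
      have h := congrArg (fun f : Sm => f x) h1
      simp [rho, hW1] at h ⊢
      linear_combination k * h - x 1 * hkw)
    (by simp [rho, hWz])
  refine ⟨-t2, t1, w₃, w₀, fun x => ?_⟩
  rw [hw₀]
  simp [famW, rho]

/-- The equations for a pair of commuting first order integrals of cylindrical type. -/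
structure CylSystem (B1 B2 B3 W F s3 : Sm) : Prop where
  F0 : d 0 F = 2 * B2
  F1 : d 1 F = -(2 * B1)
  F2 : d 2 F = 0
  rad : X 0 * B1 + X 1 * B2 = 0
  s0 : d 0 s3 = -(X 0 * B3)
  s1 : d 1 s3 = -(X 1 * B3)
  s2 : d 2 s3 = 0
  W2 : d 2 W = 0
  Wr : rot W = 0

namespace PairSystem

variable {a b : ℝ} {B1 B2 B3 W S1 S2 S3 M s1 s2 s3 m : Sm}

/-- The equations of `X₂` say that `(S1, S2)` is a Killing field in the plane at each height. The
coefficients of `{X₁, X₂}` quadratic in the planar momenta exclude dependence on `z` and couple the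
rotation constant to `a` and `b`. -/
lemma exists_S (H : PairSystem a b B1 B2 B3 W S1 S2 S3 M s1 s2 s3 m) :
    ∃ w σ1 σ2 : ℝ, a * w = 0 ∧ b * w = 0 ∧ S1 = C σ1 - C w * X 1 ∧ S2 = C σ2 + C w * X 0 := by
  have e1 := congrArg (d 0) H.a01
  have e2 := congrArg (d 1) H.a01
  have e2' := congrArg (d 2) H.a01
  have e3 := congrArg (d 1) H.a00
  have e4 := congrArg (d 0) H.a11
  have c00 := H.c00
  have c11 := H.c11
  have c01 := H.c01
  rw [H.a00] at c00 c01
  rw [H.a11] at c01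
  have f1 := congrArg (d 1) c00
  have g1 := congrArg (d 0) c11
  simp at e1 e2 e2' e3 e4 f1 g1
  have e42 := congrArg (d 2) e4
  simp at e42
  have p1 : d 2 S1 = X 1 * d 0 (d 2 S2) := by
    linear_combination -f1 + C b * (e2 - e4) - X 1 * e2'
  have p2 := congrArg (d 1) p1
  simp at p2
  have hw : d 0 (d 2 S2) = 0 :=
    regular_two _ (by linear_combination e2' - p2 - X 1 * e42)
  rw [hw, mul_zero] at p1
  have q1 : d 2 S2 = 0 := by
    linear_combination g1 - C b * (e1 - e3) - X 0 * hw
  obtain ⟨w, hw0⟩ := exists_C_of_d (f := d 0 S2) (by linear_combination e1 - e3)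
    (by simpa using e4) (by simpa using hw)
  obtain ⟨σ1, h1⟩ := eq_of_d_eq (f := S1) (g := -(C w * X 1)) (by simp [H.a00])
    (by simp; linear_combination H.a01 - hw0) (by simp [p1])
  obtain ⟨σ2, h2⟩ := eq_of_d_eq (f := S2) (g := C w * X 0) (by simp [hw0])
    (by simp [H.a11]) (by simp [q1])
  refine ⟨w, σ1, σ2, C_eq_zero.1 ?_, C_eq_zero.1 ?_, by rw [h1]; ring, by rw [h2]; ring⟩
  · rw [map_mul]
    apply regular_two
    rw [p1, q1] at c01
    linear_combination c01 - 2 * C a * hw0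
  · rw [map_mul]
    rw [q1] at c11
    linear_combination c11 - C b * hw0

lemma rot_S3 (H : PairSystem a b B1 B2 B3 W S1 S2 S3 M s1 s2 s3 m) :
    X 0 * d 1 S3 - X 1 * d 0 S3 = 0 := by
  linear_combination -H.c22 + 2 * H.b22

/-- The equations after elimination of the linear terms of the second integral. -/
structure Reduced (a b w σ1 σ2 τ : ℝ) (B1 B2 B3 W F s1 s2 s3 : Sm) : Prop where
  aw : a * w = 0
  bw : b * w = 0
  σw : σ1 * w = 0 ∧ σ2 * w = 0
  z1 : d 2 B1 = 0
  z2 : d 2 B2 = 0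
  z3 : d 2 B3 = 0
  div : d 0 B1 + d 1 B2 = 0
  rad : X 0 * B1 + X 1 * B2 = 0
  F0 : d 0 F = 2 * B2
  F1 : d 1 F = -(2 * B1)
  F2 : d 2 F = 0
  s1z : 2 * d 2 s1 = C σ2
  s2z : 2 * d 2 s2 = -C σ1
  s3z : d 2 s3 = 0
  Wz : 2 * d 2 W = C τ - (B1 * C σ2 - B2 * C σ1)
  b00 : d 0 s1 = -(X 1 * B2) - C b * B3
  b11 : d 1 s2 = -(X 0 * B1) + C b * B3
  b01 : d 0 s2 + d 1 s1 = X 1 * B1 + X 0 * B2 + 2 * C a * B3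
  b02 : d 0 s3 + d 2 s1 = C b * B1 - 2 * C a * B2 - X 0 * B3
  b12 : d 1 s3 + d 2 s2 = -(C b * B2) - X 1 * B3
  aW : (C σ1 - C w * X 1) * d 0 W + (C σ2 + C w * X 0) * d 1 W + F * d 2 W = 0
  bW : s1 * d 0 W + s2 * d 1 W + s3 * d 2 W = 0
  p0 : (C σ1 - C w * X 1) * d 0 s1 + (C σ2 + C w * X 0) * d 1 s1 + F * d 2 s1 + C w * s2
    + 2 * X 1 * d 2 W = 0
  p1 : (C σ1 - C w * X 1) * d 0 s2 + (C σ2 + C w * X 0) * d 1 s2 + F * d 2 s2 - C w * s1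
    - 2 * X 0 * d 2 W = 0
  p2 : 2 * rot W + (C σ1 - C w * X 1) * d 0 s3 + (C σ2 + C w * X 0) * d 1 s3
    = s1 * d 0 F + s2 * d 1 F
  e3 : C b * (d 1 B1 + d 0 B2) - 2 * C a * d 1 B2 = rot B3
  B3d : (C σ1 - C w * X 1) * d 0 B3 + (C σ2 + C w * X 0) * d 1 B3 = 0
  em : 2 * C a * d 0 (d 1 W) + C b * d 1 (d 1 W) - X 1 * d 1 (d 2 W) - d 2 W + d 1 (B2 * s3 - B3 * s2)
    = C b * d 0 (d 0 W) + X 0 * d 0 (d 2 W) + d 2 W + d 0 (B3 * s1 - B1 * s3)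

/-- The scalar terms `m`, `M` are removed by their integrability conditions, and the known form of
`S1, S2` is inserted. The remaining component `F = S3` carries the planar field: its planar gradient
is twice the field rotated by a right angle. -/
lemma exists_reduced (H : PairSystem a b B1 B2 B3 W S1 S2 S3 M s1 s2 s3 m) :
    ∃ w σ1 σ2 τ, Reduced a b w σ1 σ2 τ B1 B2 B3 W S3 s1 s2 s3 := by
  obtain ⟨w, σ1, σ2, aw, bw, rfl, rfl⟩ := H.exists_S
  have Caw : C a * C w = 0 := by rw [← map_mul, aw, map_zero]
  have Cbw : C b * C w = 0 := by rw [← map_mul, bw, map_zero]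
  have F0 : d 0 S3 = 2 * B2 := by simpa using H.a02
  have F1 : d 1 S3 = -(2 * B1) := by simpa using H.a12
  have F2 := H.a22
  have hr := H.rot_S3
  have rad : X 0 * B1 + X 1 * B2 = 0 := by
    apply regular_two
    linear_combination -hr + X 0 * F1 - X 1 * F0
  have F02 := congrArg (d 2) F0
  have F12 := congrArg (d 2) F1
  have F01 := congrArg (d 1) F0
  have F10 := congrArg (d 0) F1
  simp [F2] at F02 F12 F01 F10
  have z1 : d 2 B1 = 0 := regular_two _ F12
  have z2 : d 2 B2 = 0 := regular_two _ F02.symm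
  have div : d 0 B1 + d 1 B2 = 0 := by
    apply regular_two
    linear_combination F10 - F01
  have z3 : d 2 B3 = 0 := by linear_combination H.div - div
  have s3z : d 2 s3 = 0 := by rw [H.b22, rad]
  have c02 := H.c02
  have c12 := H.c12
  simp at c02 c12
  have s1z : 2 * d 2 s1 = C σ2 := by
    linear_combination c02 + 2 * C a * F0 + C b * F1 - X 1 * F2
  have s2z : 2 * d 2 s2 = -C σ1 := by
    linear_combination c12 + C b * F0 + X 0 * F2
  have aM0 := H.aM0
  have aM1 := H.aM1
  have aM2 := H.aM2
  have p0 : (C σ1 - C w * X 1) * d 0 s1 + (C σ2 + C w * X 0) * d 1 s1 + S3 * d 2 s1 + C w * s2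
      + 2 * X 1 * d 2 W = 0 := by
    have := H.cp0
    simp at this
    linear_combination this + 2 * C a * aM0 + C b * aM1 - X 1 * aM2
  have p1 : (C σ1 - C w * X 1) * d 0 s2 + (C σ2 + C w * X 0) * d 1 s2 + S3 * d 2 s2 - C w * s1
      - 2 * X 0 * d 2 W = 0 := by
    have := H.cp1
    simp at this
    linear_combination this + C b * aM0 + X 0 * aM2
  have p0' := congrArg (d 2) p0
  have p1' := congrArg (d 2) p1
  have s1z0 := congrArg (d 0) s1z
  have s1z1 := congrArg (d 1) s1z
  have s1z2 := congrArg (d 2) s1z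
  have s2z0 := congrArg (d 0) s2z
  have s2z1 := congrArg (d 1) s2z
  have s2z2 := congrArg (d 2) s2z
  simp [F2] at p0' p1' s1z0 s1z1 s1z2 s2z0 s2z1 s2z2
  -- The `z`-derivatives of `p0` and `p1`. The left sides vanish on the axis and the right sides are
  -- constant, so `w σ1`, `w σ2` and then the second `z`-derivative of `W` vanish.
  have r0 : 4 * (X 1 * d 2 (d 2 W)) = C w * C σ1 := by
    linear_combination 2 * p0' - C w * s2z - (C σ1 - C w * X 1) * s1z0
      - (C σ2 + C w * X 0) * s1z1 - S3 * s1z2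
  have r1 : 4 * (X 0 * d 2 (d 2 W)) = -(C w * C σ2) := by
    linear_combination -2 * p1' - C w * s1z + (C σ1 - C w * X 1) * s2z0
      + (C σ2 + C w * X 0) * s2z1 + S3 * s2z2
  have σ1w : σ1 * w = 0 := by
    have := congrArg (fun f : Sm => f 0) r0
    simp at this
    rw [mul_comm]; simpa using this
  have σ2w : σ2 * w = 0 := by
    have := congrArg (fun f : Sm => f 0) r1
    simp at this
    rw [mul_comm]; simpa using this
  have W22 : d 2 (d 2 W) = 0 := by
    apply regular_X 1
    apply regular_two
    apply regular_two
    have : C w * C σ1 = 0 := by rw [← map_mul, mul_comm, σ1w, map_zero]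
    linear_combination r0 + this
  have G0 := congrArg (d 2) aM0
  have G1 := congrArg (d 2) aM1
  have K0 := congrArg (d 0) aM2
  have K1 := congrArg (d 1) aM2
  have K2 : d 2 (d 2 M) = 0 := by rw [aM2]; simp [z1, z2, W22]
  simp [z1, z2, z3, F2] at G0 G1
  -- All three partial derivatives of `∂M/∂z` vanish, so it is the constant `τ`.
  obtain ⟨τ, hτ⟩ := exists_C_of_d G0 G1 K2
  have b02' := congrArg (d 1) H.b02
  have b12' := congrArg (d 0) H.b12
  have aM0' := congrArg (d 1) aM0
  have aM1' := congrArg (d 0) aM1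
  have bm0' := congrArg (d 1) H.bm0
  have bm1' := congrArg (d 0) H.bm1
  refine ⟨w, σ1, σ2, τ, ⟨aw, bw, ⟨σ1w, σ2w⟩, z1, z2, z3, div, rad, F0, F1, F2, s1z, s2z, s3z, ?_,
    H.b00, H.b11, H.b01, H.b02, H.b12, H.aW, H.bW, p0, p1, ?_, ?_, ?_, ?_⟩⟩
  · linear_combination hτ - aM2 - C w * rad
  · have := H.cp2
    simp only [rot]
    linear_combination this - 2 * H.bm2 - S3 * s3z + X 0 * aM1 - X 1 * aM0 + s3 * F2
  · simp at b02' b12'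
    apply eq_of_two
    simp only [rot]
    linear_combination 2 * b12' - 2 * b02' + s1z1 - s2z0
  · simp at aM0' aM1'
    linear_combination aM0' - aM1' + B2 * F1 + B1 * F0 + S3 * div
  · simp at bm0' bm1'
    simp
    linear_combination bm1' - bm0'

end PairSystem

/-! ### The three cases for the linear term of the second integral. -/

namespace PairSystem.Reduced

variable {a b w σ1 σ2 τ : ℝ} {B1 B2 B3 W F s1 s2 s3 : Sm}

/-- A non-zero rotation constant kills `a`, `b` and the translations. Combining `p0` and `p1`
tangentially gives `w U = -τ ρ`; the left side is homogeneous of degree one and the right of degree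
two, so `τ = 0`. Hence `W` is independent of `z`, and `aW` becomes `w rot W = 0`. -/
lemma cyl_of_ne (R : Reduced a b w σ1 σ2 τ B1 B2 B3 W F s1 s2 s3) (hw : w ≠ 0) :
    a = 0 ∧ b = 0 ∧ CylSystem B1 B2 B3 W F s3 := by
  obtain rfl : a = 0 := (mul_eq_zero.1 R.aw).resolve_right hw
  obtain rfl : b = 0 := (mul_eq_zero.1 R.bw).resolve_right hw
  obtain rfl : σ1 = 0 := (mul_eq_zero.1 R.σw.1).resolve_right hw
  obtain rfl : σ2 = 0 := (mul_eq_zero.1 R.σw.2).resolve_right hw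
  have b00 := R.b00
  have b11 := R.b11
  have b01 := R.b01
  have b02 := R.b02
  have b12 := R.b12
  have p0 := R.p0
  have p1 := R.p1
  have Wz := R.Wz
  have aW := R.aW
  have s1z : d 2 s1 = 0 := regular_two _ (by rw [R.s1z, map_zero])
  have s2z : d 2 s2 = 0 := regular_two _ (by rw [R.s2z, map_zero, neg_zero])
  simp only [map_zero, mul_zero, zero_mul, add_zero, sub_zero, zero_add, zero_sub, s1z, s2z]
    at b00 b11 b01 b02 b12 p0 p1 Wz aW
  have hU : eul (X 0 * s1 + X 1 * s2) = X 0 * s1 + X 1 * s2 := by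
    simp [eul]
    linear_combination X 0 ^ 2 * b00 + X 1 ^ 2 * b11 + X 0 * X 1 * b01
  have hV : rot (X 0 * s2 - X 1 * s1) = -(X 0 * s1 + X 1 * s2) := by
    simp [rot]
    linear_combination X 0 ^ 2 * b11 + X 1 ^ 2 * b00 - X 0 * X 1 * b01
      - (X 0 ^ 2 + X 1 ^ 2) * R.rad
  have hwV : C w * (X 0 * s1 + X 1 * s2) = -(C τ * rho) := by
    have : C w * rot (X 0 * s2 - X 1 * s1) + C w * (X 0 * s1 + X 1 * s2)
        = C w * (X 0 * s1 + X 1 * s2) + C τ * rho := by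
      simp [rot, rho]
      linear_combination X 0 * p1 - X 1 * p0 + (X 0 ^ 2 + X 1 ^ 2) * Wz
    rw [hV] at this
    linear_combination -this
  have hτ : C τ = 0 := by
    apply eq_zero_of_rho
    have := congrArg eul hwV
    rw [eul_mul, hU] at this
    simp at this
    linear_combination this - hwV
  have W2 : d 2 W = 0 := regular_two _ (by rw [Wz, hτ])
  refine ⟨rfl, rfl, ⟨R.F0, R.F1, R.F2, R.rad, b02, ?_, R.s3z, W2, ?_⟩⟩
  · linear_combination b12
  · apply C_mul_cancel hw
    simp only [rot]
    linear_combination aW - F * W2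

lemma planar_of_eq (R : Reduced a b 0 0 0 τ B1 B2 B3 W F s1 s2 s3) :
    PlanarSystem a b B1 B2 B3 W s1 s2 ∧ d 0 s3 = C b * B1 - 2 * C a * B2 - X 0 * B3 ∧
      d 1 s3 = -(C b * B2) - X 1 * B3 := by
  have s1z : d 2 s1 = 0 := regular_two _ (by rw [R.s1z, map_zero])
  have s2z : d 2 s2 = 0 := regular_two _ (by rw [R.s2z, map_zero, neg_zero])
  have b02 := R.b02
  have b12 := R.b12
  have p0 := R.p0
  have p2 := R.p2
  have em := R.em
  have bW := R.bW
  simp only [map_zero, mul_zero, zero_mul, add_zero, sub_zero, zero_add, s1z, s2z]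
    at b02 b12 p0 p2
  have W2 : d 2 W = 0 := regular_two _ (regular_X 1 _ (by linear_combination p0))
  refine ⟨⟨R.z1, R.z2, R.z3, W2, s1z, s2z, R.div, R.rad, R.b00, R.b11, R.b01, R.e3, ?_, ?_, ?_⟩,
    b02, b12⟩
  · apply eq_of_two
    linear_combination p2 + s1 * R.F0 + s2 * R.F1
  · linear_combination bW - s3 * W2
  · simp [W2] at em
    linear_combination em - B2 * b12 - B1 * b02 - s3 * R.div + B3 * (R.b00 + R.b11)

/-- A translation in `X₂` singles out a direction `σ`, whereas the planar field, given by `F`, is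
rotationally symmetric about the axis. The two are compatible only if the Hessian of `F` vanishes.
Then the planar field is constant and orthogonal to the position vector, hence zero; what is left is
a constant `B3`, excluded by the last equation. -/
lemma false_of_ne (R : Reduced a b 0 σ1 σ2 τ B1 B2 B3 W F s1 s2 s3) (hσ : ¬(σ1 = 0 ∧ σ2 = 0))
    (hne : ¬(B1 = 0 ∧ B2 = 0 ∧ B3 = 0)) : False := by
  have hn : σ1 ^ 2 + σ2 ^ 2 ≠ 0 := by
    intro h
    exact hσ ⟨by nlinarith [sq_nonneg σ1, sq_nonneg σ2], by nlinarith [sq_nonneg σ1, sq_nonneg σ2]⟩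
  have hCn : C (σ1 ^ 2 + σ2 ^ 2) = C σ1 ^ 2 + C σ2 ^ 2 := by simp
  have cancel : ∀ f : Sm, (C σ1 ^ 2 + C σ2 ^ 2) * f = 0 → f = 0 := fun f h =>
    C_mul_cancel hn (by rw [hCn]; exact h)
  have Wz0 := congrArg (d 0) R.Wz
  have Wz1 := congrArg (d 1) R.Wz
  have Wz2 := congrArg (d 2) R.Wz
  have aW := R.aW
  simp only [map_zero, zero_mul, add_zero, sub_zero] at aW
  have aW2 := congrArg (d 2) aW
  simp [R.F2, R.z1, R.z2] at Wz0 Wz1 Wz2 aW2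
  have F00 := congrArg (d 0) R.F0
  have F01 := congrArg (d 1) R.F0
  have F10 := congrArg (d 0) R.F1
  have F11 := congrArg (d 1) R.F1
  simp at F00 F01 F10 F11
  have r : X 0 * d 1 F - X 1 * d 0 F = 0 := by
    linear_combination X 0 * R.F1 - X 1 * R.F0 - 2 * R.rad
  have r00 := congrArg (fun f => d 0 (d 0 f)) r
  have r01 := congrArg (fun f => d 0 (d 1 f)) r
  have r11 := congrArg (fun f => d 1 (d 1 f)) r
  simp at r00 r01 r11
  -- The Hessian of `F` vanishes on `(σ, σ)`. Since `F` is rotation invariant, rotating this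
  -- identity gives its value on `(σ, σ^⊥)` (`g`), and rotating again gives the difference of the
  -- values on `(σ^⊥, σ^⊥)` and `(σ, σ)` (`k`).
  have e : C σ1 ^ 2 * d 0 (d 0 F) + 2 * C σ1 * C σ2 * d 0 (d 1 F) + C σ2 ^ 2 * d 1 (d 1 F) = 0 := by
    linear_combination 4 * aW2 - 2 * C σ1 * Wz0 - 2 * C σ2 * Wz1 - 2 * F * Wz2 + C σ1 ^ 2 * F00
      + C σ1 * C σ2 * F01 + C σ1 * C σ2 * F10 + C σ2 ^ 2 * F11
  have e0 := congrArg (d 0) e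
  have e1 := congrArg (d 1) e
  simp at e0 e1
  have g : (C σ1 ^ 2 - C σ2 ^ 2) * d 0 (d 1 F) + C σ1 * C σ2 * (d 1 (d 1 F) - d 0 (d 0 F)) = 0 := by
    apply regular_two
    linear_combination C σ1 ^ 2 * r00 + 2 * C σ1 * C σ2 * r01 + C σ2 ^ 2 * r11
      - X 0 * e1 + X 1 * e0
  have g0 := congrArg (d 0) g
  have g1 := congrArg (d 1) g
  simp at g0 g1
  have k : -(4 * C σ1 * C σ2 * d 0 (d 1 F)) + (C σ1 ^ 2 - C σ2 ^ 2) * (d 1 (d 1 F) - d 0 (d 0 F))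
      = 0 := by
    linear_combination -(C σ1 * C σ2) * r00 + (C σ1 ^ 2 - C σ2 ^ 2) * r01 + C σ1 * C σ2 * r11
      - X 0 * g1 + X 1 * g0
  have f01 : d 0 (d 1 F) = 0 := by
    apply cancel; apply cancel
    linear_combination (C σ1 ^ 2 - C σ2 ^ 2) * g - C σ1 * C σ2 * k
  have fd : d 1 (d 1 F) - d 0 (d 0 F) = 0 := by
    apply cancel; apply cancel
    linear_combination (C σ1 ^ 2 - C σ2 ^ 2) * k + 4 * C σ1 * C σ2 * g
  have f00 : d 0 (d 0 F) = 0 := by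
    apply cancel
    linear_combination e - C σ2 ^ 2 * fd - 2 * C σ1 * C σ2 * f01
  rw [f00] at F00
  rw [f01] at F01 F10
  rw [f00, sub_zero] at fd
  rw [fd] at F11
  have d0B2 : d 0 B2 = 0 := regular_two _ F00.symm
  have d1B2 : d 1 B2 = 0 := regular_two _ F01.symm
  have d0B1 : d 0 B1 = 0 := regular_two _ (by linear_combination F10)
  have d1B1 : d 1 B1 = 0 := regular_two _ (by linear_combination F11)
  have hB1 : B1 = 0 := by
    have := congrArg (d 0) R.rad
    simpa [d0B1, d0B2] using this
  have hB2 : B2 = 0 := by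
    have := congrArg (d 1) R.rad
    simpa [d1B1, d1B2] using this
  subst hB1 hB2
  have F0 : d 0 F = 0 := by simpa using R.F0
  have F1 : d 1 F = 0 := by simpa using R.F1
  have B3d := R.B3d
  have rB : X 0 * d 1 B3 - X 1 * d 0 B3 = 0 := by
    have := R.e3
    simpa [rot] using this.symm
  simp only [map_zero, zero_mul, add_zero, sub_zero] at B3d
  have rB0 := congrArg (d 0) rB
  have rB1 := congrArg (d 1) rB
  have Bd0 := congrArg (d 0) B3d
  have Bd1 := congrArg (d 1) B3d
  simp at rB0 rB1 Bd0 Bd1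
  -- `rot B3 = 0` is differentiated along `σ`; with the constancy of `B3` along `σ` this gives
  -- constancy along the orthogonal direction.
  have B3p : C σ1 * d 1 B3 - C σ2 * d 0 B3 = 0 := by
    linear_combination C σ1 * rB0 + C σ2 * rB1 - X 0 * Bd1 + X 1 * Bd0
  obtain ⟨k₀, rfl⟩ : ∃ k₀, B3 = C k₀ :=
    exists_C_of_d (cancel _ (by linear_combination C σ1 * B3d - C σ2 * B3p))
      (cancel _ (by linear_combination C σ2 * B3d + C σ1 * B3p)) R.z3
  have hk₀ : k₀ ≠ 0 := by
    rintro rfl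
    exact hne ⟨rfl, rfl, map_zero C⟩
  have p0 := congrArg (d 1) R.p0
  have Wz := R.Wz
  have b00 := congrArg (d 1) R.b00
  have b01 := congrArg (d 1) R.b01
  have b11 := congrArg (d 0) R.b11
  have s1z1 := congrArg (d 1) R.s1z
  simp [F1] at p0 b00 b01 b11 s1z1 Wz1 Wz
  have hτ : C τ = 0 := by
    apply regular_two
    linear_combination 2 * p0 - 2 * C σ1 * b00 - 2 * C σ2 * (b01 - b11) - F * s1z1
      - 2 * X 1 * Wz1 - 2 * Wz
  have W2 : d 2 W = 0 := regular_two _ (by rw [Wz, hτ])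
  have bW := congrArg (d 2) R.bW
  simp [W2] at bW
  have bW' : C σ2 * d 0 W - C σ1 * d 1 W = 0 := by
    linear_combination 2 * bW - d 0 W * R.s1z - d 1 W * R.s2z
  have W0 : d 0 W = 0 := cancel _ (by linear_combination C σ1 * aW + C σ2 * bW' - C σ1 * F * W2)
  have W1 : d 1 W = 0 := cancel _ (by linear_combination C σ2 * aW - C σ1 * bW' - C σ2 * F * W2)
  have p2 := R.p2
  simp [rot, W0, W1, F0, F1] at p2
  have b02 := R.b02
  have b12 := R.b12
  simp at b02 b12
  -- With `W` constant, `p2` says that `s3` does not change along `σ`, while `b02` and `b12` compute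
  -- that change as a multiple of `k₀ (σ·x)`.
  have key : C k₀ * (C σ1 * X 0 + C σ2 * X 1) = 0 := by
    apply regular_two
    linear_combination -2 * p2 + 2 * C σ1 * b02 + 2 * C σ2 * b12 - C σ1 * R.s1z - C σ2 * R.s2z
  have key' := C_mul_cancel hk₀ key
  have key0 := congrArg (d 0) key'
  have key1 := congrArg (d 1) key'
  simp at key0 key1
  exact hσ ⟨C_eq_zero.1 key0, C_eq_zero.1 key1⟩

end PairSystem.Reduced

/-- The uniqueness statement in terms of the coefficients. -/
theorem PairSystem.isFamily_or_cyl {a b : ℝ} {B1 B2 B3 W S1 S2 S3 M s1 s2 s3 m : Sm}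
    (H : PairSystem a b B1 B2 B3 W S1 S2 S3 M s1 s2 s3 m) (hne : ¬(B1 = 0 ∧ B2 = 0 ∧ B3 = 0)) :
    IsFamily a b B1 B2 B3 W ∨ (a = 0 ∧ b = 0 ∧ CylSystem B1 B2 B3 W S3 s3) := by
  obtain ⟨w, σ1, σ2, τ, R⟩ := H.exists_reduced
  by_cases hw : w = 0
  swap
  · exact Or.inr (R.cyl_of_ne hw)
  subst hw
  by_cases hσ : σ1 = 0 ∧ σ2 = 0
  swap
  · exact (R.false_of_ne hσ hne).elim
  obtain ⟨rfl, rfl⟩ := hσ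
  obtain ⟨P, s30, s31⟩ := R.planar_of_eq
  have fam : ∀ k k₀ z₀ : ℝ, B1 = -(C k * X 1) → B2 = C k * X 0 → B3 = C k₀ →
      d 0 W = C z₀ * X 0 - C k * s2 → d 1 W = C z₀ * X 1 + C k * s1 → (k = 0 → z₀ = 0) →
      IsFamily a b B1 B2 B3 W := by
    intro k k₀ z₀ h1 h2 h3 hW0 hW1 hk
    have e11 := P.e11
    have e22 := P.e22
    have e12 := P.e12
    rw [h1, h3] at e22 e12
    rw [h2, h3] at e11
    rw [h2] at e12
    obtain ⟨w₁, w₂, w₃, w₀, h⟩ := isFamily_of_linear (a := a) (b := b) (k₀ := k₀) hW0 hW1 P.zW P.zs1 P.zs2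
      (by linear_combination e11) (by linear_combination e22) (by linear_combination e12) hk
    exact ⟨k, k₀, w₁, w₂, w₃, w₀, h1, h2, h3, h⟩
  by_cases hab : a = 0 ∧ b = 0
  · by_cases hU : X 0 * s1 + X 1 * s2 = 0
    · obtain ⟨rfl, rfl⟩ := hab
      refine Or.inr ⟨rfl, rfl, ⟨R.F0, R.F1, R.F2, R.rad, ?_, ?_, R.s3z, P.zW, ?_⟩⟩
      · simpa using s30
      · simpa using s31
      · exact eq_zero_of_rho (by rw [P.rho_rot_W, hU, mul_zero])
    · obtain ⟨rfl, rfl⟩ := hab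
      rcases P.linear_or_of_eq with ⟨k, k₀, z₀, h1, h2, h3, hW0, hW1, hz⟩ | ⟨hW, hB⟩
      -- As `z₀ U = 0` and `U` is not zero, `z₀` vanishes whatever `k` is.
      · refine Or.inl (fam k k₀ z₀ h1 h2 h3 hW0 hW1 fun _ => ?_)
        by_contra h0
        exact hU (C_mul_cancel h0 hz)
      · refine Or.inr ⟨rfl, rfl, ⟨R.F0, R.F1, R.F2, R.rad, ?_, ?_, R.s3z, P.zW, hW⟩⟩
        · simpa using s30
        · simpa using s31
  · obtain ⟨k, k₀, z₀, h1, h2, h3, hW0, hW1, hz⟩ := P.linear_of_ne hab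
    -- If `k = 0` and `z₀ ≠ 0`, then `U = 0`, so `eul_U` gives `quadIm a b * B3 = 0`; with `k = 0`
    -- the whole field would vanish.
    refine Or.inl (fam k k₀ z₀ h1 h2 h3 hW0 hW1 fun hk => ?_)
    by_contra h0
    have hU := C_mul_cancel h0 hz
    have hE := P.eul_U
    rw [hU] at hE
    have hB : B3 = 0 := regular_quadIm hab _ (by simpa using hE.symm)
    subst hk
    exact hne ⟨by simpa using h1, by simpa using h2, hB⟩

/-! ### Uniqueness on phase space. -/

lemma exists_field (A : Vec → Vec) (hA : ContDiff ℝ ∞ A) :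
    ∃ B1 B2 B3 : Sm, d 0 B1 + d 1 B2 + d 2 B3 = 0 ∧ ∀ x, curl A x = field B1 B2 B3 x := by
  refine ⟨d 1 (comp A hA 2) - d 2 (comp A hA 1), d 2 (comp A hA 0) - d 0 (comp A hA 2),
    d 0 (comp A hA 1) - d 1 (comp A hA 0), ?_, fun x => rfl⟩
  simp

lemma exists_lead₁ {a b : ℝ} {A : Vec → Vec} {X : Phase → ℝ}
    (h : HasLeadingTerm A (lead₁ a b) X) :
    ∃ s1 s2 s3 m, X = (quadLead₁ a b s1 s2 s3 m).fn A := by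
  obtain ⟨σ, μ, hσ, hμ, hX⟩ := h
  refine ⟨comp σ hσ 0, comp σ hσ 1, comp σ hσ 2, mk μ hμ, funext fun ξ => ?_⟩
  rw [hX]
  simp [lead₁, Quad.fn, Quad.eval, quadLead₁, covMom, mom, ang, covShift, cross_apply,
    Fin.sum_univ_three]
  ring

lemma exists_lead₂ {A : Vec → Vec} {X : Phase → ℝ} (h : HasLeadingTerm A lead₂ X) :
    ∃ s1 s2 s3 m, X = (quadLead₂ s1 s2 s3 m).fn A := by
  obtain ⟨σ, μ, hσ, hμ, hX⟩ := h
  refine ⟨comp σ hσ 0, comp σ hσ 1, comp σ hσ 2, mk μ hμ, funext fun ξ => ?_⟩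
  rw [hX]
  simp [lead₂, Quad.fn, Quad.eval, quadLead₂, covMom, mom, covShift, Fin.sum_univ_three]
  ring

lemma CylSystem.hasCylindricalIntegrals {A : Vec → Vec} {B1 B2 B3 W F s3 : Sm}
    (hA : ContDiff ℝ ∞ A) (hB : ∀ x, curl A x = field B1 B2 B3 x)
    (H : CylSystem B1 B2 B3 W F s3) : HasCylindricalIntegrals A (W : Vec → ℝ) := by
  have hL : (fun ξ => covAng A 2 ξ + s3 ξ.1) =
      (⟨0, 0, 0, 0, 0, 0, -X 1, X 0, 0, s3⟩ : Quad).fn A := by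
    funext ξ
    simp [covAng, ang, Quad.fn, Quad.eval, covShift, cross_apply]
    ring
  have hP : (fun ξ => covMom A 2 ξ + (C (1 / 2) * F) ξ.1) =
      (⟨0, 0, 0, 0, 0, 0, 0, 0, 1, C (1 / 2) * F⟩ : Quad).fn A := by
    funext ξ
    simp [covMom, mom, Quad.fn, Quad.eval, covShift]
  have F0 := fun x => congrArg (fun f : Sm => f x) H.F0
  have F1 := fun x => congrArg (fun f : Sm => f x) H.F1
  have F2 := fun x => congrArg (fun f : Sm => f x) H.F2
  have hr := fun x => congrArg (fun f : Sm => f x) H.rad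
  have s0 := fun x => congrArg (fun f : Sm => f x) H.s0
  have s1 := fun x => congrArg (fun f : Sm => f x) H.s1
  have s2 := fun x => congrArg (fun f : Sm => f x) H.s2
  have W2 := fun x => congrArg (fun f : Sm => f x) H.W2
  have Wr := fun x => congrArg (fun f : Sm => f x) H.Wr
  simp [rot] at F0 F1 F2 hr s0 s1 s2 W2 Wr
  -- The fields `s0`, `s1`, `s2` and `F0`, `F1`, `F2` of the structure are the determining equations
  -- of `l_3^A + s3` and of `p_3^A + F / 2` in first order in the momenta.
  refine ⟨s3, (C (1 / 2) * F : Sm), s3.contDiff, (C (1 / 2) * F : Sm).contDiff, ?_, ?_, ?_⟩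
  · rw [hL, IsIntegral]
    simp only [← quadHam_fn]
    rw [Quad.bracket_eq_zero hA hB]
    intro η
    simp [Quad.bracket, Quad.eval, Quad.dx, Quad.dp, quadHam, field, s0, s1, s2, W2]
    linear_combination -η.2 2 * hr η.1 - Wr η.1
  · rw [hP, IsIntegral]
    simp only [← quadHam_fn]
    rw [Quad.bracket_eq_zero hA hB]
    intro η
    simp [Quad.bracket, Quad.eval, Quad.dx, Quad.dp, quadHam, field, F0, F1, F2, W2]
    ring
  · rw [hL, hP, InInvolution, Quad.bracket_eq_zero hA hB]
    intro η
    simp [Quad.bracket, Quad.eval, Quad.dx, Quad.dp, field, F0, F1, F2, s0, s1, s2]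

theorem uniqueness (a b : ℝ) (A : Vec → Vec) (W : Vec → ℝ) (hA : ContDiff ℝ ∞ A)
    (hW : ContDiff ℝ ∞ W) (hne : ∃ x, curl A x ≠ 0) (hP : ∃ X₁ X₂ : Phase → ℝ, IsPair a b A W X₁ X₂) :
    (∃ bφ bZ w₁ w₂ w₃ w₀ : ℝ, (∀ x, curl A x = famB bφ bZ x) ∧
        ∀ x, W x = famW a b bφ bZ w₁ w₂ w₃ x + w₀) ∨
      (a = 0 ∧ b = 0 ∧ HasCylindricalIntegrals A W) := by
  obtain ⟨B1, B2, B3, hdiv, hB⟩ := exists_field A hA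
  obtain ⟨X₁, X₂, h1, h2, i1, i2, i12⟩ := hP
  obtain ⟨s1, s2, s3, m, rfl⟩ := exists_lead₁ h1
  obtain ⟨S1, S2, S3, M, rfl⟩ := exists_lead₂ h2
  have hH : ham A W = (quadHam (mk W hW)).fn A := (quadHam_fn (mk W hW) A).symm
  rw [IsIntegral, hH, Quad.bracket_eq_zero hA hB] at i1 i2
  rw [InInvolution, Quad.bracket_eq_zero hA hB] at i12
  have hne' : ¬(B1 = 0 ∧ B2 = 0 ∧ B3 = 0) := by
    rintro ⟨rfl, rfl, rfl⟩
    obtain ⟨x, hx⟩ := hne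
    apply hx
    rw [hB]
    ext i
    fin_cases i <;> rfl
  rcases (pairSystem_of_bracket hdiv i2 i1 i12).isFamily_or_cyl hne' with
    ⟨k, k₀, w₁, w₂, w₃, w₀, rfl, rfl, rfl, h⟩ | ⟨ha, hb, h⟩
  · exact Or.inl ⟨k, k₀, w₁, w₂, w₃, w₀, fun x => hB x, h⟩
  · exact Or.inr ⟨ha, hb, h.hasCylindricalIntegrals hA hB⟩

/-! ### Leading terms -/

namespace Quad

/-- The part of degree two in the momenta. -/
def lead (q : Quad) (η : Phase) : ℝ :=
  q.k11 η.1 * η.2 0 ^ 2 + q.k12 η.1 * (η.2 0 * η.2 1) + q.k22 η.1 * η.2 1 ^ 2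
    + q.u1 η.1 * (η.2 0 * η.2 2) + q.u2 η.1 * (η.2 1 * η.2 2) + q.f η.1 * η.2 2 ^ 2

/-- The translation `p₃ ↦ p₃ + g(x)` of the momentum. -/
def shift (g : Sm) (q : Quad) : Quad :=
  ⟨q.k11, q.k12, q.k22, q.u1, q.u2, q.f, q.t1 + q.u1 * g, q.t2 + q.u2 * g,
    q.h + 2 * q.f * g, q.n + q.h * g + q.f * g ^ 2⟩

lemma lead_shift (g : Sm) (q : Quad) : (q.shift g).lead = q.lead := rfl

lemma shift_fn (g : Sm) (q : Quad) (A : Vec → Vec) :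
    (q.shift g).fn A = q.fn (fun x i => A x i + if i = 2 then g x else 0) := by
  funext ξ
  simp [fn, eval, shift, covShift]
  ring

lemma hasLeadingTerm (q : Quad) (A : Vec → Vec) : HasLeadingTerm A q.lead (q.fn A) := by
  refine ⟨fun x => ![q.t1 x, q.t2 x, q.h x], q.n, ?_, q.n.contDiff, fun ξ => ?_⟩
  · rw [contDiff_pi]
    intro i
    fin_cases i
    · exact q.t1.contDiff
    · exact q.t2.contDiff
    · exact q.h.contDiff
  · simp [fn, eval, lead, covMom, mom, Fin.sum_univ_three]
    simp [covShift]
    ring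

lemma exists_of_hasLeadingTerm {q : Quad} {A : Vec → Vec} {X : Phase → ℝ}
    (h : HasLeadingTerm A q.lead X) : ∃ t1 t2 h' n,
      X = (⟨q.k11, q.k12, q.k22, q.u1, q.u2, q.f, t1, t2, h', n⟩ : Quad).fn A := by
  obtain ⟨σ, μ, hσ, hμ, hX⟩ := h
  refine ⟨comp σ hσ 0, comp σ hσ 1, comp σ hσ 2, Sm.mk μ hμ, funext fun ξ => ?_⟩
  rw [hX]
  simp [Quad.fn, Quad.eval, lead, covMom, mom, Fin.sum_univ_three]
  simp [covShift]
  ring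

end Quad

/-! ### The gauge in which the third momentum is conserved -/

/-- The vector potential of the field `(0, 0, b_Z)` obtained from that of `(-b_φ y, b_φ x, b_Z)`. -/
def gauge (bφ : ℝ) (A : Vec → Vec) (x : Vec) : Vec :=
  fun i => A x i + if i = 2 then (C (bφ / 2) * rho) x else 0

lemma contDiff_gauge (bφ : ℝ) {A : Vec → Vec} (hA : ContDiff ℝ ∞ A) : ContDiff ℝ ∞ (gauge bφ A) := by
  refine contDiff_pi.2 fun i => (contDiff_pi.1 hA i).add ?_
  split_ifs
  · exact (C (bφ / 2) * rho).contDiff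
  · exact contDiff_const

/-- The added third component is a function of the distance from the axis, and its curl is `(b_φ y,
-b_φ x, 0)`, which cancels the azimuthal part of the field. -/
lemma curl_gauge {bφ bZ : ℝ} {A : Vec → Vec} (hA : ContDiff ℝ ∞ A)
    (hB : ∀ x, curl A x = famB bφ bZ x) (x : Vec) :
    curl (gauge bφ A) x = field 0 0 (C bZ) x := by
  have h0 : (fun y => gauge bφ A y 0) = comp A hA 0 := by funext y; simp [gauge]
  have h1 : (fun y => gauge bφ A y 1) = comp A hA 1 := by funext y; simp [gauge]
  have h2 : (fun y => gauge bφ A y 2) = (comp A hA 2 + C (bφ / 2) * rho : Sm) := by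
    funext y; simp [gauge]
  have hx := hB x
  have e : ∀ i j, partialX i (fun y => A y j) x = d i (comp A hA j) x := fun i j => rfl
  simp only [curl, famB, e] at hx
  have g0 := congrFun hx 0
  have g1 := congrFun hx 1
  have g2 := congrFun hx 2
  simp at g0 g1 g2
  have e' : ∀ (i : Fin 3) (f : Sm), partialX i f x = d i f x := fun i f => rfl
  simp only [curl, h0, h1, h2, e', field]
  ext i
  fin_cases i
  · simp [rho]; linear_combination g0
  · simp [rho]; linear_combination g1
  · simp [g2]

/-- The linear part of the Hamiltonian in the conserved momentum. -/
def potV (bφ : ℝ) : Sm := -(C (bφ / 2) * rho)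

/-- The effective potential. -/
def potU (a b bφ bZ w₁ w₂ w₃ : ℝ) : Sm :=
  C bφ * (C w₃ * rho - C bZ * (C (a / 2) * (X 0 ^ 2 - X 1 ^ 2) + C b * X 0 * X 1) + C w₁ * X 0
    + C w₂ * X 1)

/-- The Hamiltonian in the gauge of a conserved third momentum. -/
def gaugeHam (V U : Sm) : Quad := ⟨C (1 / 2), 0, C (1 / 2), 0, 0, C (1 / 2), 0, 0, V, U⟩

/-- Writing `p_3^A = c - b_φ ρ / 2` and expanding its half square, the term `b_φ² ρ² / 8` cancels
the quartic term of `famW`; the cross term is `V c`. -/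
lemma gaugeHam_fn (a b bφ bZ w₁ w₂ w₃ : ℝ) (A : Vec → Vec) :
    ham A (famW a b bφ bZ w₁ w₂ w₃) =
      (gaugeHam (potV bφ) (potU a b bφ bZ w₁ w₂ w₃)).fn (gauge bφ A) := by
  funext ξ
  simp [Quad.fn, Quad.eval, gaugeHam, ham, covShift, Fin.sum_univ_three, potU, potV, gauge, famW,
    rho]
  ring

/-- Translating the third momentum by a function of the position alters only the coefficients of
lower degree, so passing to this gauge does not affect classes or quadratic elements. -/
lemma Quad.hasLeadingTerm_gauge (q : Quad) (bφ : ℝ) (A : Vec → Vec) :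
    HasLeadingTerm A q.lead (q.fn (gauge bφ A)) := by
  have := (q.shift (C (bφ / 2) * rho)).hasLeadingTerm A
  rwa [lead_shift, shift_fn] at this

lemma Quad.exists_of_hasLeadingTerm_gauge {q : Quad} {bφ : ℝ} {A : Vec → Vec} {X : Phase → ℝ}
    (h : HasLeadingTerm A q.lead X) : ∃ t1 t2 h' n,
      X = (⟨q.k11, q.k12, q.k22, q.u1, q.u2, q.f, t1, t2, h', n⟩ : Quad).fn (gauge bφ A) := by
  obtain ⟨t1, t2, h', n, rfl⟩ := exists_of_hasLeadingTerm h
  refine ⟨_, _, _, _, Eq.trans ?_ (shift_fn (-(C (bφ / 2) * rho))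
    ⟨q.k11, q.k12, q.k22, q.u1, q.u2, q.f, t1, t2, h', n⟩ (gauge bφ A)).symm⟩
  congr 1
  funext x i
  simp only [gauge]
  split_ifs <;> simp

/-! ### Quadratic elements -/

lemma isQuadraticElement_gen_mul {i j : Fin 6} (h : i ≤ j) :
    IsQuadraticElement (fun ξ => gen ξ i * gen ξ j) := by
  refine ⟨fun i' j' => if i' = i ∧ j' = j then 1 else 0, fun ξ => ?_⟩
  rw [Finset.sum_eq_single i, Finset.sum_eq_single j]
  · simp
  · intro k _ hk; simp [hk]
  · intro hj; simp [h] at hj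
  · intro k _ hk; simp [hk]
  · simp

lemma IsQuadraticElement.add {Q Q' : Phase → ℝ} (h : IsQuadraticElement Q)
    (h' : IsQuadraticElement Q') : IsQuadraticElement (fun ξ => Q ξ + Q' ξ) := by
  obtain ⟨α, hα⟩ := h
  obtain ⟨β, hβ⟩ := h'
  refine ⟨fun i j => α i j + β i j, fun ξ => ?_⟩
  simp only [hα, hβ, add_mul, Finset.sum_add_distrib]

lemma IsQuadraticElement.const_mul {Q : Phase → ℝ} (c : ℝ) (h : IsQuadraticElement Q) :
    IsQuadraticElement (fun ξ => c * Q ξ) := by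
  obtain ⟨α, hα⟩ := h
  refine ⟨fun i j => c * α i j, fun ξ => ?_⟩
  simp only [hα, Finset.mul_sum, mul_assoc]

lemma isQuadraticElement_zero : IsQuadraticElement (fun _ => 0) := ⟨0, fun ξ => by simp⟩

/-- The coefficients of the generators as linear functions of the momenta. -/
def genCoeff (i : Fin 6) (k : Fin 3) : Sm :=
  (![![1, 0, 0], ![0, 1, 0], ![0, 0, 1], ![0, -X 2, X 1], ![X 2, 0, -X 0], ![-X 1, X 0, 0]] :
    Fin 6 → Fin 3 → Sm) i k

lemma gen_eq (ξ : Phase) (i : Fin 6) : gen ξ i =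
    genCoeff i 0 ξ.1 * ξ.2 0 + genCoeff i 1 ξ.1 * ξ.2 1 + genCoeff i 2 ξ.1 * ξ.2 2 := by
  fin_cases i <;> simp [gen, genCoeff, mom, ang, cross_apply] <;> ring

/-- The six generators are affine in `z`, hence products of two of them have degree at most two in
`z`; this is the source of `AxialQuadratic`. -/
lemma d_d_genCoeff (i : Fin 6) (k : Fin 3) : d 2 (d 2 (genCoeff i k)) = 0 := by
  fin_cases i <;> fin_cases k <;> simp [genCoeff]

lemma d_d_d_mul {f g : Sm} (hf : d 2 (d 2 f) = 0) (hg : d 2 (d 2 g) = 0) :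
    d 2 (d 2 (d 2 (f * g))) = 0 := by
  simp [hf, hg]

/-- Functions whose third derivative along the axis vanishes. -/
def AxialQuadratic (f : Sm) : Prop := d 2 (d 2 (d 2 f)) = 0

lemma IsQuadraticElement.exists_lead {Q : Phase → ℝ} (h : IsQuadraticElement Q) :
    ∃ k11 k12 k22 u1 u2 f : Sm, (AxialQuadratic k11 ∧ AxialQuadratic k12 ∧ AxialQuadratic k22 ∧
      AxialQuadratic u1 ∧ AxialQuadratic u2 ∧ AxialQuadratic f) ∧
      ∀ t1 t2 h n, Q = (⟨k11, k12, k22, u1, u2, f, t1, t2, h, n⟩ : Quad).lead := by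
  obtain ⟨α, hα⟩ := h
  have key : ∀ p q : Fin 3, AxialQuadratic
      (∑ i : Fin 6, ∑ j ∈ Finset.Ici i, C (α i j) * (genCoeff i p * genCoeff j q)) := by
    intro p q
    simp only [AxialQuadratic, d_sum]
    refine Finset.sum_eq_zero fun i _ => Finset.sum_eq_zero fun j _ => ?_
    have hC : ∀ (c : ℝ) (g : Sm), d 2 (C c * g) = C c * d 2 g := fun c g => by simp
    rw [hC, hC, hC, d_d_d_mul (d_d_genCoeff i p) (d_d_genCoeff j q), mul_zero]
  have key2 : ∀ p q : Fin 3, AxialQuadratic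
      (∑ i : Fin 6, ∑ j ∈ Finset.Ici i, C (α i j) * (genCoeff i p * genCoeff j q)
      + ∑ i : Fin 6, ∑ j ∈ Finset.Ici i, C (α i j) * (genCoeff i q * genCoeff j p)) := by
    intro p q
    have h1 := key p q
    have h2 := key q p
    unfold AxialQuadratic at *
    rw [d_add, d_add, d_add, h1, h2, add_zero]
  refine ⟨_, _, _, _, _, _, ⟨key 0 0, key2 0 1, key 1 1, key2 0 2, key2 1 2, key 2 2⟩,
    fun t1 t2 h n => funext fun ξ => ?_⟩
  have hs : ∀ (p q : Fin 3) (x : Vec),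
      (∑ i : Fin 6, ∑ j ∈ Finset.Ici i, C (α i j) * (genCoeff i p * genCoeff j q) : Sm) x =
      ∑ i : Fin 6, ∑ j ∈ Finset.Ici i, α i j * (genCoeff i p x * genCoeff j q x) := by
    intro p q x
    let ev : Sm →+ ℝ := ⟨⟨fun f => f x, rfl⟩, fun _ _ => rfl⟩
    have he : ∀ f : Sm, f x = ev f := fun _ => rfl
    simp only [he, map_sum]
    rfl
  rw [hα]
  simp only [Quad.lead, Sm.add_apply, hs]
  simp only [Finset.sum_mul, ← Finset.sum_add_distrib, gen_eq]
  refine Finset.sum_congr rfl fun i _ => Finset.sum_congr rfl fun j _ => ?_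
  ring

/-! ### Functional independence -/

/-- `covShift A` is a homeomorphism of phase space. -/
def covShiftHomeo {A : Vec → Vec} (hA : ContDiff ℝ ∞ A) : Phase ≃ₜ Phase where
  toFun := covShift A
  invFun := fun η => (η.1, η.2 - A η.1)
  left_inv := fun ξ => by simp [covShift]
  right_inv := fun ξ => by simp [covShift]
  continuous_toFun := continuous_fst.prodMk (continuous_snd.add (hA.continuous.comp continuous_fst))
  continuous_invFun := continuous_fst.prodMk (continuous_snd.sub (hA.continuous.comp continuous_fst))

lemma dense_covShift {A : Vec → Vec} (hA : ContDiff ℝ ∞ A) {D : Phase → ℝ} (hD : ContDiff ℝ ω D)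
    {η₀ : Phase} (h0 : D η₀ ≠ 0) : Dense {ξ | D (covShift A ξ) ≠ 0} :=
  (dense_ne_zero_of_analytic hD h0).preimage (covShiftHomeo hA).isOpenMap

/-- Independence may be tested in the coordinates `(x, p^A)`: the change of coordinates is
triangular, so the derivatives of `A` multiply only sums that already vanish. The analytic function
`D` plays the role of a minor; one point with `D ≠ 0` makes the set of good points dense. -/
lemma Quad.functionallyIndependent {n : ℕ} {A : Vec → Vec} (hA : ContDiff ℝ ∞ A) (q : Fin n → Quad)
    {D : Phase → ℝ} (hD : ContDiff ℝ ω D) {η₀ : Phase} (h0 : D η₀ ≠ 0)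
    (h : ∀ η, D η ≠ 0 → ∀ g : Fin n → ℝ, (∀ k, ∑ i, g i * (q i).dp k η = 0) →
      (∀ k, ∑ i, g i * ((q i).dx k).eval η = 0) → ∀ i, g i = 0) :
    FunctionallyIndependent (fun i => (q i).fn A) := by
  refine (dense_covShift hA hD h0).mono fun ξ hξ => ?_
  refine Fintype.linearIndependent_iff.2 fun g hg => ?_
  have hv : ∀ v : Phase, ∑ i, g i * fderiv ℝ ((q i).fn A) ξ v = 0 := by
    intro v
    have := congrArg (fun L : Phase →L[ℝ] ℝ => L v) hg
    simpa using this
  have hp : ∀ k, ∑ i, g i * (q i).dp k (covShift A ξ) = 0 := by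
    intro k
    have := hv (0, Pi.single k 1)
    simpa [fderiv_fn _ hA, Pi.single_apply] using this
  refine h _ hξ g hp fun k => ?_
  have hk := hv (Pi.single k 1, 0)
  have e : ∀ i, fderiv ℝ ((q i).fn A) ξ (Pi.single k 1, 0) = ((q i).dx k).eval (covShift A ξ)
      + ∑ j, (q i).dp j (covShift A ξ) * partialX k (fun y => A y j) ξ.1 := by
    intro i
    rw [fderiv_fn _ hA]
    fin_cases k <;> simp
  simp only [e, mul_add, Finset.sum_add_distrib, Finset.mul_sum] at hk
  rw [Finset.sum_comm] at hk
  have : ∑ j, ∑ i, g i * ((q i).dp j (covShift A ξ) * partialX k (fun y => A y j) ξ.1) = 0 := by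
    refine Finset.sum_eq_zero fun j _ => ?_
    simp only [← mul_assoc, ← Finset.sum_mul, hp, zero_mul]
  rwa [this, add_zero] at hk

/-! ### The pair of integrals of the family -/

lemma contDiff_famA (bφ bZ : ℝ) : ContDiff ℝ ∞ (famA bφ bZ) := by
  refine contDiff_pi.2 fun i => ?_
  fin_cases i
  · exact (-(C (1 / 2 * bZ) * X 1)).contDiff
  · exact (C (1 / 2 * bZ) * X 0).contDiff
  · exact (-(C (1 / 2 * bφ) * (X 0 ^ 2 + X 1 ^ 2))).contDiff

lemma curl_famA (bφ bZ : ℝ) (x : Vec) : curl (famA bφ bZ) x = famB bφ bZ x := by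
  have h0 : (fun y => famA bφ bZ y 0) = (-(C (1 / 2 * bZ) * X 1) : Sm) := rfl
  have h1 : (fun y => famA bφ bZ y 1) = (C (1 / 2 * bZ) * X 0 : Sm) := rfl
  have h2 : (fun y => famA bφ bZ y 2) = (-(C (1 / 2 * bφ) * (X 0 ^ 2 + X 1 ^ 2)) : Sm) := rfl
  have e : ∀ (i : Fin 3) (f : Sm), partialX i f x = d i f x := fun i f => rfl
  simp only [curl, h0, h1, h2, e, famB]
  ext i
  fin_cases i
  · simp; ring
  · simp; ring
  · simp; ring

/-- The quadratic integral with leading term `l₃ p₃ + a p₁² + b p₁ p₂`. -/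
def pairQuad (a b bφ bZ w₁ w₂ w₃ : ℝ) : Quad where
  k11 := C a
  k12 := C b
  k22 := 0
  u1 := -X 1
  u2 := X 0
  f := 0
  t1 := C w₂ - C bZ * (C b * X 0 - C a * X 1) + 2 * C w₃ * X 1
  t2 := -(C w₁ - C bZ * (C a * X 0 + C b * X 1) + 2 * C w₃ * X 0)
  h := -(C bφ * (C a * X 0 ^ 2 + C b * X 0 * X 1)) - C (bZ / 2) * rho
  n := C bZ * (C w₃ * rho - C bZ * (C (a / 2) * (X 0 ^ 2 - X 1 ^ 2) + C b * X 0 * X 1) + C w₁ * X 0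
      + C w₂ * X 1)
    + C bφ * (2 * C (a * w₁) * X 0 + C b * (C w₁ * X 1 + C w₂ * X 0)
      + C (1 / 2 * (4 * a * w₃ - 2 * a ^ 2 * bZ - b ^ 2 * bZ)) * X 0 ^ 2
      + C (2 * b * w₃ - a * b * bZ) * X 0 * X 1 - C (1 / 2 * b ^ 2 * bZ) * X 1 ^ 2)

/-- The square of the third momentum. -/
def sqQuad : Quad := ⟨0, 0, 0, 0, 0, 1, 0, 0, 0, 0⟩

lemma lead_pairQuad (a b bφ bZ w₁ w₂ w₃ : ℝ) : (pairQuad a b bφ bZ w₁ w₂ w₃).lead = lead₁ a b := by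
  funext ξ
  simp [Quad.lead, pairQuad, lead₁, mom, ang, cross_apply]
  ring

lemma lead_sqQuad : sqQuad.lead = lead₂ := by
  funext ξ
  simp [Quad.lead, sqQuad, lead₂, mom]

lemma bracket_pairQuad (a b bφ bZ w₁ w₂ w₃ : ℝ) (η : Phase) :
    Quad.bracket (field 0 0 (C bZ)) (pairQuad a b bφ bZ w₁ w₂ w₃)
      (gaugeHam (potV bφ) (potU a b bφ bZ w₁ w₂ w₃)) η = 0 := by
  simp [Quad.bracket, Quad.dx, Quad.dp, Quad.eval, pairQuad, gaugeHam, potV, potU, field, rho]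
  ring

lemma bracket_sqQuad (a b bφ bZ w₁ w₂ w₃ : ℝ) (η : Phase) :
    Quad.bracket (field 0 0 (C bZ)) sqQuad (gaugeHam (potV bφ) (potU a b bφ bZ w₁ w₂ w₃)) η
      = 0 := by
  simp [Quad.bracket, Quad.dx, Quad.dp, Quad.eval, sqQuad, gaugeHam, potV, potU, field, rho]

lemma bracket_pairQuad_sqQuad (a b bφ bZ w₁ w₂ w₃ : ℝ) (η : Phase) :
    Quad.bracket (field 0 0 (C bZ)) (pairQuad a b bφ bZ w₁ w₂ w₃) sqQuad η = 0 := by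
  simp [Quad.bracket, Quad.dx, Quad.dp, Quad.eval, sqQuad, pairQuad, field, rho]

section

variable {bφ bZ : ℝ} {A : Vec → Vec} (hA : ContDiff ℝ ∞ A) (hB : ∀ x, curl A x = famB bφ bZ x)
include hA hB

lemma poisson_gauge (F G : Quad) (ξ : Phase) :
    poisson (F.fn (gauge bφ A)) (G.fn (gauge bφ A)) ξ =
      Quad.bracket (field 0 0 (C bZ)) F G (covShift (gauge bφ A) ξ) :=
  Quad.poisson_fn (contDiff_gauge bφ hA) (curl_gauge hA hB) F G ξ

lemma isIntegral_gauge {a b w₁ w₂ w₃ : ℝ} {F : Quad} (h : ∀ η, Quad.bracket (field 0 0 (C bZ)) F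
    (gaugeHam (potV bφ) (potU a b bφ bZ w₁ w₂ w₃)) η = 0) :
    IsIntegral A (famW a b bφ bZ w₁ w₂ w₃) (F.fn (gauge bφ A)) := fun ξ => by
  rw [gaugeHam_fn, poisson_gauge hA hB, h]

lemma inInvolution_gauge {F G : Quad} (h : ∀ η, Quad.bracket (field 0 0 (C bZ)) F G η = 0) :
    InInvolution (F.fn (gauge bφ A)) (G.fn (gauge bφ A)) := fun ξ => by
  rw [poisson_gauge hA hB, h]

lemma isQuadraticIntegral_gauge {a b w₁ w₂ w₃ : ℝ} {F : Quad} (hF : IsQuadraticElement F.lead)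
    (h : ∀ η, Quad.bracket (field 0 0 (C bZ)) F
      (gaugeHam (potV bφ) (potU a b bφ bZ w₁ w₂ w₃)) η = 0) :
    IsQuadraticIntegral A (famW a b bφ bZ w₁ w₂ w₃) (F.fn (gauge bφ A)) :=
  ⟨⟨_, hF, F.hasLeadingTerm_gauge bφ A⟩, isIntegral_gauge hA hB h⟩

lemma belongsToClass_gauge {a b w₁ w₂ w₃ : ℝ} {κ : PairClass} {F G : Quad}
    (hF : IsQuadraticElement F.lead) (hG : IsQuadraticElement G.lead)
    (hFH : ∀ η, Quad.bracket (field 0 0 (C bZ)) F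
      (gaugeHam (potV bφ) (potU a b bφ bZ w₁ w₂ w₃)) η = 0)
    (hGH : ∀ η, Quad.bracket (field 0 0 (C bZ)) G
      (gaugeHam (potV bφ) (potU a b bφ bZ w₁ w₂ w₃)) η = 0)
    (hFG : ∀ η, Quad.bracket (field 0 0 (C bZ)) F G η = 0)
    (h : PairInClass κ F.lead G.lead) : BelongsToClass κ A (famW a b bφ bZ w₁ w₂ w₃) :=
  ⟨_, _, _, _, hF, F.hasLeadingTerm_gauge bφ A, isIntegral_gauge hA hB hFH, hG,
    G.hasLeadingTerm_gauge bφ A, isIntegral_gauge hA hB hGH, inInvolution_gauge hA hB hFG, h⟩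

theorem existence (a b w₁ w₂ w₃ : ℝ) :
    ∃ X₁ X₂ : Phase → ℝ, IsPair a b A (famW a b bφ bZ w₁ w₂ w₃) X₁ X₂ ∧
      FunctionallyIndependent ![ham A (famW a b bφ bZ w₁ w₂ w₃), X₁, X₂] := by
  refine ⟨(pairQuad a b bφ bZ w₁ w₂ w₃).fn (gauge bφ A), sqQuad.fn (gauge bφ A),
    ⟨?_, ?_, isIntegral_gauge hA hB (bracket_pairQuad a b bφ bZ w₁ w₂ w₃),
      isIntegral_gauge hA hB (bracket_sqQuad a b bφ bZ w₁ w₂ w₃),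
      inInvolution_gauge hA hB (bracket_pairQuad_sqQuad a b bφ bZ w₁ w₂ w₃)⟩, ?_⟩
  · rw [← lead_pairQuad a b bφ bZ w₁ w₂ w₃]; exact Quad.hasLeadingTerm_gauge _ _ _
  · rw [← lead_sqQuad]; exact Quad.hasLeadingTerm_gauge _ _ _
  have e : ![ham A (famW a b bφ bZ w₁ w₂ w₃), (pairQuad a b bφ bZ w₁ w₂ w₃).fn (gauge bφ A),
      sqQuad.fn (gauge bφ A)] = fun i => ((![gaugeHam (potV bφ) (potU a b bφ bZ w₁ w₂ w₃),
        pairQuad a b bφ bZ w₁ w₂ w₃, sqQuad] : Fin 3 → Quad) i).fn (gauge bφ A) := by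
    rw [gaugeHam_fn]
    funext i
    fin_cases i <;> rfl
  rw [e]
  -- At the test point `x = (1, 0, 0)`, `p = (1, 0, c)` the minor `D` below equals `c` times the
  -- second expression; one of `c = 1, 2` avoids its zero.
  obtain ⟨c, hc, hc'⟩ : ∃ c : ℝ, c ≠ 0 ∧ c + (b - (w₁ - bZ * a + 2 * w₃)) ≠ 0 := by
    by_cases h : b - (w₁ - bZ * a + 2 * w₃) = -1
    · exact ⟨2, by norm_num, by rw [h]; norm_num⟩
    · exact ⟨1, by norm_num, fun h' => h (by linarith)⟩
  refine Quad.functionallyIndependent (contDiff_gauge bφ hA) _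
    -- The minor of the three momentum derivatives up to a factor: `p₃` from the square of `c`,
    -- times the planar minor of `H` and `X₁`.
    (D := fun η => η.2 2 * (η.2 0 * (b * η.2 0 + η.1 0 * η.2 2
        - (w₁ - bZ * (a * η.1 0 + b * η.1 1) + 2 * w₃ * η.1 0))
      - η.2 1 * (2 * a * η.2 0 + b * η.2 1 - η.1 1 * η.2 2
        + (w₂ - bZ * (b * η.1 0 - a * η.1 1) + 2 * w₃ * η.1 1))))
    (by fun_prop) (η₀ := (![1, 0, 0], ![1, 0, c])) ?_ ?_
  · simp
    refine ⟨hc, fun h => hc' (by linarith)⟩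
  · intro η hD g hp _
    have h0 := hp 0
    have h1 := hp 1
    have h2 := hp 2
    simp [Fin.sum_univ_three, Quad.dp, gaugeHam, pairQuad, sqQuad] at h0 h1 h2
    obtain ⟨hc, hdet⟩ := mul_ne_zero_iff.1 hD
    have g1 : g 1 = 0 := by
      refine (mul_eq_zero.1 ?_).resolve_right hdet
      linear_combination η.2 0 * h1 - η.2 1 * h0
    have g0 : g 0 = 0 := by
      refine (mul_eq_zero.1 ?_).resolve_right hdet
      simp only [g1, zero_mul, add_zero] at h0 h1
      linear_combination (b * η.2 0 + η.1 0 * η.2 2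
        - (w₁ - bZ * (a * η.1 0 + b * η.1 1) + 2 * w₃ * η.1 0)) * h0 - (2 * a * η.2 0 + b * η.2 1
        - η.1 1 * η.2 2 + (w₂ - bZ * (b * η.1 0 - a * η.1 1) + 2 * w₃ * η.1 1)) * h1
    have g2 : g 2 = 0 := by
      simp only [g0, g1, zero_mul, zero_add] at h2
      have : g 2 * η.2 2 = 0 := by linear_combination (1 / 2) * h2
      exact (mul_eq_zero.1 this).resolve_right hc
    intro i
    fin_cases i
    exacts [g0, g1, g2]

end

/-! ### Quadratic elements and classes of the leading terms -/

lemma isQuadraticElement_lead₁ (a b : ℝ) : IsQuadraticElement (lead₁ a b) := by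
  have := (isQuadraticElement_gen_mul (i := 2) (j := 5) (by decide)).add
    (((isQuadraticElement_gen_mul (le_refl 0)).const_mul a).add
      ((isQuadraticElement_gen_mul (i := 0) (j := 1) (by decide)).const_mul b))
  convert this using 2 with ξ
  simp [lead₁, gen]
  ring

lemma isQuadraticElement_sq (i : Fin 6) : IsQuadraticElement (fun ξ => gen ξ i ^ 2) := by
  simpa only [sq] using isQuadraticElement_gen_mul (le_refl i)

lemma isQuadraticElement_lead₂ : IsQuadraticElement lead₂ := isQuadraticElement_sq 2

/-- The permutation `(x, y, z) ↦ (y, ± z, ± x)` of the coordinates. -/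
def cyclic (ε : ℝ) (h : ε ^ 2 = 1) : Matrix.orthogonalGroup (Fin 3) ℝ :=
  ⟨!![0, 1, 0; 0, 0, ε; ε, 0, 0], by
    rw [Matrix.mem_orthogonalGroup_iff]
    ext i j
    fin_cases i <;> fin_cases j <;> simp [Matrix.mul_apply, Fin.sum_univ_three, ← sq, h]⟩

/-- The permutation `(x, y, z) ↦ (x, z, y)` of the coordinates. -/
def transposition : Matrix.orthogonalGroup (Fin 3) ℝ :=
  ⟨!![1, 0, 0; 0, 0, 1; 0, 1, 0], by
    rw [Matrix.mem_orthogonalGroup_iff]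
    ext i j
    fin_cases i <;> fin_cases j <;> simp [Matrix.mul_apply, Fin.sum_univ_three]⟩

/-- Cycling the axes carries `l₃ p₃` to `l₁ p₁`, `p₁²` to `p₂²` and `p₁ p₂` to `ε p₂ p₃`. The sign
`ε` reverses two axes if necessary to meet the normalisation `β = ε b ≥ 0`; the determinant stays
one, so the product `l₃ p₃` keeps its sign. -/
lemma pairInClass_i (a b : ℝ) : PairInClass .i (lead₁ a b) lead₂ := by
  obtain ⟨ε, h, hε⟩ : ∃ ε : ℝ, ε ^ 2 = 1 ∧ 0 ≤ ε * b := by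
    rcases le_total 0 b with hb | hb
    · exact ⟨1, by norm_num, by linarith⟩
    · exact ⟨-1, by norm_num, by linarith⟩
  refine ⟨cyclic ε h, 0, _, _, ⟨a, ε * b, hε, fun ξ => rfl, fun ξ => rfl⟩, ?_⟩
  congr 2
  congr 1
  · funext ξ
    simp [lead₁, euclid, cyclic, mom, ang, cross_apply, dotProduct,
      Fin.sum_univ_three]
    linear_combination (ξ.1 1 * ξ.2 2 - ξ.1 2 * ξ.2 1) * ξ.2 0 * h
  · congr 1
    funext ξ
    simp [lead₂, euclid, cyclic, mom, dotProduct, Fin.sum_univ_three]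
    linear_combination ξ.2 0 ^ 2 * h

lemma pairInClass_k : PairInClass .k (fun ξ => mom 0 ξ ^ 2) lead₂ := by
  refine ⟨transposition, 0, _, _, ⟨0, 0, 0, 0, le_rfl, by norm_num, le_rfl, le_rfl, fun ξ => rfl,
    fun ξ => rfl⟩, ?_⟩
  congr 2
  congr 1
  · funext ξ
    simp [euclid, transposition, mom, dotProduct, Fin.sum_univ_three]
  · congr 1
    funext ξ
    simp [lead₂, euclid, transposition, mom, dotProduct, Fin.sum_univ_three]

lemma pairInClass_f : PairInClass .f (fun ξ => ang 2 ξ ^ 2) lead₂ := by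
  refine ⟨1, 0, _, _, ⟨0, 0, 0, 0, le_rfl, le_rfl, fun ξ => rfl, fun ξ => rfl⟩, ?_⟩
  congr 2
  congr 1
  · funext ξ
    simp [euclid]
  · congr 1
    funext ξ
    simp [lead₂, euclid]

lemma belongsToClass_i {bφ bZ : ℝ} {A : Vec → Vec} (hA : ContDiff ℝ ∞ A)
    (hB : ∀ x, curl A x = famB bφ bZ x) (a b w₁ w₂ w₃ : ℝ) :
    BelongsToClass .i A (famW a b bφ bZ w₁ w₂ w₃) := by
  refine belongsToClass_gauge hA hB (F := pairQuad a b bφ bZ w₁ w₂ w₃) (G := sqQuad) ?_ ?_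
    (bracket_pairQuad a b bφ bZ w₁ w₂ w₃) (bracket_sqQuad a b bφ bZ w₁ w₂ w₃)
    (bracket_pairQuad_sqQuad a b bφ bZ w₁ w₂ w₃) ?_
  · rw [lead_pairQuad]; exact isQuadraticElement_lead₁ a b
  · rw [lead_sqQuad]; exact isQuadraticElement_lead₂
  · rw [lead_pairQuad, lead_sqQuad]; exact pairInClass_i a b

/-! ### The integrals in the limit `b_Z = 0` -/

/-- The conserved third momentum. -/
def momQuad : Quad := ⟨0, 0, 0, 0, 0, 0, 0, 0, 1, 0⟩

/-- The third angular momentum. -/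
def angQuad : Quad := ⟨0, 0, 0, 0, 0, 0, -X 1, X 0, 0, 0⟩

/-- The square of the third angular momentum. -/
def angSqQuad : Quad := ⟨X 1 ^ 2, -(2 * X 0 * X 1), X 0 ^ 2, 0, 0, 0, 0, 0, 0, 0⟩

/-- The integral `intA`. -/
def aQuad (bφ w₁ w₃ : ℝ) : Quad :=
  ⟨1, 0, 0, 0, 0, 0, 0, 0, -(C bφ * X 0 ^ 2), 2 * C (bφ * w₃) * X 0 ^ 2 + 2 * C (bφ * w₁) * X 0⟩

/-- The integral `intB`. -/
def bQuad (bφ w₁ w₂ w₃ : ℝ) : Quad :=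
  ⟨0, 1, 0, 0, 0, 0, 0, 0, -(C bφ * X 0 * X 1),
    2 * C (bφ * w₃) * X 0 * X 1 + C bφ * (C w₂ * X 0 + C w₁ * X 1)⟩

/-- The integral `intC`. -/
def cQuad (w₁ w₂ w₃ s : ℝ) : Quad :=
  ⟨0, 0, 0, -X 1, X 0, 0, C w₂ + 2 * C w₃ * X 1, -C w₁ - 2 * C w₃ * X 0, C s, 0⟩

section

variable (bφ w₁ w₂ w₃ s : ℝ) (A : Vec → Vec)

lemma intP_eq : intP bφ A = momQuad.fn (gauge bφ A) := by
  funext ξ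
  simp [intP, Quad.fn, Quad.eval, momQuad, covMom, mom, covShift, gauge, rho]
  ring

lemma covAng_eq : covAng A 2 = angQuad.fn (gauge bφ A) := by
  funext ξ
  simp [covAng, ang, Quad.fn, Quad.eval, angQuad, covShift, gauge, rho, cross_apply]
  ring

lemma intA_eq : intA bφ w₁ w₃ A = (aQuad bφ w₁ w₃).fn (gauge bφ A) := by
  funext ξ
  simp [intA, Quad.fn, Quad.eval, aQuad, covMom, mom, covShift, gauge, rho]
  ring

lemma intB_eq : intB bφ w₁ w₂ w₃ A = (bQuad bφ w₁ w₂ w₃).fn (gauge bφ A) := by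
  funext ξ
  simp [intB, Quad.fn, Quad.eval, bQuad, covMom, mom, covShift, gauge, rho]
  ring

lemma intC_eq : intC bφ w₁ w₂ w₃ s A = (cQuad w₁ w₂ w₃ s).fn (gauge bφ A) := by
  funext ξ
  simp [intC, Quad.fn, Quad.eval, cQuad, covMom, covAng, ang, mom, covShift, gauge, rho,
    cross_apply]
  ring

end

lemma lead_momQuad : momQuad.lead = fun _ => 0 := by funext ξ; simp [Quad.lead, momQuad]

lemma lead_angQuad : angQuad.lead = fun _ => 0 := by funext ξ; simp [Quad.lead, angQuad]

lemma lead_angSqQuad : angSqQuad.lead = fun ξ => ang 2 ξ ^ 2 := by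
  funext ξ
  simp [Quad.lead, angSqQuad, ang, cross_apply]
  ring

lemma lead_aQuad (bφ w₁ w₃ : ℝ) : (aQuad bφ w₁ w₃).lead = fun ξ => mom 0 ξ ^ 2 := by
  funext ξ
  simp [Quad.lead, aQuad, mom]

lemma lead_bQuad (bφ w₁ w₂ w₃ : ℝ) :
    (bQuad bφ w₁ w₂ w₃).lead = fun ξ => gen ξ 0 * gen ξ 1 := by
  funext ξ
  simp [Quad.lead, bQuad, gen, mom]

lemma lead_cQuad (w₁ w₂ w₃ s : ℝ) : (cQuad w₁ w₂ w₃ s).lead = lead₁ 0 0 := by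
  funext ξ
  simp [Quad.lead, cQuad, lead₁, ang, mom, cross_apply]
  ring

section Brackets

variable (a b bφ w₁ w₂ w₃ s : ℝ) (η : Phase)

lemma bracket_momQuad (bZ : ℝ) : Quad.bracket (field 0 0 (C bZ)) momQuad
    (gaugeHam (potV bφ) (potU a b bφ bZ w₁ w₂ w₃)) η = 0 := by
  simp [Quad.bracket, Quad.dx, Quad.dp, Quad.eval, momQuad, gaugeHam, potV, potU, field, rho]

lemma bracket_aQuad : Quad.bracket (field 0 0 (C 0)) (aQuad bφ w₁ w₃)
    (gaugeHam (potV bφ) (potU a b bφ 0 w₁ w₂ w₃)) η = 0 := by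
  simp [Quad.bracket, Quad.dx, Quad.dp, Quad.eval, aQuad, gaugeHam, potV, potU, field, rho]
  ring

lemma bracket_bQuad : Quad.bracket (field 0 0 (C 0)) (bQuad bφ w₁ w₂ w₃)
    (gaugeHam (potV bφ) (potU a b bφ 0 w₁ w₂ w₃)) η = 0 := by
  simp [Quad.bracket, Quad.dx, Quad.dp, Quad.eval, bQuad, gaugeHam, potV, potU, field, rho]
  ring

lemma bracket_cQuad : Quad.bracket (field 0 0 (C 0)) (cQuad w₁ w₂ w₃ s)
    (gaugeHam (potV bφ) (potU a b bφ 0 w₁ w₂ w₃)) η = 0 := by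
  simp [Quad.bracket, Quad.dx, Quad.dp, Quad.eval, cQuad, gaugeHam, potV, potU, field, rho]
  ring

lemma bracket_angQuad : Quad.bracket (field 0 0 (C 0)) angQuad
    (gaugeHam (potV bφ) (potU a b bφ 0 0 0 w₃)) η = 0 := by
  simp [Quad.bracket, Quad.dx, Quad.dp, Quad.eval, angQuad, gaugeHam, potV, potU, field, rho]
  ring

lemma bracket_angSqQuad : Quad.bracket (field 0 0 (C 0)) angSqQuad
    (gaugeHam (potV bφ) (potU a b bφ 0 0 0 w₃)) η = 0 := by
  simp [Quad.bracket, Quad.dx, Quad.dp, Quad.eval, angSqQuad, gaugeHam, potV, potU, field, rho]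
  ring

lemma bracket_aQuad_bQuad :
    Quad.bracket (field 0 0 (C 0)) (aQuad bφ w₁ w₃) (bQuad bφ w₁ w₂ w₃) η =
      2 * bφ * (s * momQuad.eval η - (cQuad w₁ w₂ w₃ s).eval η) := by
  simp [Quad.bracket, Quad.dx, Quad.dp, Quad.eval, aQuad, bQuad, cQuad, momQuad, field]
  ring

lemma bracket_aQuad_cQuad :
    Quad.bracket (field 0 0 (C 0)) (aQuad bφ w₁ w₃) (cQuad w₁ w₂ w₃ s) η =
      -2 * (momQuad.eval η - 2 * w₃) * (bQuad bφ w₁ w₂ w₃).eval η + 2 * bφ * w₁ * w₂ := by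
  simp [Quad.bracket, Quad.dx, Quad.dp, Quad.eval, aQuad, bQuad, cQuad, momQuad, field]
  ring

lemma bracket_bQuad_cQuad :
    Quad.bracket (field 0 0 (C 0)) (bQuad bφ w₁ w₂ w₃) (cQuad w₁ w₂ w₃ s) η =
      (momQuad.eval η - 2 * w₃) * (momQuad.eval η ^ 2 + 2 * (aQuad bφ w₁ w₃).eval η
        - 2 * (gaugeHam (potV bφ) (potU a b bφ 0 w₁ w₂ w₃)).eval η) + bφ * (w₂ ^ 2 - w₁ ^ 2) := by
  simp [Quad.bracket, Quad.dx, Quad.dp, Quad.eval, aQuad, bQuad, cQuad, momQuad, field, gaugeHam,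
    potU, potV, rho]
  ring

lemma bracket_aQuad_momQuad :
    Quad.bracket (field 0 0 (C 0)) (aQuad bφ w₁ w₃) momQuad η = 0 := by
  simp [Quad.bracket, Quad.dx, Quad.dp, Quad.eval, aQuad, momQuad, field]

lemma bracket_bQuad_momQuad :
    Quad.bracket (field 0 0 (C 0)) (bQuad bφ w₁ w₂ w₃) momQuad η = 0 := by
  simp [Quad.bracket, Quad.dx, Quad.dp, Quad.eval, bQuad, momQuad, field]

lemma bracket_cQuad_momQuad :
    Quad.bracket (field 0 0 (C 0)) (cQuad w₁ w₂ w₃ s) momQuad η = 0 := by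
  simp [Quad.bracket, Quad.dx, Quad.dp, Quad.eval, cQuad, momQuad, field]

lemma bracket_momQuad_angQuad : Quad.bracket (field 0 0 (C 0)) momQuad angQuad η = 0 := by
  simp [Quad.bracket, Quad.dx, Quad.dp, Quad.eval, angQuad, momQuad, field]

lemma bracket_angQuad_cQuad :
    Quad.bracket (field 0 0 (C 0)) angQuad (cQuad 0 0 w₃ s) η = 0 := by
  simp [Quad.bracket, Quad.dx, Quad.dp, Quad.eval, angQuad, cQuad, field]
  ring

lemma bracket_angQuad_aQuad :
    Quad.bracket (field 0 0 (C 0)) angQuad (aQuad bφ 0 w₃) η = 2 * (bQuad bφ 0 0 w₃).eval η := by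
  simp [Quad.bracket, Quad.dx, Quad.dp, Quad.eval, angQuad, aQuad, bQuad, field]
  ring

lemma bracket_angQuad_bQuad :
    Quad.bracket (field 0 0 (C 0)) angQuad (bQuad bφ 0 0 w₃) η = -(momQuad.eval η ^ 2
      - 2 * (gaugeHam (potV bφ) (potU a b bφ 0 0 0 w₃)).eval η) - 2 * (aQuad bφ 0 w₃).eval η := by
  simp [Quad.bracket, Quad.dx, Quad.dp, Quad.eval, angQuad, aQuad, bQuad, momQuad, field, gaugeHam,
    potU, potV, rho]
  ring

lemma cQuad_eval_eq : (cQuad 0 0 w₃ s).eval η = momQuad.eval η * angQuad.eval η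
    - 2 * w₃ * angQuad.eval η + s * momQuad.eval η := by
  simp [Quad.eval, angQuad, cQuad, momQuad]
  ring

lemma bQuad_eval_sq : (bQuad bφ 0 0 w₃).eval η ^ 2 =
    (2 * (gaugeHam (potV bφ) (potU a b bφ 0 0 0 w₃)).eval η - momQuad.eval η ^ 2
      - (aQuad bφ 0 w₃).eval η) * (aQuad bφ 0 w₃).eval η
      + bφ * (momQuad.eval η - 2 * w₃) * angQuad.eval η ^ 2 := by
  simp [Quad.eval, angQuad, aQuad, bQuad, momQuad, gaugeHam, potU, potV, rho]
  ring

lemma bracket_aQuad_sqQuad :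
    Quad.bracket (field 0 0 (C 0)) (aQuad bφ w₁ w₃) sqQuad η = 0 := by
  simp [Quad.bracket, Quad.dx, Quad.dp, Quad.eval, aQuad, sqQuad, field]

lemma bracket_angSqQuad_sqQuad :
    Quad.bracket (field 0 0 (C 0)) angSqQuad sqQuad η = 0 := by
  simp [Quad.bracket, Quad.dx, Quad.dp, Quad.eval, angSqQuad, sqQuad, field]

end Brackets

section

variable {bφ : ℝ} {A : Vec → Vec} (hA : ContDiff ℝ ∞ A) (hφ : bφ ≠ 0)
include hA hφ

lemma functionallyIndependent_ABP (a b w₁ w₂ w₃ : ℝ) :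
    FunctionallyIndependent ![ham A (famW a b bφ 0 w₁ w₂ w₃), intA bφ w₁ w₃ A,
      intB bφ w₁ w₂ w₃ A, intP bφ A] := by
  have e : ![ham A (famW a b bφ 0 w₁ w₂ w₃), intA bφ w₁ w₃ A, intB bφ w₁ w₂ w₃ A, intP bφ A]
      = fun i => ((![gaugeHam (potV bφ) (potU a b bφ 0 w₁ w₂ w₃), aQuad bφ w₁ w₃,
        bQuad bφ w₁ w₂ w₃, momQuad] : Fin 4 → Quad) i).fn (gauge bφ A) := by
    rw [gaugeHam_fn, intA_eq, intB_eq, intP_eq]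
    funext i
    fin_cases i <;> rfl
  rw [e]
  refine Quad.functionallyIndependent (contDiff_gauge bφ hA) _
    -- Momentum derivatives alone give only three rows, so the row `∂/∂y` is added. The bracketed
    -- factor comes from the `p₂` and `∂/∂y` rows on `H` and `X^b`, and the test point makes it
    -- `-1`.
    (D := fun η => η.2 0 * (η.2 1 * (w₁ - η.1 0 * (η.2 2 - 2 * w₃))
      - η.2 0 * (w₂ - η.1 1 * (η.2 2 - 2 * w₃))))
    (by fun_prop) (η₀ := (![w₁ + 1, w₂, 0], ![1, 1, 2 * w₃ + 1])) ?_ ?_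
  · simp
  · intro η hD g hp hx
    have h0 := hp 0
    have h1 := hp 1
    have h2 := hp 2
    have hy := hx 1
    simp [Fin.sum_univ_four, Quad.dp, Quad.dx, Quad.eval, gaugeHam, aQuad, bQuad, momQuad, potU,
      potV, rho] at h0 h1 h2 hy
    obtain ⟨hc, hdet⟩ := mul_ne_zero_iff.1 hD
    have hdet' : bφ * (η.2 1 * (w₁ - η.1 0 * (η.2 2 - 2 * w₃))
      - η.2 0 * (w₂ - η.1 1 * (η.2 2 - 2 * w₃))) ≠ 0 := mul_ne_zero hφ hdet
    have g0 : g 0 = 0 := by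
      refine (mul_eq_zero.1 ?_).resolve_right hdet'
      linear_combination bφ * (w₁ - η.1 0 * (η.2 2 - 2 * w₃)) * h1 - η.2 0 * hy
    have g2 : g 2 = 0 := by
      simp only [g0, zero_mul, zero_add] at h1
      exact (mul_eq_zero.1 h1).resolve_right hc
    have g1 : g 1 = 0 := by
      simp only [g0, g2, zero_mul, zero_add, add_zero] at h0
      have : g 1 * η.2 0 = 0 := by linear_combination (1 / 2) * h0
      exact (mul_eq_zero.1 this).resolve_right hc
    have g3 : g 3 = 0 := by
      simpa only [g0, g1, g2, zero_mul, zero_add, neg_zero] using h2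
    intro i
    fin_cases i
    exacts [g0, g1, g2, g3]

omit hφ in
lemma functionallyIndependent_ACP (a b w₁ w₂ w₃ s : ℝ) :
    FunctionallyIndependent ![ham A (famW a b bφ 0 w₁ w₂ w₃), intA bφ w₁ w₃ A,
      intC bφ w₁ w₂ w₃ s A, intP bφ A] := by
  have e : ![ham A (famW a b bφ 0 w₁ w₂ w₃), intA bφ w₁ w₃ A, intC bφ w₁ w₂ w₃ s A, intP bφ A]
      = fun i => ((![gaugeHam (potV bφ) (potU a b bφ 0 w₁ w₂ w₃), aQuad bφ w₁ w₃,
        cQuad w₁ w₂ w₃ s, momQuad] : Fin 4 → Quad) i).fn (gauge bφ A) := by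
    rw [gaugeHam_fn, intA_eq, intC_eq, intP_eq]
    funext i
    fin_cases i <;> rfl
  rw [e]
  refine Quad.functionallyIndependent (contDiff_gauge bφ hA) _
    -- The same four rows as for `X^b`. At the test point `y (p₃ - 2 w₃) = w₂`, so the term with
    -- `b_φ` drops out and independence needs no condition on it.
    (D := fun η => η.2 0 * (-(η.2 1 * η.2 0 * (η.2 2 - 2 * w₃))
      - bφ * (w₂ - η.1 1 * (η.2 2 - 2 * w₃)) * (η.1 0 * (η.2 2 - 2 * w₃) - w₁)))
    (by fun_prop) (η₀ := (![0, w₂, 0], ![1, 1, 2 * w₃ + 1])) ?_ ?_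
  · simp
  · intro η hD g hp hx
    have h0 := hp 0
    have h1 := hp 1
    have h2 := hp 2
    have hy := hx 1
    simp [Fin.sum_univ_four, Quad.dp, Quad.dx, Quad.eval, gaugeHam, aQuad, cQuad, momQuad, potU,
      potV, rho] at h0 h1 h2 hy
    obtain ⟨hc, hdet⟩ := mul_ne_zero_iff.1 hD
    have g0 : g 0 = 0 := by
      refine (mul_eq_zero.1 ?_).resolve_right hdet
      linear_combination -(η.2 0 * (η.2 2 - 2 * w₃)) * h1
        - (η.1 0 * (η.2 2 - 2 * w₃) - w₁) * hy
    have g2 : g 2 = 0 := by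
      refine (mul_eq_zero.1 ?_).resolve_right hdet
      linear_combination η.2 1 * hy - bφ * (w₂ - η.1 1 * (η.2 2 - 2 * w₃)) * h1
    have g1 : g 1 = 0 := by
      simp only [g0, g2, zero_mul, zero_add, add_zero] at h0
      have : g 1 * η.2 0 = 0 := by linear_combination (1 / 2) * h0
      exact (mul_eq_zero.1 this).resolve_right hc
    have g3 : g 3 = 0 := by
      simpa only [g0, g1, g2, zero_mul, zero_add, neg_zero] using h2
    intro i
    fin_cases i
    exacts [g0, g1, g2, g3]

omit hφ in
lemma functionallyIndependent_APL (a b w₃ : ℝ) :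
    FunctionallyIndependent ![ham A (famW a b bφ 0 0 0 w₃), intA bφ 0 w₃ A, intP bφ A,
      covAng A 2] := by
  have e : ![ham A (famW a b bφ 0 0 0 w₃), intA bφ 0 w₃ A, intP bφ A, covAng A 2]
      = fun i => ((![gaugeHam (potV bφ) (potU a b bφ 0 0 0 w₃), aQuad bφ 0 w₃,
        momQuad, angQuad] : Fin 4 → Quad) i).fn (gauge bφ A) := by
    rw [gaugeHam_fn, intA_eq, intP_eq, covAng_eq bφ]
    funext i
    fin_cases i <;> rfl
  rw [e]
  refine Quad.functionallyIndependent (contDiff_gauge bφ hA) _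
    (D := fun η => η.2 0 * (-(η.2 1 * η.2 0)
      - bφ * (0 - η.1 1 * (η.2 2 - 2 * w₃)) * η.1 0))
    (by fun_prop) (η₀ := (![0, 0, 0], ![1, 1, 0])) ?_ ?_
  · simp
  · intro η hD g hp hx
    have h0 := hp 0
    have h1 := hp 1
    have h2 := hp 2
    have hy := hx 1
    simp [Fin.sum_univ_four, Quad.dp, Quad.dx, Quad.eval, gaugeHam, aQuad, angQuad, momQuad, potU,
      potV, rho] at h0 h1 h2 hy
    obtain ⟨hc, hdet⟩ := mul_ne_zero_iff.1 hD
    have g0 : g 0 = 0 := by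
      refine (mul_eq_zero.1 ?_).resolve_right hdet
      linear_combination -(η.2 0) * h1 - η.1 0 * hy
    have g3 : g 3 = 0 := by
      refine (mul_eq_zero.1 ?_).resolve_right hdet
      linear_combination η.2 1 * hy - bφ * (0 - η.1 1 * (η.2 2 - 2 * w₃)) * h1
    have g1 : g 1 = 0 := by
      simp only [g0, g3, zero_mul, zero_add, add_zero, neg_zero] at h0
      have : g 1 * η.2 0 = 0 := by linear_combination (1 / 2) * h0
      exact (mul_eq_zero.1 this).resolve_right hc
    have g2 : g 2 = 0 := by
      simpa only [g0, g1, g3, zero_mul, zero_add, add_zero, neg_zero] using h2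
    intro i
    fin_cases i
    exacts [g0, g1, g2, g3]

end

lemma isQuadraticElement_mom_sq : IsQuadraticElement (fun ξ => mom 0 ξ ^ 2) :=
  isQuadraticElement_sq 0

lemma isQuadraticElement_ang_sq : IsQuadraticElement (fun ξ => ang 2 ξ ^ 2) :=
  isQuadraticElement_sq 5

section

variable {bφ : ℝ} {A : Vec → Vec} (hA : ContDiff ℝ ∞ A) (hB : ∀ x, curl A x = famB bφ 0 x)
include hA hB

lemma isQuadraticIntegral_intP (a b w₁ w₂ w₃ : ℝ) :
    IsQuadraticIntegral A (famW a b bφ 0 w₁ w₂ w₃) (intP bφ A) := by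
  rw [intP_eq]
  exact isQuadraticIntegral_gauge hA hB (by rw [lead_momQuad]; exact isQuadraticElement_zero)
    fun η => bracket_momQuad a b bφ w₁ w₂ w₃ η 0

lemma isQuadraticIntegral_intA (a b w₁ w₂ w₃ : ℝ) :
    IsQuadraticIntegral A (famW a b bφ 0 w₁ w₂ w₃) (intA bφ w₁ w₃ A) := by
  rw [intA_eq]
  exact isQuadraticIntegral_gauge hA hB (by rw [lead_aQuad]; exact isQuadraticElement_mom_sq)
    (bracket_aQuad a b bφ w₁ w₂ w₃)

lemma isQuadraticIntegral_intB (a b w₁ w₂ w₃ : ℝ) :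
    IsQuadraticIntegral A (famW a b bφ 0 w₁ w₂ w₃) (intB bφ w₁ w₂ w₃ A) := by
  rw [intB_eq]
  exact isQuadraticIntegral_gauge hA hB
    (by rw [lead_bQuad]; exact isQuadraticElement_gen_mul (by decide))
    (bracket_bQuad a b bφ w₁ w₂ w₃)

lemma isQuadraticIntegral_intC (a b w₁ w₂ w₃ s : ℝ) :
    IsQuadraticIntegral A (famW a b bφ 0 w₁ w₂ w₃) (intC bφ w₁ w₂ w₃ s A) := by
  rw [intC_eq]
  exact isQuadraticIntegral_gauge hA hB
    (by rw [lead_cQuad]; exact isQuadraticElement_lead₁ 0 0)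
    (bracket_cQuad a b bφ w₁ w₂ w₃ s)

lemma isQuadraticIntegral_covAng (a b w₃ : ℝ) :
    IsQuadraticIntegral A (famW a b bφ 0 0 0 w₃) (covAng A 2) := by
  rw [covAng_eq bφ]
  exact isQuadraticIntegral_gauge hA hB (by rw [lead_angQuad]; exact isQuadraticElement_zero)
    (bracket_angQuad a b bφ w₃)

lemma belongsToClass_k (a b w₁ w₂ w₃ : ℝ) :
    BelongsToClass .k A (famW a b bφ 0 w₁ w₂ w₃) := by
  refine belongsToClass_gauge hA hB (F := aQuad bφ w₁ w₃) (G := sqQuad) ?_ ?_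
    (bracket_aQuad a b bφ w₁ w₂ w₃) (bracket_sqQuad a b bφ 0 w₁ w₂ w₃)
    (bracket_aQuad_sqQuad bφ w₁ w₃) ?_
  · rw [lead_aQuad]; exact isQuadraticElement_mom_sq
  · rw [lead_sqQuad]; exact isQuadraticElement_lead₂
  · rw [lead_aQuad, lead_sqQuad]; exact pairInClass_k

lemma belongsToClass_f (a b w₃ : ℝ) : BelongsToClass .f A (famW a b bφ 0 0 0 w₃) := by
  refine belongsToClass_gauge hA hB (F := angSqQuad) (G := sqQuad) ?_ ?_
    (bracket_angSqQuad a b bφ w₃) (bracket_sqQuad a b bφ 0 0 0 w₃) bracket_angSqQuad_sqQuad ?_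
  · rw [lead_angSqQuad]; exact isQuadraticElement_ang_sq
  · rw [lead_sqQuad]; exact isQuadraticElement_lead₂
  · rw [lead_angSqQuad, lead_sqQuad]; exact pairInClass_f

end

lemma FunctionallyIndependent.comp_equiv {n : ℕ} {F : Fin n → Phase → ℝ}
    (h : FunctionallyIndependent F) (σ : Equiv.Perm (Fin n)) :
    FunctionallyIndependent (fun i => F (σ i)) :=
  h.mono fun _ hξ => hξ.comp σ σ.injective

theorem poissonAlgebra {bφ : ℝ} {A : Vec → Vec} (hA : ContDiff ℝ ∞ A)
    (hB : ∀ x, curl A x = famB bφ 0 x) (a b w₁ w₂ w₃ s : ℝ) (ξ : Phase) :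
    poisson (intA bφ w₁ w₃ A) (intB bφ w₁ w₂ w₃ A) ξ
      = 2 * bφ * (s * intP bφ A ξ - intC bφ w₁ w₂ w₃ s A ξ) ∧
    poisson (intA bφ w₁ w₃ A) (intC bφ w₁ w₂ w₃ s A) ξ
      = -2 * (intP bφ A ξ - 2 * w₃) * intB bφ w₁ w₂ w₃ A ξ + 2 * bφ * w₁ * w₂ ∧
    poisson (intB bφ w₁ w₂ w₃ A) (intC bφ w₁ w₂ w₃ s A) ξ
      = (intP bφ A ξ - 2 * w₃) * (intP bφ A ξ ^ 2 + 2 * intA bφ w₁ w₃ A ξ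
        - 2 * ham A (famW a b bφ 0 w₁ w₂ w₃) ξ) + bφ * (w₂ ^ 2 - w₁ ^ 2) ∧
    poisson (intA bφ w₁ w₃ A) (intP bφ A) ξ = 0 ∧
    poisson (intB bφ w₁ w₂ w₃ A) (intP bφ A) ξ = 0 ∧
    poisson (intC bφ w₁ w₂ w₃ s A) (intP bφ A) ξ = 0 := by
  rw [intA_eq, intB_eq, intC_eq, intP_eq, gaugeHam_fn]
  simp only [poisson_gauge hA hB]
  exact ⟨bracket_aQuad_bQuad .., bracket_aQuad_cQuad .., bracket_bQuad_cQuad ..,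
    bracket_aQuad_momQuad .., bracket_bQuad_momQuad .., bracket_cQuad_momQuad ..⟩

theorem poissonAlgebra_axial {bφ : ℝ} {A : Vec → Vec} (hA : ContDiff ℝ ∞ A)
    (hB : ∀ x, curl A x = famB bφ 0 x) (a b w₃ s : ℝ) (ξ : Phase) :
    poisson (intP bφ A) (covAng A 2) ξ = 0 ∧
    poisson (covAng A 2) (intC bφ 0 0 w₃ s A) ξ = 0 ∧
    poisson (covAng A 2) (intA bφ 0 w₃ A) ξ = 2 * intB bφ 0 0 w₃ A ξ ∧
    poisson (covAng A 2) (intB bφ 0 0 w₃ A) ξ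
      = -(intP bφ A ξ ^ 2 - 2 * ham A (famW a b bφ 0 0 0 w₃) ξ) - 2 * intA bφ 0 w₃ A ξ ∧
    intC bφ 0 0 w₃ s A ξ
      = intP bφ A ξ * covAng A 2 ξ - 2 * w₃ * covAng A 2 ξ + s * intP bφ A ξ ∧
    intB bφ 0 0 w₃ A ξ ^ 2
      = (2 * ham A (famW a b bφ 0 0 0 w₃) ξ - intP bφ A ξ ^ 2 - intA bφ 0 w₃ A ξ)
          * intA bφ 0 w₃ A ξ + bφ * (intP bφ A ξ - 2 * w₃) * covAng A 2 ξ ^ 2 := by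
  rw [intA_eq, intB_eq, intC_eq, intP_eq, gaugeHam_fn, covAng_eq bφ]
  simp only [poisson_gauge hA hB]
  exact ⟨bracket_momQuad_angQuad .., bracket_angQuad_cQuad .., bracket_angQuad_aQuad ..,
    bracket_angQuad_bQuad .., cQuad_eval_eq .., bQuad_eval_sq ..⟩

/-! ### The limit `b_φ = 0` -/

/-- The translation integral in the first direction in a homogeneous magnetic field. -/
def transQuad₁ (bZ : ℝ) : Quad := ⟨0, 0, 0, 0, 0, 0, 1, 0, 0, C bZ * X 1⟩

/-- The translation integral in the second direction. -/
def transQuad₂ (bZ : ℝ) : Quad := ⟨0, 0, 0, 0, 0, 0, 0, 1, 0, -(C bZ * X 0)⟩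

/-- The square of a translation integral. -/
def transSqQuad (bZ : ℝ) : Quad :=
  ⟨1, 0, 0, 0, 0, 0, 2 * C bZ * X 1, 0, 0, C bZ ^ 2 * X 1 ^ 2⟩

/-- The square of the rotation integral in a homogeneous magnetic field. -/
def rotSqQuad (bZ : ℝ) : Quad :=
  ⟨X 1 ^ 2, -(2 * X 0 * X 1), X 0 ^ 2, 0, 0, 0, C bZ * rho * X 1, -(C bZ * rho * X 0), 0,
    C (bZ ^ 2 / 4) * rho ^ 2⟩

lemma lead_transSqQuad (bZ : ℝ) : (transSqQuad bZ).lead = fun ξ => mom 0 ξ ^ 2 := by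
  funext ξ
  simp [Quad.lead, transSqQuad, mom]

lemma lead_transQuad₁ (bZ : ℝ) : (transQuad₁ bZ).lead = fun _ => 0 := by
  funext ξ; simp [Quad.lead, transQuad₁]

lemma lead_transQuad₂ (bZ : ℝ) : (transQuad₂ bZ).lead = fun _ => 0 := by
  funext ξ; simp [Quad.lead, transQuad₂]

lemma lead_rotSqQuad (bZ : ℝ) : (rotSqQuad bZ).lead = fun ξ => ang 2 ξ ^ 2 := by
  funext ξ
  simp [Quad.lead, rotSqQuad, ang, cross_apply]
  ring

section Brackets

variable (a b bZ w₁ w₂ w₃ : ℝ) (η : Phase)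

lemma bracket_transQuad₁ : Quad.bracket (field 0 0 (C bZ)) (transQuad₁ bZ)
    (gaugeHam (potV 0) (potU a b 0 bZ w₁ w₂ w₃)) η = 0 := by
  simp [Quad.bracket, Quad.dx, Quad.dp, Quad.eval, transQuad₁, gaugeHam, potV, potU, field, rho]

lemma bracket_transQuad₂ : Quad.bracket (field 0 0 (C bZ)) (transQuad₂ bZ)
    (gaugeHam (potV 0) (potU a b 0 bZ w₁ w₂ w₃)) η = 0 := by
  simp [Quad.bracket, Quad.dx, Quad.dp, Quad.eval, transQuad₂, gaugeHam, potV, potU, field, rho]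

lemma bracket_transSqQuad : Quad.bracket (field 0 0 (C bZ)) (transSqQuad bZ)
    (gaugeHam (potV 0) (potU a b 0 bZ w₁ w₂ w₃)) η = 0 := by
  simp [Quad.bracket, Quad.dx, Quad.dp, Quad.eval, transSqQuad, gaugeHam, potV, potU, field, rho]
  ring

lemma bracket_rotSqQuad : Quad.bracket (field 0 0 (C bZ)) (rotSqQuad bZ)
    (gaugeHam (potV 0) (potU a b 0 bZ w₁ w₂ w₃)) η = 0 := by
  simp [Quad.bracket, Quad.dx, Quad.dp, Quad.eval, rotSqQuad, gaugeHam, potV, potU, field, rho]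
  ring

lemma bracket_momQuad_transQuad₁ :
    Quad.bracket (field 0 0 (C bZ)) momQuad (transQuad₁ bZ) η = 0 := by
  simp [Quad.bracket, Quad.dx, Quad.dp, Quad.eval, transQuad₁, momQuad, field]

lemma bracket_transSqQuad_sqQuad :
    Quad.bracket (field 0 0 (C bZ)) (transSqQuad bZ) sqQuad η = 0 := by
  simp [Quad.bracket, Quad.dx, Quad.dp, Quad.eval, transSqQuad, sqQuad, field]

lemma bracket_rotSqQuad_sqQuad :
    Quad.bracket (field 0 0 (C bZ)) (rotSqQuad bZ) sqQuad η = 0 := by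
  simp [Quad.bracket, Quad.dx, Quad.dp, Quad.eval, rotSqQuad, sqQuad, field, rho]

end Brackets

section

variable {bZ : ℝ} {A : Vec → Vec} (hA : ContDiff ℝ ∞ A) (hB : ∀ x, curl A x = famB 0 bZ x)
include hA

lemma functionallyIndependent_homogeneous (hZ : bZ ≠ 0) (a b w₁ w₂ w₃ : ℝ) :
    FunctionallyIndependent ![ham A (famW a b 0 bZ w₁ w₂ w₃), momQuad.fn (gauge 0 A),
      (transQuad₁ bZ).fn (gauge 0 A), (transQuad₂ bZ).fn (gauge 0 A)] := by
  have e : ![ham A (famW a b 0 bZ w₁ w₂ w₃), momQuad.fn (gauge 0 A),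
      (transQuad₁ bZ).fn (gauge 0 A), (transQuad₂ bZ).fn (gauge 0 A)]
      = fun i => ((![gaugeHam (potV 0) (potU a b 0 bZ w₁ w₂ w₃), momQuad, transQuad₁ bZ,
        transQuad₂ bZ] : Fin 4 → Quad) i).fn (gauge 0 A) := by
    rw [gaugeHam_fn]
    funext i
    fin_cases i <;> rfl
  rw [e]
  -- The effective potential is zero here, so the rows `∂/∂x` and `∂/∂y` see only the two
  -- translation integrals, through `b_Z`; then `p₁ ≠ 0` handles `H`.
  refine Quad.functionallyIndependent (contDiff_gauge 0 hA) _ (D := fun η => η.2 0)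
    (by fun_prop) (η₀ := (0, ![1, 0, 0])) (by simp) ?_
  intro η hD g hp hx
  have h0 := hp 0
  have h2 := hp 2
  have hx0 := hx 0
  have hy := hx 1
  simp [Fin.sum_univ_four, Quad.dp, Quad.dx, Quad.eval, gaugeHam, transQuad₁, transQuad₂, momQuad,
    potU, potV, rho, hZ] at h0 h2 hx0 hy
  have g0 : g 0 = 0 := by
    refine (mul_eq_zero.1 ?_).resolve_right hD
    simpa only [hy, add_zero] using h0
  have g1 : g 1 = 0 := by simpa only [g0, zero_mul, zero_add] using h2
  intro i
  fin_cases i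
  exacts [g0, g1, hy, hx0]

include hB

lemma belongsToClass_k_homogeneous (a b w₁ w₂ w₃ : ℝ) :
    BelongsToClass .k A (famW a b 0 bZ w₁ w₂ w₃) := by
  refine belongsToClass_gauge hA hB (F := transSqQuad bZ) (G := sqQuad) ?_ ?_
    (bracket_transSqQuad a b bZ w₁ w₂ w₃) (bracket_sqQuad a b 0 bZ w₁ w₂ w₃)
    (bracket_transSqQuad_sqQuad bZ) ?_
  · rw [lead_transSqQuad]; exact isQuadraticElement_mom_sq
  · rw [lead_sqQuad]; exact isQuadraticElement_lead₂
  · rw [lead_transSqQuad, lead_sqQuad]; exact pairInClass_k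

lemma belongsToClass_f_homogeneous (a b w₁ w₂ w₃ : ℝ) :
    BelongsToClass .f A (famW a b 0 bZ w₁ w₂ w₃) := by
  refine belongsToClass_gauge hA hB (F := rotSqQuad bZ) (G := sqQuad) ?_ ?_
    (bracket_rotSqQuad a b bZ w₁ w₂ w₃) (bracket_sqQuad a b 0 bZ w₁ w₂ w₃)
    (bracket_rotSqQuad_sqQuad bZ) ?_
  · rw [lead_rotSqQuad]; exact isQuadraticElement_ang_sq
  · rw [lead_sqQuad]; exact isQuadraticElement_lead₂
  · rw [lead_rotSqQuad, lead_sqQuad]; exact pairInClass_f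

end

/-! ### Invariance of all quadratic integrals under translations along the axis. -/

/-- The determining equations of a quadratic integral of `(π² + c²) / 2 + V c + U`, where `c` is the
conserved third momentum, in the magnetic field `(0, 0, β)`. -/
structure AxialSystem (V U : Sm) (β : ℝ) (q : Quad) : Prop where
  k0 : d 0 q.k11 = 0
  k1 : d 1 q.k11 + d 0 q.k12 = 0
  k2 : d 0 q.k22 + d 1 q.k12 = 0
  k3 : d 1 q.k22 = 0
  u00 : d 0 q.u1 + d 2 q.k11 = 0
  u01 : d 1 q.u1 + d 0 q.u2 + d 2 q.k12 = 0
  u11 : d 1 q.u2 + d 2 q.k22 = 0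
  f0 : d 0 q.f + d 2 q.u1 = 0
  f1 : d 1 q.f + d 2 q.u2 = 0
  f2 : d 2 q.f = 0
  t00 : d 0 q.t1 + V * d 2 q.k11 + C β * q.k12 = 0
  t01 : d 1 q.t1 + d 0 q.t2 + V * d 2 q.k12 - 2 * C β * (q.k11 - q.k22) = 0
  t11 : d 1 q.t2 + V * d 2 q.k22 - C β * q.k12 = 0
  h0 : d 0 q.h + d 2 q.t1 + V * d 2 q.u1 - (2 * q.k11 * d 0 V + q.k12 * d 1 V) + C β * q.u2 = 0
  h1 : d 1 q.h + d 2 q.t2 + V * d 2 q.u2 - (q.k12 * d 0 V + 2 * q.k22 * d 1 V) - C β * q.u1 = 0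
  h2 : d 2 q.h + V * d 2 q.f - (q.u1 * d 0 V + q.u2 * d 1 V) = 0
  n0 : d 0 q.n + V * d 2 q.t1 - (2 * q.k11 * d 0 U + q.k12 * d 1 U) + C β * q.t2 = 0
  n1 : d 1 q.n + V * d 2 q.t2 - (q.k12 * d 0 U + 2 * q.k22 * d 1 U) - C β * q.t1 = 0
  n2 : d 2 q.n + V * d 2 q.h - (q.u1 * d 0 U + q.u2 * d 1 U) - (q.t1 * d 0 V + q.t2 * d 1 V) = 0
  w : V * d 2 q.n - (q.t1 * d 0 U + q.t2 * d 1 U) = 0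

lemma axialSystem_of_bracket {V U : Sm} {β : ℝ} {q : Quad} (hV : d 2 V = 0) (hU : d 2 U = 0)
    (h : ∀ η, Quad.bracket (field 0 0 (C β)) q (gaugeHam V U) η = 0) : AxialSystem V U β q := by
  have k := fun x : Vec => cubic_coeff
    (c300 := (d 0 q.k11) x) (c210 := (d 1 q.k11 + d 0 q.k12) x)
    (c120 := (d 0 q.k22 + d 1 q.k12) x) (c030 := (d 1 q.k22) x)
    (c201 := (d 0 q.u1 + d 2 q.k11) x) (c111 := (d 1 q.u1 + d 0 q.u2 + d 2 q.k12) x)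
    (c021 := (d 1 q.u2 + d 2 q.k22) x) (c102 := (d 0 q.f + d 2 q.u1) x)
    (c012 := (d 1 q.f + d 2 q.u2) x) (c003 := (d 2 q.f) x)
    (c200 := (d 0 q.t1 + V * d 2 q.k11 + C β * q.k12) x)
    (c110 := (d 1 q.t1 + d 0 q.t2 + V * d 2 q.k12 - 2 * C β * (q.k11 - q.k22)) x)
    (c020 := (d 1 q.t2 + V * d 2 q.k22 - C β * q.k12) x)
    (c101 := (d 0 q.h + d 2 q.t1 + V * d 2 q.u1 - (2 * q.k11 * d 0 V + q.k12 * d 1 V)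
      + C β * q.u2) x)
    (c011 := (d 1 q.h + d 2 q.t2 + V * d 2 q.u2 - (q.k12 * d 0 V + 2 * q.k22 * d 1 V)
      - C β * q.u1) x)
    (c002 := (d 2 q.h + V * d 2 q.f - (q.u1 * d 0 V + q.u2 * d 1 V)) x)
    (c100 := (d 0 q.n + V * d 2 q.t1 - (2 * q.k11 * d 0 U + q.k12 * d 1 U) + C β * q.t2) x)
    (c010 := (d 1 q.n + V * d 2 q.t2 - (q.k12 * d 0 U + 2 * q.k22 * d 1 U) - C β * q.t1) x)
    (c001 := (d 2 q.n + V * d 2 q.h - (q.u1 * d 0 U + q.u2 * d 1 U)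
      - (q.t1 * d 0 V + q.t2 * d 1 V)) x)
    (c000 := (V * d 2 q.n - (q.t1 * d 0 U + q.t2 * d 1 U)) x)
    (fun p r s => by
      have := h (x, ![p, r, s])
      simp [Quad.bracket, Quad.eval, Quad.dx, Quad.dp, gaugeHam, field, hV, hU] at this ⊢
      linear_combination this)
  exact
    { w := Sm.ext fun x => (k x).1.1
      n0 := Sm.ext fun x => (k x).1.2.1
      n1 := Sm.ext fun x => (k x).1.2.2.1
      n2 := Sm.ext fun x => (k x).1.2.2.2
      t00 := Sm.ext fun x => (k x).2.1.1
      t01 := Sm.ext fun x => (k x).2.1.2.1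
      h0 := Sm.ext fun x => (k x).2.1.2.2.1
      t11 := Sm.ext fun x => (k x).2.1.2.2.2.1
      h1 := Sm.ext fun x => (k x).2.1.2.2.2.2.1
      h2 := Sm.ext fun x => (k x).2.1.2.2.2.2.2
      k0 := Sm.ext fun x => (k x).2.2.1
      k1 := Sm.ext fun x => (k x).2.2.2.1
      u00 := Sm.ext fun x => (k x).2.2.2.2.1
      k2 := Sm.ext fun x => (k x).2.2.2.2.2.1
      u01 := Sm.ext fun x => (k x).2.2.2.2.2.2.1
      f0 := Sm.ext fun x => (k x).2.2.2.2.2.2.2.1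
      k3 := Sm.ext fun x => (k x).2.2.2.2.2.2.2.2.1
      u11 := Sm.ext fun x => (k x).2.2.2.2.2.2.2.2.2.1
      f1 := Sm.ext fun x => (k x).2.2.2.2.2.2.2.2.2.2.1
      f2 := Sm.ext fun x => (k x).2.2.2.2.2.2.2.2.2.2.2 }

/-- The zero polynomial. -/
instance : Zero Quad := ⟨⟨0, 0, 0, 0, 0, 0, 0, 0, 0, 0⟩⟩

lemma Quad.eq_zero_iff {q : Quad} : q = 0 ↔ q.k11 = 0 ∧ q.k12 = 0 ∧ q.k22 = 0 ∧ q.u1 = 0 ∧ q.u2 = 0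
    ∧ q.f = 0 ∧ q.t1 = 0 ∧ q.t2 = 0 ∧ q.h = 0 ∧ q.n = 0 :=
  Quad.ext_iff

namespace AxialSystem

variable {V U : Sm} {β : ℝ} {q : Quad}

/-- The coefficients of the system do not depend on `z`, so it is stable under differentiation in
`z`. -/
lemma dz (H : AxialSystem V U β q) (hV : d 2 V = 0) (hU : d 2 U = 0) :
    AxialSystem V U β (q.dx 2) := by
  obtain ⟨k0, k1, k2, k3, u00, u01, u11, f0, f1, f2, t00, t01, t11, h0, h1, h2, n0, n1, n2, w⟩ := H
  have e : ∀ {f : Sm}, f = 0 → d 2 f = 0 := fun h => by rw [h, d_zero]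
  replace k0 := e k0
  replace k1 := e k1
  replace k2 := e k2
  replace k3 := e k3
  replace u00 := e u00
  replace u01 := e u01
  replace u11 := e u11
  replace f0 := e f0
  replace f1 := e f1
  replace f2 := e f2
  replace t00 := e t00
  replace t01 := e t01
  replace t11 := e t11
  replace h0 := e h0
  replace h1 := e h1
  replace h2 := e h2
  replace n0 := e n0
  replace n1 := e n1
  replace n2 := e n2
  replace w := e w
  simp only [d_add, d_sub, d_mul, d_C, d_ofNat, hV, hU, d20, d21, d_zero, zero_mul, mul_zero,
    zero_add, add_zero] at k0 k1 k2 k3 u00 u01 u11 f0 f1 f2 t00 t01 t11 h0 h1 h2 n0 n1 n2 w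
  constructor <;> simp only [Quad.dx] <;> assumption

end AxialSystem

/-- A smooth planar vector field orthogonal to the position vector and of Killing type is a
rotation. -/
lemma exists_rotation {r1 r2 : Sm} (h11 : d 0 r1 = 0) (h22 : d 1 r2 = 0)
    (h12 : d 0 r2 + d 1 r1 = 0) (hz1 : d 2 r1 = 0) (hz2 : d 2 r2 = 0) (h : X 0 * r1 + X 1 * r2 = 0) :
    ∃ t, r1 = -(C t * X 1) ∧ r2 = C t * X 0 := by
  obtain ⟨t1, t2, t3, rfl, rfl⟩ := exists_killing h11 h22 h12 hz1 hz2
  have e0 := congrArg (d 0) h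
  have e1 := congrArg (d 1) h
  simp at e0 e1
  exact ⟨t3, by linear_combination e0, by linear_combination e1⟩

namespace AxialSystem

variable {V U : Sm} {β : ℝ} {q : Quad}

/-- The second derivatives along the axis vanish. -/
def Affine (q : Quad) : Prop := (q.dx 2).dx 2 = 0

lemma dz_u_const (H : AxialSystem V U β q) (hq : Affine q) :
    d 0 (d 2 q.u1) = 0 ∧ d 1 (d 2 q.u1) = 0 ∧ d 0 (d 2 q.u2) = 0 ∧ d 1 (d 2 q.u2) = 0 := by
  simp only [Affine, Quad.eq_zero_iff, Quad.dx] at hq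
  obtain ⟨z11, z12, z22, zu1, zu2, zf, zt1, zt2, zh, zn⟩ := hq
  have a := congrArg (d 2) H.u00
  have b := congrArg (d 2) H.u01
  have c := congrArg (d 2) H.u11
  have f0 := congrArg (d 1) H.f0
  have f1 := congrArg (d 0) H.f1
  simp [z11, z12, z22] at a b c f0 f1
  refine ⟨a, ?_, ?_, c⟩
  · apply eq_of_two; linear_combination b + f0 - f1
  · apply eq_of_two; linear_combination b - f0 + f1

/-- The coefficients of second degree do not depend on `z`, in the presence of a radial field. -/
lemma dz_eq_zero_of_radial {k : ℝ} (hk : k ≠ 0) (hV0 : d 0 V = -(C k * X 0))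
    (hV1 : d 1 V = -(C k * X 1)) (hV2 : d 2 V = 0) (hU2 : d 2 U = 0)
    (H : AxialSystem V U β q) (hq : Affine q) :
    q.dx 2 = 0 := by
  obtain ⟨u10, u11, u20, u21⟩ := H.dz_u_const hq
  simp only [Affine, Quad.eq_zero_iff, Quad.dx] at hq
  obtain ⟨z11, z12, z22, zu1, zu2, zf, zt1, zt2, zh, zn⟩ := hq
  have hc : ∀ {f : Sm}, C k * f = 0 → f = 0 := C_mul_cancel hk
  have hf := H.f2
  -- the mixed coefficients
  have eu : X 0 * d 2 q.u1 + X 1 * d 2 q.u2 = 0 := by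
    have e := congrArg (d 2) H.h2
    simp [hV0, hV1, zh, zf, hV2] at e
    apply hc
    linear_combination e
  have eu1 : d 2 q.u1 = 0 := by
    have := congrArg (d 0) eu
    simpa [u10, u20] using this
  have eu2 : d 2 q.u2 = 0 := by
    have := congrArg (d 1) eu
    simpa [u11, u21] using this
  have hh : d 2 q.h = -(C k * (X 0 * q.u1 + X 1 * q.u2)) := by
    have e := H.h2
    rw [hf, hV0, hV1] at e
    linear_combination e
  have i0 : q.u1 + X 0 * d 0 q.u1 + X 1 * d 0 q.u2 = 2 * d 2 q.k11 * X 0 + d 2 q.k12 * X 1 := by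
    have e := congrArg (d 2) H.h0
    simp [hV0, hV1, zu1, eu2, zt1, hV2, hh] at e
    refine sub_eq_zero.1 (hc ?_)
    linear_combination -e
  have i1 : q.u2 + X 0 * d 1 q.u1 + X 1 * d 1 q.u2 = d 2 q.k12 * X 0 + 2 * d 2 q.k22 * X 1 := by
    have e := congrArg (d 2) H.h1
    simp [hV0, hV1, zu2, eu1, zt2, hV2, hh] at e
    refine sub_eq_zero.1 (hc ?_)
    linear_combination -e
  have a0 := congrArg (d 2) H.k0
  have a1 := congrArg (d 2) H.k1
  have a2 := congrArg (d 2) H.k2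
  have a3 := congrArg (d 2) H.k3
  simp at a0 a1 a2 a3
  -- Write `K` for the quadratic form of the `z`-derivatives of `k11, k12, k22` at the position
  -- vector. Contracting `i0` and `i1` with that vector and removing the gradients of `u1, u2` gives
  -- `x u1 + y u2 = 3 K`.
  have hg : X 0 * q.u1 + X 1 * q.u2 =
      3 * (d 2 q.k11 * X 0 ^ 2 + d 2 q.k12 * (X 0 * X 1) + d 2 q.k22 * X 1 ^ 2) := by
    linear_combination X 0 * i0 + X 1 * i1 - X 0 ^ 2 * H.u00 - X 0 * X 1 * H.u01 - X 1 ^ 2 * H.u11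
  -- Applying the Euler field to `x u1 + y u2 = 3 K`: the left side becomes `2 K` by `i0` and `i1`,
  -- the right side `6 K` because the Killing tensor equations vanish when contracted three times
  -- with the position vector. Hence `K = 0`.
  have hq0 : d 2 q.k11 * X 0 ^ 2 + d 2 q.k12 * (X 0 * X 1) + d 2 q.k22 * X 1 ^ 2 = 0 := by
    have e := congrArg eul hg
    simp [eul] at e
    apply eq_of_two
    apply eq_of_two
    linear_combination -e + X 0 * i0 + X 1 * i1 - 3 * X 0 ^ 3 * a0 - 3 * X 0 ^ 2 * X 1 * a1
      - 3 * X 0 * X 1 ^ 2 * a2 - 3 * X 1 ^ 3 * a3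
  have hg0 : X 0 * q.u1 + X 1 * q.u2 = 0 := by rw [hg, hq0, mul_zero]
  rw [hg0, mul_zero, neg_zero] at hh
  have j0 : 2 * d 2 q.k11 * X 0 + d 2 q.k12 * X 1 = 0 := by
    have e := congrArg (d 0) hg0
    simp at e
    linear_combination e - i0
  have j1 : d 2 q.k12 * X 0 + 2 * d 2 q.k22 * X 1 = 0 := by
    have e := congrArg (d 1) hg0
    simp at e
    linear_combination e - i1
  -- the leading coefficients
  have s : d 1 (d 1 (d 2 q.k11)) = 0 ∧ d 0 (d 0 (d 2 q.k22)) = 0 := by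
    have b0 := congrArg (d 1) (congrArg (d 1) H.u00)
    have b1 := congrArg (d 0) (congrArg (d 1) H.u01)
    have b2 := congrArg (d 0) (congrArg (d 0) H.u11)
    have c1 := congrArg (d 1) a1
    have c2 := congrArg (d 0) a2
    simp at b0 b1 b2 c1 c2
    have three : ∀ {f : Sm}, 3 * f = 0 → f = 0 := fun {f} h =>
      C_mul_cancel (a := 3) (by norm_num) (by rw [map_ofNat]; exact h)
    constructor
    · apply three; linear_combination b0 + b2 - b1 + 2 * c1 - c2
    · apply three; linear_combination b0 + b2 - b1 - c1 + 2 * c2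
  have e11 : d 2 q.k11 = 0 := by
    have e0 := congrArg (d 0) j0
    have e1 := congrArg (d 1) e0
    simp at e0 e1
    have c1 := congrArg (d 1) a1
    have c0 := congrArg (d 1) a0
    simp at c1 c0
    apply eq_of_two
    have : d 1 (d 2 q.k11) = 0 := by
      linear_combination e1 - X 1 * c1 + X 1 * s.1 - a1 - 2 * X 0 * c0
    linear_combination e0 - 2 * X 0 * a0 - X 1 * a1 + X 1 * this
  have e22 : d 2 q.k22 = 0 := by
    have e0 := congrArg (d 1) j1
    have e1 := congrArg (d 0) e0
    simp at e0 e1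
    have c1 := congrArg (d 0) a2
    have c0 := congrArg (d 0) a3
    simp at c1 c0
    apply eq_of_two
    have : d 0 (d 2 q.k22) = 0 := by
      linear_combination e1 - X 0 * c1 + X 0 * s.2 - a2 - 2 * X 1 * c0
    linear_combination e0 - 2 * X 1 * a3 - X 0 * a2 + X 0 * this
  have e12 : d 2 q.k12 = 0 := by
    apply regular_X 1
    linear_combination j0 - 2 * X 0 * e11
  -- the terms of first degree
  have t := exists_rotation (r1 := d 2 q.t1) (r2 := d 2 q.t2)
    (by have e := congrArg (d 2) H.t00
        simp [z11, hV2, e12] at e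
        exact e)
    (by have e := congrArg (d 2) H.t11
        simp [z22, hV2, e12] at e
        exact e)
    (by have e := congrArg (d 2) H.t01
        simp [z12, hV2, e11, e22] at e
        linear_combination e)
    zt1 zt2
    (by have e := congrArg (d 2) H.n2
        simp [zn, zh, hV2, hV0, hV1, hU2, eu1, eu2] at e
        apply hc
        linear_combination e)
  obtain ⟨t, ht1, ht2⟩ := t
  -- The integrability condition of `h` in the plane equates the constant `2 t` with an expression
  -- that vanishes at the origin.
  have t0 : t = 0 := by
    have e1 := congrArg (d 1) H.h0
    have e0 := congrArg (d 0) H.h1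
    simp [eu1, eu2, hV0, hV1, ht1, ht2] at e0 e1
    have e : 2 * C t = C k * (3 * X 0 * d 1 q.k11 - 3 * X 1 * d 0 q.k22) := by
      linear_combination e0 - e1 - C k * X 0 * H.k1 + C k * X 1 * H.k2 + C β * H.u00 + C β * H.u11
        - C β * e11 - C β * e22
    have := congrArg (fun f : Sm => f 0) e
    simpa using this
  have et1 : d 2 q.t1 = 0 := by rw [ht1, t0]; simp
  have et2 : d 2 q.t2 = 0 := by rw [ht2, t0]; simp
  -- the potential
  have en : d 2 q.n = 0 := by
    have e0 := congrArg (d 2) H.n0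
    have e1 := congrArg (d 2) H.n1
    simp [e11, e12, e22, hU2, et1, et2] at e0 e1
    -- The derivative of `n` along the axis is a constant; in `n2` every other term vanishes at the
    -- origin, since `i0` and `i1` show `u1` and `u2` to vanish there.
    obtain ⟨c, hc⟩ := exists_C_of_d e0 e1 zn
    have e := H.n2
    rw [hc, hh, hV0, hV1] at e
    have v1 : q.u1 0 = 0 := by
      have := congrArg (fun f : Sm => f 0) i0
      simpa using this
    have v2 : q.u2 0 = 0 := by
      have := congrArg (fun f : Sm => f 0) i1
      simpa using this
    have := congrArg (fun f : Sm => f 0) e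
    simp [v1, v2] at this
    rw [hc, this, map_zero]
  exact Quad.eq_zero_iff.2 ⟨e11, e12, e22, eu1, eu2, hf, et1, et2, hh, en⟩

/-- Without `V` and `U` the `z`-derivatives of `h` and `n` vanish. In the differentiated equations
the magnetic terms then stand alone, and `β` can be divided out one coefficient after another. -/
lemma dz_eq_zero_of_homogeneous (hβ : β ≠ 0) (H : AxialSystem 0 0 β q) (hq : Affine q) :
    q.dx 2 = 0 := by
  obtain ⟨u10, u11, u20, u21⟩ := H.dz_u_const hq
  simp only [Affine, Quad.eq_zero_iff, Quad.dx] at hq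
  obtain ⟨z11, z12, z22, zu1, zu2, zf, zt1, zt2, zh, zn⟩ := hq
  have hc : ∀ {f : Sm}, C β * f = 0 → f = 0 := C_mul_cancel hβ
  have hf := H.f2
  have hh : d 2 q.h = 0 := by simpa using H.h2
  have hn : d 2 q.n = 0 := by simpa using H.n2
  have eu1 : d 2 q.u1 = 0 := hc (by
    have e := congrArg (d 2) H.h1
    simpa [hh, zt2] using e)
  have eu2 : d 2 q.u2 = 0 := hc (by
    have e := congrArg (d 2) H.h0
    simpa [hh, zt1] using e)
  have et1 : d 2 q.t1 = 0 := hc (by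
    have e := congrArg (d 2) H.n1
    simpa [hn, zt2] using e)
  have et2 : d 2 q.t2 = 0 := hc (by
    have e := congrArg (d 2) H.n0
    simpa [hn, zt1] using e)
  have e12 : d 2 q.k12 = 0 := hc (by
    have e := congrArg (d 2) H.t00
    simpa [et1] using e)
  have e1122 : d 2 q.k11 - d 2 q.k22 = 0 := hc (by
    have e := congrArg (d 2) H.t01
    simp [et1, et2] at e
    apply eq_of_two
    linear_combination e)
  have es : d 2 q.k11 + d 2 q.k22 = 0 := hc (by
    have e1 := congrArg (d 1) H.h0
    have e0 := congrArg (d 0) H.h1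
    simp [et1, et2] at e0 e1
    linear_combination e0 - e1 + C β * H.u00 + C β * H.u11)
  have e11 : d 2 q.k11 = 0 := by
    apply eq_of_two
    linear_combination e1122 + es
  have e22 : d 2 q.k22 = 0 := by linear_combination es - e11
  exact Quad.eq_zero_iff.2 ⟨e11, e12, e22, eu1, eu2, hf, et1, et2, hh, hn⟩

/-- Once the leading coefficients are gone, `h` is independent of `z`, `t1` and `t2` are affine, and
`n` is at most quadratic in `z`. -/
lemma dz_dz_dz_eq_zero (H : AxialSystem V U β q) (hV : d 2 V = 0)
    (hk : q.k11 = 0 ∧ q.k12 = 0 ∧ q.k22 = 0 ∧ q.u1 = 0 ∧ q.u2 = 0 ∧ q.f = 0) :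
    ((q.dx 2).dx 2).dx 2 = 0 := by
  obtain ⟨z11, z12, z22, zu1, zu2, zf⟩ := hk
  have h2 := H.h2
  simp [zu1, zu2, zf] at h2
  have t1 : d 2 (d 2 q.t1) = 0 := by
    have e := congrArg (d 2) H.h0
    simpa [z11, z12, zu1, zu2, h2] using e
  have t2 : d 2 (d 2 q.t2) = 0 := by
    have e := congrArg (d 2) H.h1
    simpa [z22, z12, zu1, zu2, h2] using e
  have n : d 2 (d 2 (d 2 q.n)) = 0 := by
    have e := congrArg (d 2) (congrArg (d 2) H.n2)
    simpa [zu1, zu2, h2, t1, t2, hV] using e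
  refine Quad.eq_zero_iff.2 ?_
  simp [Quad.dx, z11, z12, z22, zu1, zu2, zf, h2, t1, t2, n]

/-- Integrals with leading coefficients polynomial in `z` are invariant under translations in `z` as
soon as those affine in `z` are. -/
lemma dz_eq_zero_of_axialQuadratic (hV : d 2 V = 0) (hU : d 2 U = 0)
    (step : ∀ p, AxialSystem V U β p → Affine p → p.dx 2 = 0) (H : AxialSystem V U β q)
    (hk : AxialQuadratic q.k11 ∧ AxialQuadratic q.k12 ∧ AxialQuadratic q.k22 ∧
      AxialQuadratic q.u1 ∧ AxialQuadratic q.u2 ∧ AxialQuadratic q.f) : q.dx 2 = 0 := by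
  have H1 := H.dz hV hU
  have H2 := H1.dz hV hU
  have H3 := H2.dz hV hU
  have H4 := H3.dz hV hU
  -- Three derivatives remove the leading coefficients and three more remove the rest, so the fourth
  -- derivative of `q` is affine in `z`. Each use of `step` lowers by one the number of derivatives
  -- that annihilate `q`.
  exact step _ H (step _ H1 (step _ H2 (step _ H3 (step _ H4 (H3.dz_dz_dz_eq_zero hV hk)))))

end AxialSystem

lemma d2_potV (bφ : ℝ) : d 2 (potV bφ) = 0 := by simp [potV, rho]

lemma d0_potV (bφ : ℝ) : d 0 (potV bφ) = -(C bφ * X 0) := by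
  simp [potV, rho]
  linear_combination X 0 * two_mul_C_half bφ

lemma d1_potV (bφ : ℝ) : d 1 (potV bφ) = -(C bφ * X 1) := by
  simp [potV, rho]
  linear_combination X 1 * two_mul_C_half bφ

lemma d2_potU (a b bφ bZ w₁ w₂ w₃ : ℝ) : d 2 (potU a b bφ bZ w₁ w₂ w₃) = 0 := by
  simp [potU, rho]

lemma potV_zero : potV 0 = 0 := by simp [potV]

lemma potU_zero (a b bZ w₁ w₂ w₃ : ℝ) : potU a b 0 bZ w₁ w₂ w₃ = 0 := by simp [potU]

/-- Quadratic integrals of the systems of the family with a non-zero magnetic field are invariant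
under translations along the axis. -/
lemma exists_axialSystem {bφ bZ : ℝ} {A : Vec → Vec} (hA : ContDiff ℝ ∞ A)
    (hB : ∀ x, curl A x = famB bφ bZ x) (hne : bφ ≠ 0 ∨ bφ = 0 ∧ bZ ≠ 0) {a b w₁ w₂ w₃ : ℝ}
    {Q F : Phase → ℝ} (hQ : IsQuadraticElement Q) (hL : HasLeadingTerm A Q F)
    (hI : IsIntegral A (famW a b bφ bZ w₁ w₂ w₃) F) :
    ∃ q : Quad, F = q.fn (gauge bφ A) ∧ q.lead = Q ∧ q.dx 2 = 0 ∧
      AxialSystem (potV bφ) (potU a b bφ bZ w₁ w₂ w₃) bZ q := by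
  obtain ⟨k11, k12, k22, u1, u2, f, hk, hq⟩ := hQ.exists_lead
  have hL' := hL
  rw [hq 0 0 0 0] at hL'
  obtain ⟨t1, t2, h, n, rfl⟩ := Quad.exists_of_hasLeadingTerm_gauge (bφ := bφ) hL'
  have H : AxialSystem (potV bφ) (potU a b bφ bZ w₁ w₂ w₃) bZ
      ⟨k11, k12, k22, u1, u2, f, t1, t2, h, n⟩ := by
    refine axialSystem_of_bracket (d2_potV _) (d2_potU ..) ?_
    refine (Quad.bracket_eq_zero (contDiff_gauge bφ hA) (curl_gauge hA hB)).1 fun ξ => ?_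
    rw [← gaugeHam_fn]
    exact hI ξ
  refine ⟨_, rfl, (hq t1 t2 h n).symm, ?_, H⟩
  refine H.dz_eq_zero_of_axialQuadratic (d2_potV _) (d2_potU ..) ?_ hk
  rcases hne with hφ | ⟨rfl, hZ⟩
  · exact fun p Hp hp => Hp.dz_eq_zero_of_radial hφ (d0_potV _) (d1_potV _) (d2_potV _)
      (d2_potU ..) hp
  · rw [potV_zero, potU_zero]
    exact fun p Hp hp => Hp.dz_eq_zero_of_homogeneous hZ hp

/-! ### Upper bounds for the number of independent integrals. -/

namespace Quad

lemma sum_fderiv_eq_zero {n : ℕ} {A : Vec → Vec} (hA : ContDiff ℝ ∞ A) {q : Fin n → Quad}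
    {g : Fin n → ℝ} {ξ : Phase} (hp : ∀ k, ∑ i, g i * (q i).dp k (covShift A ξ) = 0)
    (hx : ∀ k, ∑ i, g i * ((q i).dx k).eval (covShift A ξ) = 0) :
    ∑ i, g i • fderiv ℝ ((q i).fn A) ξ = 0 := by
  refine ContinuousLinearMap.ext fun v => ?_
  rw [sum_apply]
  simp only [smul_apply, smul_eq_mul, _root_.zero_apply, fderiv_fn _ hA]
  have e : ∀ i, g i * ((v.1 0 * ((q i).dx 0).eval (covShift A ξ)
      + v.1 1 * ((q i).dx 1).eval (covShift A ξ) + v.1 2 * ((q i).dx 2).eval (covShift A ξ))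
      + ∑ j, (q i).dp j (covShift A ξ) * (v.2 j + (v.1 0 * partialX 0 (fun y => A y j) ξ.1
        + v.1 1 * partialX 1 (fun y => A y j) ξ.1 + v.1 2 * partialX 2 (fun y => A y j) ξ.1)))
      = v.1 0 * (g i * ((q i).dx 0).eval (covShift A ξ))
      + v.1 1 * (g i * ((q i).dx 1).eval (covShift A ξ))
      + v.1 2 * (g i * ((q i).dx 2).eval (covShift A ξ))
      + ∑ j, (v.2 j + (v.1 0 * partialX 0 (fun y => A y j) ξ.1
        + v.1 1 * partialX 1 (fun y => A y j) ξ.1 + v.1 2 * partialX 2 (fun y => A y j) ξ.1))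
        * (g i * (q i).dp j (covShift A ξ)) := by
    intro i
    simp only [Fin.sum_univ_three]
    ring
  simp only [e, Finset.sum_add_distrib, ← Finset.mul_sum, hx, mul_zero, zero_add]
  rw [Finset.sum_comm]
  simp only [← Finset.mul_sum, hp, mul_zero, Finset.sum_const_zero]

lemma contDiff_fn (q : Quad) {A : Vec → Vec} (hA : ContDiff ℝ ∞ A) : ContDiff ℝ ∞ (q.fn A) := by
  have hc : ∀ f : Sm, ContDiff ℝ ∞ (fun ξ : Phase => f ξ.1) := fun f => f.contDiff.comp contDiff_fst
  have hP : ∀ i, ContDiff ℝ ∞ (fun ξ : Phase => (covShift A ξ).2 i) := fun i =>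
    (contDiff_pi.1 contDiff_snd i).add ((contDiff_pi.1 hA i).comp contDiff_fst)
  exact ((((((((((hc q.k11).mul ((hP 0).pow 2)).add ((hc q.k12).mul ((hP 0).mul (hP 1)))).add
    ((hc q.k22).mul ((hP 1).pow 2))).add ((hc q.u1).mul ((hP 0).mul (hP 2)))).add
    ((hc q.u2).mul ((hP 1).mul (hP 2)))).add ((hc q.f).mul ((hP 2).pow 2))).add
    ((hc q.t1).mul (hP 0))).add ((hc q.t2).mul (hP 1))).add ((hc q.h).mul (hP 2))).add (hc q.n)

lemma exists_relation {n m : ℕ} (h : m < n) (v : Fin n → Fin m → ℝ) :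
    ∃ g : Fin n → ℝ, (∀ j, ∑ i, g i * v i j = 0) ∧ ∃ i, g i ≠ 0 := by
  have : ¬ LinearIndependent ℝ v := fun hv => by
    have := hv.fintype_card_le_finrank
    simp at this
    omega
  obtain ⟨g, hg, i, hi⟩ := Fintype.not_linearIndependent_iff.1 this
  refine ⟨g, fun j => ?_, i, hi⟩
  have := congrFun hg j
  simpa using this

/-- Functions whose differentials lie in the span of fewer differentials are dependent. -/
lemma functionallyDependent_of_span {n m : ℕ} (h : m < n) {A : Vec → Vec} (hA : ContDiff ℝ ∞ A)
    {q : Fin n → Quad} {p : Fin m → Quad} (hq : ∀ η i, ∃ c : Fin m → ℝ,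
      (∀ k, (q i).dp k η = ∑ j, c j * (p j).dp k η) ∧
      ∀ k, ((q i).dx k).eval η = ∑ j, c j * ((p j).dx k).eval η) :
    FunctionallyDependent (fun i => (q i).fn A) := by
  intro ξ hξ
  choose c hp hx using hq (covShift A ξ)
  obtain ⟨g, hg, i, hi⟩ := exists_relation h c
  refine hi (Fintype.linearIndependent_iff.1 hξ g (sum_fderiv_eq_zero hA ?_ ?_) i)
  · intro k
    simp only [hp, Finset.mul_sum]
    rw [Finset.sum_comm]
    simp only [← mul_assoc, ← Finset.sum_mul, hg, zero_mul, Finset.sum_const_zero]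
  · intro k
    simp only [hx, Finset.mul_sum]
    rw [Finset.sum_comm]
    simp only [← mul_assoc, ← Finset.sum_mul, hg, zero_mul, Finset.sum_const_zero]

/-- Five integrals that are invariant under the same translation are dependent. -/
lemma functionallyDependent_of_dz {A : Vec → Vec} (hA : ContDiff ℝ ∞ A) {B : Vec → Vec}
    {V U : Sm} {q : Fin 5 → Quad} (hz : ∀ i, (q i).dx 2 = 0)
    (hq : ∀ i η, bracket B (q i) (gaugeHam V U) η = 0) :
    FunctionallyDependent (fun i => (q i).fn A) := by
  intro ξ₀ hξ₀
  have hopen : IsOpen {ξ | LinearIndependent ℝ (fun i => fderiv ℝ ((q i).fn A) ξ)} :=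
    isOpen_setOfPred_linearIndependent.preimage
      (continuous_pi fun i => ((q i).contDiff_fn hA).continuous_fderiv (by simp))
  -- Independence is an open condition, so a point of independence may be moved to one with `p₁ ≠
  -- 0`.
  obtain ⟨ξ, hξ, hD⟩ := (dense_covShift hA (D := fun η => η.2 0) (by fun_prop)
    (η₀ := (0, ![1, 0, 0])) (by simp)).inter_open_nonempty _ hopen ⟨ξ₀, hξ₀⟩
  change (covShift A ξ).2 0 ≠ 0 at hD
  -- Four of the six components of a differential suffice: `∂/∂z` vanishes, and `∂/∂x` is recovered
  -- from the others below. Five vectors with four components are dependent.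
  obtain ⟨g, hg, i, hi⟩ := exists_relation (n := 5) (m := 4) (by norm_num) (fun i =>
    ![((q i).dx 1).eval (covShift A ξ), (q i).dp 0 (covShift A ξ), (q i).dp 1 (covShift A ξ),
      (q i).dp 2 (covShift A ξ)])
  have h1 := hg 0
  have p0 := hg 1
  have p1 := hg 2
  have p2 := hg 3
  simp only [Matrix.cons_val_zero, Matrix.cons_val_one, Matrix.cons_val] at h1 p0 p1 p2
  have h2 : ∑ i, g i * ((q i).dx 2).eval (covShift A ξ) = 0 :=
    Finset.sum_eq_zero fun i _ => by rw [hz]; simp [eval, show (0 : Quad) = ⟨0, 0, 0, 0, 0, 0, 0, 0, 0, 0⟩ from rfl]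
  -- The bracket with `H` is linear in the differential of the integral and contains its `∂/∂x`
  -- component with the factor `p₁`; all other components already satisfy the relation.
  have h0 : ∑ i, g i * ((q i).dx 0).eval (covShift A ξ) = 0 := by
    refine (mul_eq_zero.1 ?_).resolve_right hD
    have e : ∑ i, g i * bracket B (q i) (gaugeHam V U) (covShift A ξ) = 0 :=
      Finset.sum_eq_zero fun i _ => by rw [hq, mul_zero]
    simp only [bracket, Fin.sum_univ_five] at e h1 p0 p1 p2 h2 ⊢
    have hp : (gaugeHam V U).dp 0 (covShift A ξ) = (covShift A ξ).2 0 := by simp [dp, gaugeHam]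
    rw [hp] at e
    set H := gaugeHam V U
    set η := covShift A ξ
    linear_combination e - H.dp 1 η * h1 - H.dp 2 η * h2
      + ((H.dx 0).eval η + B η.1 1 * -H.dp 2 η + B η.1 2 * H.dp 1 η) * p0
      + ((H.dx 1).eval η + B η.1 0 * H.dp 2 η - B η.1 2 * η.2 0) * p1
      + ((H.dx 2).eval η - B η.1 0 * H.dp 1 η + B η.1 1 * η.2 0) * p2
  refine hi (Fintype.linearIndependent_iff.1 hξ g (sum_fderiv_eq_zero hA ?_ ?_) i)
  · intro k
    fin_cases k
    exacts [p0, p1, p2]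
  · intro k
    fin_cases k
    exacts [h0, h1, h2]

end Quad

lemma noIndependentQuadratic_five {bφ bZ : ℝ} {A : Vec → Vec} (hA : ContDiff ℝ ∞ A)
    (hB : ∀ x, curl A x = famB bφ bZ x) (hne : bφ ≠ 0 ∨ bφ = 0 ∧ bZ ≠ 0) (a b w₁ w₂ w₃ : ℝ) :
    NoIndependentQuadratic 5 A (famW a b bφ bZ w₁ w₂ w₃) := by
  intro F hF
  have h' : ∀ i, ∃ q : Quad, F i = q.fn (gauge bφ A) ∧ q.dx 2 = 0 := fun i => by
    obtain ⟨Q, hQ, hL⟩ := (hF i).1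
    obtain ⟨q, hq, -, hz, -⟩ := exists_axialSystem hA hB hne hQ hL (hF i).2
    exact ⟨q, hq, hz⟩
  choose q hq hz using h'
  rw [funext hq]
  refine Quad.functionallyDependent_of_dz (contDiff_gauge bφ hA) hz
    (B := field 0 0 (C bZ)) (V := potV bφ) (U := potU a b bφ bZ w₁ w₂ w₃) fun i => ?_
  refine (Quad.bracket_eq_zero (contDiff_gauge bφ hA) (curl_gauge hA hB)).1 fun ξ => ?_
  rw [← gaugeHam_fn, ← hq]
  exact (hF i).2 ξ

theorem quadraticallyMinimallySuperintegrable_of_bZ_eq_zero {bφ : ℝ} {A : Vec → Vec}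
    (hA : ContDiff ℝ ∞ A) (hB : ∀ x, curl A x = famB bφ 0 x) (hφ : bφ ≠ 0) (a b w₁ w₂ w₃ : ℝ) :
    QuadraticallyMinimallySuperintegrable A (famW a b bφ 0 w₁ w₂ w₃) := by
  refine ⟨⟨_, _, _, isQuadraticIntegral_intA hA hB a b w₁ w₂ w₃,
    isQuadraticIntegral_intP hA hB a b w₁ w₂ w₃, isQuadraticIntegral_intB hA hB a b w₁ w₂ w₃,
    fun ξ => (poissonAlgebra hA hB a b w₁ w₂ w₃ 0 ξ).2.2.2.1, ?_⟩,
    noIndependentQuadratic_five hA hB (Or.inl hφ) a b w₁ w₂ w₃⟩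
  -- The commuting pair must be the first two integrals, here `X^a` and `P`, so `X^b` is moved to
  -- the end.
  convert (functionallyIndependent_ABP hA hφ a b w₁ w₂ w₃).comp_equiv (Equiv.swap 2 3) using 1
  funext i
  fin_cases i <;> rfl

theorem quadraticallyMinimallySuperintegrable_of_bφ_eq_zero {bZ : ℝ} {A : Vec → Vec}
    (hA : ContDiff ℝ ∞ A) (hB : ∀ x, curl A x = famB 0 bZ x) (hZ : bZ ≠ 0) (a b w₁ w₂ w₃ : ℝ) :
    QuadraticallyMinimallySuperintegrable A (famW a b 0 bZ w₁ w₂ w₃) := by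
  refine ⟨⟨_, _, _, isQuadraticIntegral_gauge hA hB ?_ (fun η => bracket_momQuad a b 0 w₁ w₂ w₃ η bZ),
    isQuadraticIntegral_gauge hA hB ?_ (bracket_transQuad₁ a b bZ w₁ w₂ w₃),
    isQuadraticIntegral_gauge hA hB ?_ (bracket_transQuad₂ a b bZ w₁ w₂ w₃),
    inInvolution_gauge hA hB (bracket_momQuad_transQuad₁ bZ),
    functionallyIndependent_homogeneous hA hZ a b w₁ w₂ w₃⟩,
    noIndependentQuadratic_five hA hB (Or.inr ⟨rfl, hZ⟩) a b w₁ w₂ w₃⟩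
  · rw [lead_momQuad]; exact isQuadraticElement_zero
  · rw [lead_transQuad₁]; exact isQuadraticElement_zero
  · rw [lead_transQuad₂]; exact isQuadraticElement_zero

/-! ### Classification of the quadratic integrals -/

/-- The rotation integral in a homogeneous magnetic field. -/
def rotQuad (bZ : ℝ) : Quad := ⟨0, 0, 0, 0, 0, 0, -X 1, X 0, 0, -(C (bZ / 2) * rho)⟩

/-- The angular derivative of the effective potential, up to the factor `b_φ`. -/
def angularForce (a b bZ w₁ w₂ : ℝ) : Sm := C bZ * quadIm a b + C w₂ * X 0 - C w₁ * X 1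

lemma regular_angularForce {a b bZ w₁ w₂ : ℝ} (hZ : bZ ≠ 0)
    (h : ¬ (a = 0 ∧ b = 0 ∧ w₁ = 0 ∧ w₂ = 0)) : (angularForce a b bZ w₁ w₂).Regular := by
  have hp : ContDiff ℝ ω (angularForce a b bZ w₁ w₂ : Vec → ℝ) :=
    show ContDiff ℝ ω (fun x : Vec => bZ * (2 * a * (x 0 * x 1) - b * (x 0 ^ 2 - x 1 ^ 2))
      + w₂ * x 0 - w₁ * x 1) by fun_prop
  by_contra hr
  have hz : ∀ s t : ℝ, bZ * (2 * a * (s * t) - b * (s ^ 2 - t ^ 2)) + w₂ * s - w₁ * t = 0 := by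
    intro s t
    by_contra hx
    exact hr (regular_of_analytic hp (x₀ := ![s, t, 0]) (by
      simpa [angularForce, quadIm] using hx))
  have e1 := hz 1 0
  have e2 := hz (-1) 0
  have e3 := hz 0 1
  have e4 := hz 1 1
  have hb : b = 0 := (mul_eq_zero.1 (show bZ * b = 0 by linarith)).resolve_left hZ
  subst hb
  have ha : a = 0 := (mul_eq_zero.1 (show bZ * a = 0 by linarith)).resolve_left hZ
  exact h ⟨ha, rfl, by linarith, by linarith⟩

lemma d0_potU (a b bφ bZ w₁ w₂ w₃ : ℝ) : d 0 (potU a b bφ bZ w₁ w₂ w₃) =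
    C bφ * (2 * C w₃ * X 0 - C bZ * (C a * X 0 + C b * X 1) + C w₁) := by
  simp [potU, rho]
  linear_combination -(C bφ * C bZ * X 0) * two_mul_C_half a

lemma d1_potU (a b bφ bZ w₁ w₂ w₃ : ℝ) : d 1 (potU a b bφ bZ w₁ w₂ w₃) =
    C bφ * (2 * C w₃ * X 1 - C bZ * (C b * X 0 - C a * X 1) + C w₂) := by
  simp [potU, rho]
  linear_combination C bφ * C bZ * X 1 * two_mul_C_half a

namespace AxialSystem

variable {a b bφ bZ w₁ w₂ w₃ : ℝ} {q : Quad}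

/-- The solution is `κ` times the squared rotation integral plus `k X₁`, `r` times the rotation
integral, and `H`, `c²`, `c` terms, up to the scalar coefficient. The planar Killing tensor and
vector constants are cut down by the radial force. The momentum-free equation `w` then says that the
planar linear term does no work against the effective potential, which is the last condition, `b_φ *
angularForce` being its angular derivative. -/
lemma exists_form (hφ : bφ ≠ 0) (hZ : bZ ≠ 0)
    (H : AxialSystem (potV bφ) (potU a b bφ bZ w₁ w₂ w₃) bZ q) (hz : q.dx 2 = 0) :
    ∃ κ k r c f h : ℝ, q.k11 = C κ * X 1 ^ 2 + C (k * a + c) ∧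
      q.k12 = -(2 * C κ * X 0 * X 1) + C (k * b) ∧ q.k22 = C κ * X 0 ^ 2 + C c ∧
      q.u1 = -(C k * X 1) ∧ q.u2 = C k * X 0 ∧ q.f = C f ∧
      q.t1 = C κ * (C bZ * rho * X 1) + C k * (pairQuad a b bφ bZ w₁ w₂ w₃).t1 - C r * X 1 ∧
      q.t2 = -(C κ * (C bZ * rho * X 0)) + C k * (pairQuad a b bφ bZ w₁ w₂ w₃).t2 + C r * X 0 ∧
      q.h = C k * (pairQuad a b bφ bZ w₁ w₂ w₃).h + 2 * C c * potV bφ + C h ∧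
      (C r - C κ * (C bZ * rho)) * angularForce a b bZ w₁ w₂ = 0 := by
  obtain ⟨k0, k1, k2, k3, u00, u01, u11, f0, f1, f2, t00, t01, t11, h0, h1, h2, n0, n1, n2, w⟩ := H
  simp only [Quad.eq_zero_iff, Quad.dx] at hz
  obtain ⟨z11, z12, z22, zu1, zu2, zf, zt1, zt2, zh, zn⟩ := hz
  have hcφ : ∀ {f : Sm}, C bφ * f = 0 → f = 0 := C_mul_cancel hφ
  have hcZ : ∀ {f : Sm}, C bZ * f = 0 → f = 0 := C_mul_cancel hZ
  simp only [z11, z12, z22, zu1, zu2, zf, zt1, zt2, zh, zn, mul_zero, add_zero, d0_potV,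
    d1_potV] at u00 u01 u11 f0 f1 t00 t01 t11 h0 h1 h2 n0 n1 n2 w
  obtain ⟨f, hf⟩ := exists_C_of_d f0 f1 zf
  obtain ⟨k, hu1, hu2⟩ := exists_rotation u00 u11 (by linear_combination u01) zu1 zu2
    (hcφ (by linear_combination h2))
  -- the leading coefficients
  have l0 := congrArg (d 0) k0
  have l1 := congrArg (d 1) k0
  have m0 := congrArg (d 0) k1
  have m1 := congrArg (d 1) k2
  have m2 := congrArg (d 0) k3
  have c00 : d 0 (d 0 q.k12) = 0 := by
    simp at m0 l1
    linear_combination m0 - l1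
  have c11 : d 1 (d 1 q.k12) = 0 := by
    simp at m1 m2
    linear_combination m1 - m2
  -- Integrability of `h` in the plane; it removes the linear terms from the Killing tensor.
  have hc : X 0 * d 0 q.k12 = X 1 * d 1 q.k12 := by
    have e1 := congrArg (d 1) h0
    have e0 := congrArg (d 0) h1
    simp [hu1, hu2] at e0 e1
    refine sub_eq_zero.1 (C_mul_cancel (a := 3 * bφ) (by simpa using hφ) ?_)
    rw [map_mul, map_ofNat]
    linear_combination e0 - e1 + 2 * C bφ * X 0 * k1 - 2 * C bφ * X 1 * k2
  have e0 := congrArg (d 0) hc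
  have e1 := congrArg (d 1) hc
  simp [c00, c11] at e0 e1
  obtain ⟨κ', hκ⟩ := exists_C_of_d (f := d 0 (d 1 q.k12))
    (by have := congrArg (d 1) c00; simpa using this)
    (by have := congrArg (d 0) c11; simpa using this) (by simp [z12])
  obtain ⟨κ, rfl⟩ : ∃ κ, κ' = -(2 * κ) := ⟨-(κ' / 2), by ring⟩
  rw [hκ] at e0 e1
  simp only [map_neg, map_mul, map_ofNat] at e0 e1
  obtain ⟨kb, h12⟩ := eq_of_d_eq (f := q.k12) (g := -(2 * C κ * X 0 * X 1))
    (by simp; linear_combination e0) (by simp; linear_combination -e1) (by simp [z12])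
  obtain ⟨c, h22⟩ := eq_of_d_eq (f := q.k22) (g := C κ * X 0 ^ 2)
    (by simp; linear_combination k2 + e1) (by simp [k3]) (by simp [z22])
  obtain ⟨c', h11⟩ := eq_of_d_eq (f := q.k11) (g := C κ * X 1 ^ 2)
    (by simp [k0]) (by simp; linear_combination k1 - e0) (by simp [z11])
  obtain ⟨ka, rfl⟩ : ∃ ka, c' = ka + c := ⟨c' - c, by ring⟩
  rw [map_add] at h11
  -- the terms of first degree
  obtain ⟨r1, r2, r3, ht1, ht2⟩ := exists_killing
    (r1 := q.t1 - (C κ * (C bZ * rho * X 1) - C bZ * C kb * X 0 + C bZ * C ka * X 1))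
    (r2 := q.t2 - (-(C κ * (C bZ * rho * X 0)) + C bZ * C kb * X 1 + C bZ * C ka * X 0))
    (by simp [rho]; linear_combination t00 - C bZ * h12)
    (by simp [rho]; linear_combination t11 + C bZ * h12)
    (by simp [rho]; linear_combination t01 + 2 * C bZ * h11 - 2 * C bZ * h22)
    (by simp [rho, zt1]) (by simp [rho, zt2])
  -- Equation `n2` divided by `b_φ`: an identity of polynomials in `x, y`. Its Taylor coefficients
  -- at the origin express the remaining constants by `k`, namely `ka = k a`, `kb = k b`, `r1 = k
  -- w₂`, `r2 = -k w₁`.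
  have hn : C k * angularForce a b bZ w₁ w₂ = C bZ * quadIm ka kb + C r1 * X 0 + C r2 * X 1 := by
    refine sub_eq_zero.1 (hcφ ?_)
    simp [hu1, hu2, potU, rho] at n2
    simp [angularForce, quadIm]
    have v2 := two_mul_C_half a
    linear_combination -n2 + C bφ * X 0 * ht1 + C bφ * X 1 * ht2
      - C k * C bφ * C bZ * 2 * X 0 * X 1 * v2
  have n00 := congrArg (d 0) (congrArg (d 0) hn)
  have n01 := congrArg (d 0) (congrArg (d 1) hn)
  have hn0 := congrArg (fun f : Sm => f 0) (congrArg (d 0) hn)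
  have hn1 := congrArg (fun f : Sm => f 0) (congrArg (d 1) hn)
  have n00 := congrArg (fun f : Sm => f 0) n00
  have n01 := congrArg (fun f : Sm => f 0) n01
  simp [angularForce, quadIm] at n00 n01 hn0 hn1
  have hka : ka = k * a := mul_left_cancel₀ hZ (by linarith)
  have hkb : kb = k * b := mul_left_cancel₀ hZ (by linarith)
  have hr1 : r1 = k * w₂ := by linarith
  have hr2 : r2 = -(k * w₁) := by linarith
  subst hka hkb hr1 hr2
  simp only [map_mul, map_neg] at h11 h12 ht1 ht2
  have v1 := two_mul_C_half bZ
  have v2 := two_mul_C_half a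
  obtain ⟨h, hh⟩ := eq_of_d_eq (f := q.h)
    (g := C k * (pairQuad a b bφ bZ w₁ w₂ w₃).h + 2 * C c * potV bφ)
    (by simp [pairQuad, rho, d0_potV]
        linear_combination h0 - 2 * C bφ * X 0 * h11 - C bφ * X 1 * h12 - C bZ * hu2
          + C k * X 0 * v1)
    (by simp [pairQuad, rho, d1_potV]
        linear_combination h1 - 2 * C bφ * X 1 * h22 - C bφ * X 0 * h12 + C bZ * hu1
          + C k * X 1 * v1)
    (by simp [pairQuad, rho, d2_potV, zh])
  have ht1' : q.t1 = C κ * (C bZ * rho * X 1) + C k * (pairQuad a b bφ bZ w₁ w₂ w₃).t1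
      - C (r3 + 2 * k * w₃) * X 1 := by
    simp [pairQuad, map_ofNat]
    linear_combination ht1
  have ht2' : q.t2 = -(C κ * (C bZ * rho * X 0)) + C k * (pairQuad a b bφ bZ w₁ w₂ w₃).t2
      + C (r3 + 2 * k * w₃) * X 0 := by
    simp [pairQuad, map_ofNat]
    linear_combination ht2
  refine ⟨κ, k, r3 + 2 * k * w₃, c, f, h, ?_, ?_, h22, hu1, hu2, hf, ht1', ht2', hh, ?_⟩
  · rw [h11, map_add, map_mul]
  · rw [h12, map_mul]
  · rw [ht1', ht2', d0_potU, d1_potU] at w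
    simp [pairQuad, rho, map_ofNat] at w
    apply hcφ
    simp [angularForce, quadIm, rho, map_ofNat]
    linear_combination -w

end AxialSystem

lemma bracket_rotSqQuad_axial (bφ bZ w₃ : ℝ) (η : Phase) : Quad.bracket (field 0 0 (C bZ))
    (rotSqQuad bZ) (gaugeHam (potV bφ) (potU 0 0 bφ bZ 0 0 w₃)) η = 0 := by
  simp [Quad.bracket, Quad.dx, Quad.dp, Quad.eval, rotSqQuad, gaugeHam, potV, potU, field, rho]
  ring

lemma bracket_rotQuad (bφ bZ w₃ : ℝ) (η : Phase) : Quad.bracket (field 0 0 (C bZ))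
    (rotQuad bZ) (gaugeHam (potV bφ) (potU 0 0 bφ bZ 0 0 w₃)) η = 0 := by
  simp [Quad.bracket, Quad.dx, Quad.dp, Quad.eval, rotQuad, gaugeHam, potV, potU, field, rho]
  ring

namespace AxialSystem

variable {a b bφ bZ w₁ w₂ w₃ : ℝ} {q : Quad}

/-- For generic parameters the quadratic integrals are combinations of the pair, the Hamiltonian and
the conserved momentum. -/
lemma exists_form_generic (hφ : bφ ≠ 0) (hZ : bZ ≠ 0)
    (H : AxialSystem (potV bφ) (potU a b bφ bZ w₁ w₂ w₃) bZ q) (hz : q.dx 2 = 0)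
    (hne : ¬ (a = 0 ∧ b = 0 ∧ w₁ = 0 ∧ w₂ = 0)) :
    ∃ k c f h n : ℝ, q = ⟨C (k * a + c), C (k * b), C c, -(C k * X 1), C k * X 0, C f,
      C k * (pairQuad a b bφ bZ w₁ w₂ w₃).t1, C k * (pairQuad a b bφ bZ w₁ w₂ w₃).t2,
      C k * (pairQuad a b bφ bZ w₁ w₂ w₃).h + 2 * C c * potV bφ + C h,
      C k * (pairQuad a b bφ bZ w₁ w₂ w₃).n + 2 * C c * potU a b bφ bZ w₁ w₂ w₃ + C n⟩ := by
  obtain ⟨κ, k, r, c, f, h, h11, h12, h22, hu1, hu2, hf, ht1, ht2, hh, hr⟩ :=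
    H.exists_form hφ hZ hz
  -- A generic angular force can be cancelled, leaving `r = κ b_Z ρ`; the values at the origin and
  -- at `(1, 0, 0)` give `r = 0` and `κ = 0`.
  have hr0 := regular_angularForce hZ hne _ (by rw [mul_comm]; exact hr)
  have r0 : r = 0 := by
    have := congrArg (fun f : Sm => f 0) hr0
    simpa [rho] using this
  have κ0 : κ = 0 := by
    have := congrArg (fun f : Sm => f ![1, 0, 0]) hr0
    simpa [rho, r0, hZ] using this
  subst r0 κ0
  simp only [map_zero, zero_mul, zero_add, mul_zero, neg_zero, sub_zero, add_zero]
    at h11 h12 h22 ht1 ht2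
  have P := axialSystem_of_bracket (d2_potV _) (d2_potU ..)
    (bracket_pairQuad a b bφ bZ w₁ w₂ w₃)
  simp only [Quad.eq_zero_iff, Quad.dx] at hz
  have z : d 2 (pairQuad a b bφ bZ w₁ w₂ w₃).n = 0 ∧ d 2 (pairQuad a b bφ bZ w₁ w₂ w₃).t1 = 0 ∧
      d 2 (pairQuad a b bφ bZ w₁ w₂ w₃).t2 = 0 := by simp [pairQuad, rho]
  have e0 := H.n0
  have e1 := H.n1
  have p0 := P.n0
  have p1 := P.n1
  rw [hz.2.2.2.2.2.2.1, h11, h12, ht2] at e0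
  rw [hz.2.2.2.2.2.2.2.1, h12, h22, ht1] at e1
  rw [z.2.1] at p0
  rw [z.2.2] at p1
  obtain ⟨n, hn⟩ := eq_of_d_eq (f := q.n)
    (g := C k * (pairQuad a b bφ bZ w₁ w₂ w₃).n + 2 * C c * potU a b bφ bZ w₁ w₂ w₃)
    (by simp only [d_add, d_mul, d_C, d_ofNat, zero_mul, zero_add, mul_zero, add_zero]
        rw [map_add, map_mul, map_mul] at e0
        simp only [show (pairQuad a b bφ bZ w₁ w₂ w₃).k11 = C a from rfl,
          show (pairQuad a b bφ bZ w₁ w₂ w₃).k12 = C b from rfl] at p0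
        linear_combination e0 - C k * p0)
    (by simp only [d_add, d_mul, d_C, d_ofNat, zero_mul, zero_add, mul_zero, add_zero]
        rw [map_mul] at e1
        simp only [show (pairQuad a b bφ bZ w₁ w₂ w₃).k22 = 0 from rfl,
          show (pairQuad a b bφ bZ w₁ w₂ w₃).k12 = C b from rfl] at p1
        linear_combination e1 - C k * p1)
    (by simp [z.1, d2_potU, hz.2.2.2.2.2.2.2.2.2])
  exact ⟨k, c, f, h, n, Quad.ext h11 h12 h22 hu1 hu2 hf ht1 ht2 hh hn⟩

/-- In the axially symmetric case the quadratic integrals are polynomials in the rotation integral,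
the Hamiltonian and the conserved momentum. -/
lemma exists_form_axial (hφ : bφ ≠ 0) (hZ : bZ ≠ 0)
    (H : AxialSystem (potV bφ) (potU 0 0 bφ bZ 0 0 w₃) bZ q) (hz : q.dx 2 = 0) :
    ∃ κ k r c f h n : ℝ, q = ⟨C κ * X 1 ^ 2 + C c, -(2 * C κ * X 0 * X 1), C κ * X 0 ^ 2 + C c,
      -(C k * X 1), C k * X 0, C f,
      C κ * (C bZ * rho * X 1) + C k * (pairQuad 0 0 bφ bZ 0 0 w₃).t1 - C r * X 1,
      -(C κ * (C bZ * rho * X 0)) + C k * (pairQuad 0 0 bφ bZ 0 0 w₃).t2 + C r * X 0,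
      C k * (pairQuad 0 0 bφ bZ 0 0 w₃).h + 2 * C c * potV bφ + C h,
      C κ * (rotSqQuad bZ).n + C k * (pairQuad 0 0 bφ bZ 0 0 w₃).n + C r * (rotQuad bZ).n
        + 2 * C c * potU 0 0 bφ bZ 0 0 w₃ + C n⟩ := by
  obtain ⟨κ, k, r, c, f, h, h11, h12, h22, hu1, hu2, hf, ht1, ht2, hh, -⟩ :=
    H.exists_form hφ hZ hz
  simp only [map_zero, zero_add, mul_zero, add_zero] at h11 h12
  have P := axialSystem_of_bracket (d2_potV _) (d2_potU ..) (bracket_pairQuad 0 0 bφ bZ 0 0 w₃)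
  have R := axialSystem_of_bracket (d2_potV _) (d2_potU ..) (bracket_rotSqQuad_axial bφ bZ w₃)
  have S := axialSystem_of_bracket (d2_potV _) (d2_potU ..) (bracket_rotQuad bφ bZ w₃)
  simp only [Quad.eq_zero_iff, Quad.dx] at hz
  have z : d 2 (pairQuad 0 0 bφ bZ 0 0 w₃).n = 0 ∧ d 2 (pairQuad 0 0 bφ bZ 0 0 w₃).t1 = 0 ∧
      d 2 (pairQuad 0 0 bφ bZ 0 0 w₃).t2 = 0 ∧ d 2 (rotSqQuad bZ).n = 0 ∧
      d 2 (rotSqQuad bZ).t1 = 0 ∧ d 2 (rotSqQuad bZ).t2 = 0 ∧ d 2 (rotQuad bZ).n = 0 ∧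
      d 2 (rotQuad bZ).t1 = 0 ∧ d 2 (rotQuad bZ).t2 = 0 := by
    simp [pairQuad, rotSqQuad, rotQuad, rho]
  obtain ⟨zpn, zp1, zp2, zrn, zr1, zr2, zsn, zs1, zs2⟩ := z
  have e0 := H.n0
  have e1 := H.n1
  have p0 := P.n0
  have p1 := P.n1
  have r0 := R.n0
  have r1 := R.n1
  have s0 := S.n0
  have s1 := S.n1
  rw [hz.2.2.2.2.2.2.1, h11, h12, ht2] at e0
  rw [hz.2.2.2.2.2.2.2.1, h12, h22, ht1] at e1
  rw [zp1] at p0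
  rw [zp2] at p1
  rw [zr1] at r0
  rw [zr2] at r1
  rw [zs1] at s0
  rw [zs2] at s1
  have k1 : (pairQuad 0 0 bφ bZ 0 0 w₃).k11 = 0 := map_zero C
  have k2 : (pairQuad 0 0 bφ bZ 0 0 w₃).k12 = 0 := map_zero C
  have k3 : (pairQuad 0 0 bφ bZ 0 0 w₃).k22 = 0 := rfl
  rw [k1, k2] at p0
  rw [k2, k3] at p1
  have hC : ∀ i c f, d i (C c * f) = C c * d i f := by simp
  have h2C : ∀ i c f, d i (2 * C c * f) = 2 * C c * d i f := by simp
  simp only [rotSqQuad, rotQuad, d_neg, hC] at r0 r1 s0 s1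
  obtain ⟨n, hn⟩ := eq_of_d_eq (f := q.n)
    (g := C κ * (rotSqQuad bZ).n + C k * (pairQuad 0 0 bφ bZ 0 0 w₃).n + C r * (rotQuad bZ).n
        + 2 * C c * potU 0 0 bφ bZ 0 0 w₃)
    (by simp only [d_add, d_neg, hC, h2C, rotSqQuad, rotQuad]
        linear_combination e0 - C k * p0 - C κ * r0 - C r * s0)
    (by simp only [d_add, d_neg, hC, h2C, rotSqQuad, rotQuad]
        linear_combination e1 - C k * p1 - C κ * r1 - C r * s1)
    (by simp [zpn, zrn, zsn, d2_potU, hz.2.2.2.2.2.2.2.2.2])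
  exact ⟨κ, k, r, c, f, h, n, Quad.ext h11 h12 h22 hu1 hu2 hf ht1 ht2 hh hn⟩

end AxialSystem

lemma noIndependentQuadratic_four {bφ bZ : ℝ} {A : Vec → Vec} (hA : ContDiff ℝ ∞ A)
    (hB : ∀ x, curl A x = famB bφ bZ x) (hφ : bφ ≠ 0) (hZ : bZ ≠ 0) (a b w₁ w₂ w₃ : ℝ) :
    NoIndependentQuadratic 4 A (famW a b bφ bZ w₁ w₂ w₃) := by
  intro F hF
  have h' : ∀ i, ∃ q : Quad, F i = q.fn (gauge bφ A) ∧ q.dx 2 = 0 ∧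
      AxialSystem (potV bφ) (potU a b bφ bZ w₁ w₂ w₃) bZ q := fun i => by
    obtain ⟨Q, hQ, hL⟩ := (hF i).1
    obtain ⟨q, hq, -, hz, H⟩ := exists_axialSystem hA hB (Or.inl hφ) hQ hL (hF i).2
    exact ⟨q, hq, hz, H⟩
  choose q hq hz H using h'
  rw [funext hq]
  by_cases hne : a = 0 ∧ b = 0 ∧ w₁ = 0 ∧ w₂ = 0
  · obtain ⟨rfl, rfl, rfl, rfl⟩ := hne
    refine Quad.functionallyDependent_of_span (m := 3) (by norm_num) (contDiff_gauge bφ hA)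
      (p := ![momQuad, gaugeHam (potV bφ) (potU 0 0 bφ bZ 0 0 w₃), rotQuad bZ]) fun η i => ?_
    obtain ⟨κ, k, r, c, f, h, n, e⟩ := (H i).exists_form_axial hφ hZ (hz i)
    -- With `L` the rotation integral, `X₁` is `(c - 2 w₃) L` in this case, so the integral is a
    -- polynomial in the third momentum, `H` and `L`; the entries are its partial derivatives with
    -- respect to these three.
    refine ⟨![k * (rotQuad bZ).eval η + 2 * (f - c) * η.2 2 + h, 2 * c,
      2 * κ * (rotQuad bZ).eval η + k * (η.2 2 - 2 * w₃) + r], fun j => ?_, fun j => ?_⟩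
    · rw [e]
      fin_cases j <;> simp [Fin.sum_univ_three, Quad.dp, Quad.eval, gaugeHam, momQuad, rotQuad,
        pairQuad, rho] <;> ring
    · rw [e]
      fin_cases j <;> simp [Fin.sum_univ_three, Quad.dx, Quad.eval, gaugeHam, momQuad, rotQuad,
        pairQuad, rotSqQuad, rho] <;> ring
  · refine Quad.functionallyDependent_of_span (m := 3) (by norm_num) (contDiff_gauge bφ hA)
      (p := ![momQuad, gaugeHam (potV bφ) (potU a b bφ bZ w₁ w₂ w₃),
        pairQuad a b bφ bZ w₁ w₂ w₃]) fun η i => ?_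
    obtain ⟨k, c, f, h, n, e⟩ := (H i).exists_form_generic hφ hZ (hz i) hne
    refine ⟨![2 * (f - c) * η.2 2 + h, 2 * c, k], fun j => ?_, fun j => ?_⟩
    · rw [e]
      fin_cases j <;> simp [Fin.sum_univ_three, Quad.dp, gaugeHam, momQuad, pairQuad] <;> ring
    · rw [e]
      fin_cases j <;> simp [Fin.sum_univ_three, Quad.dx, Quad.eval, gaugeHam, momQuad, pairQuad] <;>
        ring

/-- The leading terms of the quadratic integrals for generic parameters. -/
lemma exists_lead_eq {bφ bZ : ℝ} {A : Vec → Vec} (hA : ContDiff ℝ ∞ A)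
    (hB : ∀ x, curl A x = famB bφ bZ x) (hφ : bφ ≠ 0) (hZ : bZ ≠ 0) {a b w₁ w₂ w₃ : ℝ}
    (hne : ¬ (a = 0 ∧ b = 0 ∧ w₁ = 0 ∧ w₂ = 0))
    {Q F : Phase → ℝ} (hQ : IsQuadraticElement Q) (hL : HasLeadingTerm A Q F)
    (hI : IsIntegral A (famW a b bφ bZ w₁ w₂ w₃) F) :
    ∃ k c e : ℝ, Q = c • freeHam + k • lead₁ a b + e • lead₂ := by
  obtain ⟨q, -, rfl, hz, H⟩ := exists_axialSystem hA hB (Or.inl hφ) hQ hL hI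
  obtain ⟨k, c, f, h, n, e⟩ := H.exists_form_generic hφ hZ hz hne
  refine ⟨k, 2 * c, f - c, funext fun ξ => ?_⟩
  rw [e]
  simp [Quad.lead, freeHam, lead₁, lead₂, mom, ang, cross_apply, Fin.sum_univ_three]
  ring

/-! ### Exclusion of classes -/

/-- Orthonormal frames. -/
structure Frame (r s n : Vec) : Prop where
  rr : r 0 ^ 2 + r 1 ^ 2 + r 2 ^ 2 = 1
  ss : s 0 ^ 2 + s 1 ^ 2 + s 2 ^ 2 = 1
  nn : n 0 ^ 2 + n 1 ^ 2 + n 2 ^ 2 = 1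
  rs : r 0 * s 0 + r 1 * s 1 + r 2 * s 2 = 0
  rn : r 0 * n 0 + r 1 * n 1 + r 2 * n 2 = 0
  sn : s 0 * n 0 + s 1 * n 1 + s 2 * n 2 = 0

/-- The elements of `span {p² / 2, lead₁, lead₂}` in a Euclidean frame `r, s, n` with origin determined by
`t`. -/
def frameForm (a b : ℝ) (r s n t : Vec) (c k f : ℝ) (ξ : Phase) : ℝ :=
  c * freeHam ξ + k * (((r ⬝ᵥ ξ.1 + t 0) * (s ⬝ᵥ ξ.2) - (s ⬝ᵥ ξ.1 + t 1) * (r ⬝ᵥ ξ.2)) * (n ⬝ᵥ ξ.2)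
    + a * (r ⬝ᵥ ξ.2) ^ 2 + b * (r ⬝ᵥ ξ.2) * (s ⬝ᵥ ξ.2)) + f * (n ⬝ᵥ ξ.2) ^ 2

lemma freeHam_euclid (R : Matrix.orthogonalGroup (Fin 3) ℝ) (t : Vec) (ξ : Phase) :
    freeHam (euclid R t ξ) = freeHam ξ := by
  have h := (Matrix.mem_orthogonalGroup_iff' _ _).1 R.2
  have e : ∀ v : Vec, ∑ i, v i ^ 2 = v ⬝ᵥ v := fun v => by simp [dotProduct, sq]
  simp only [freeHam, mom, e, euclid]
  rw [Matrix.dotProduct_mulVec, Matrix.vecMul_mulVec, h, Matrix.vecMul_one]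

lemma frame_of_orthogonal (R : Matrix.orthogonalGroup (Fin 3) ℝ) :
    Frame ((R : Matrix (Fin 3) (Fin 3) ℝ) 0) ((R : Matrix (Fin 3) (Fin 3) ℝ) 1)
      ((R : Matrix (Fin 3) (Fin 3) ℝ) 2) := by
  have h := (Matrix.mem_orthogonalGroup_iff _ _).1 R.2
  have e : ∀ i j, _ := fun i j => congrFun (congrFun h i) j
  simp only [Matrix.mul_apply, Matrix.transpose_apply, Fin.sum_univ_three] at e
  exact
    { rr := by simpa [sq] using e 0 0
      ss := by simpa [sq] using e 1 1
      nn := by simpa [sq] using e 2 2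
      rs := by simpa using e 0 1
      rn := by simpa using e 0 2
      sn := by simpa using e 1 2 }

lemma comp_euclid (a b c k f : ℝ) (R : Matrix.orthogonalGroup (Fin 3) ℝ) (t : Vec) :
    (c • freeHam + k • lead₁ a b + f • lead₂) ∘ euclid R t =
      frameForm a b ((R : Matrix (Fin 3) (Fin 3) ℝ) 0) ((R : Matrix (Fin 3) (Fin 3) ℝ) 1)
        ((R : Matrix (Fin 3) (Fin 3) ℝ) 2) t c k f := by
  funext ξ
  simp only [Function.comp_apply, Pi.add_apply, Pi.smul_apply, smul_eq_mul, freeHam_euclid,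
    frameForm]
  simp [lead₁, lead₂, mom, ang, euclid, cross_apply, Matrix.mulVec, Matrix.vec3_dotProduct]
  exact Or.inl (Or.inl (by ring))

/-- The normal forms of the classes of a pair with leading terms in
`span {p² / 2, lead₁, lead₂}`. -/
lemma exists_frameForm {κ : PairClass} {a b : ℝ} {Q₁ Q₂ : Phase → ℝ}
    (h₁ : ∃ k c e : ℝ, Q₁ = c • freeHam + k • lead₁ a b + e • lead₂)
    (h₂ : ∃ k c e : ℝ, Q₂ = c • freeHam + k • lead₁ a b + e • lead₂) (h : PairInClass κ Q₁ Q₂) :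
    ∃ (r s n t : Vec) (N₁ N₂ : Phase → ℝ), Frame r s n ∧ IsNormalForm κ N₁ N₂ ∧
      (∃ c k f, N₁ = frameForm a b r s n t c k f) ∧ ∃ c k f, N₂ = frameForm a b r s n t c k f := by
  obtain ⟨R, t, N₁, N₂, hN, hs⟩ := h
  obtain ⟨k₁, c₁, f₁, rfl⟩ := h₁
  obtain ⟨k₂, c₂, f₂, rfl⟩ := h₂
  rw [comp_euclid, comp_euclid] at hs
  refine ⟨_, _, _, t, N₁, N₂, frame_of_orthogonal R, hN, ?_⟩
  have key : ∀ N ∈ Submodule.span ℝ {freeHam, N₁, N₂}, ∃ c k f, N =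
      frameForm a b ((R : Matrix (Fin 3) (Fin 3) ℝ) 0) ((R : Matrix (Fin 3) (Fin 3) ℝ) 1)
        ((R : Matrix (Fin 3) (Fin 3) ℝ) 2) t c k f := by
    intro N hN
    rw [← hs, Submodule.mem_span_triple] at hN
    obtain ⟨x, y, z, rfl⟩ := hN
    refine ⟨x + y * c₁ + z * c₂, y * k₁ + z * k₂, y * f₁ + z * f₂, funext fun ξ => ?_⟩
    simp only [Pi.add_apply, Pi.smul_apply, smul_eq_mul, frameForm]
    ring
  exact ⟨key _ (Submodule.subset_span (by simp)), key _ (Submodule.subset_span (by simp))⟩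

section

variable {a b : ℝ} {r s n t : Vec} {c k f : ℝ}

/-- `lead₁` contains a single angular momentum factor. This second difference in the position
detects the squares of angular momenta in the first normal forms of classes (a) to (g). -/
lemma frameForm_affine (x p : Vec) : frameForm a b r s n t c k f (2 • x, p)
    - 2 * frameForm a b r s n t c k f (x, p) + frameForm a b r s n t c k f (0, p) = 0 := by
  simp [frameForm, freeHam, mom, two_smul]
  ring

/-- The part of a normal form that is linear in the position has rank one. -/
lemma frameForm_rank_one (hF : Frame r s n) {d₀ d₁ d₂ om : ℝ} (h : ∀ ξ : Phase,
    frameForm a b r s n t c k f ξ - frameForm a b r s n t c k f (0, ξ.2) =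
      d₀ * (ang 0 ξ * mom 0 ξ) + d₁ * (ang 1 ξ * mom 1 ξ) + d₂ * (ang 2 ξ * mom 2 ξ)
        + om * (ang 0 ξ * mom 2 ξ - ang 2 ξ * mom 0 ξ)) :
    om = 0 ∧ ∃ A B C : ℝ, A * B = 0 ∧ B * C = 0 ∧ A * C = 0 ∧ A - C = d₀ - d₂ ∧ B - A = d₁ - d₀ ∧
      (A = 0 → B = 0 → C = 0 → k = 0) := by
  obtain ⟨m, hm⟩ : ∃ m : Vec, m = crossProduct r s := ⟨_, rfl⟩
  have m0 : m 0 = r 1 * s 2 - r 2 * s 1 := by rw [hm, cross_apply]; simp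
  have m1 : m 1 = r 2 * s 0 - r 0 * s 2 := by rw [hm, cross_apply]; simp
  have m2 : m 2 = r 0 * s 1 - r 1 * s 0 := by rw [hm, cross_apply]; simp
  -- In the frame, the part linear in the position is `k (m·l)(n·p)` with `m = r × s`, while on the
  -- other side stands a matrix with diagonal `d₀, d₁, d₂` and an antisymmetric entry `om`, both
  -- determined only up to multiples of `l·p = 0`.
  have g : ∀ x p : Vec, k * ((m 0 * (x 1 * p 2 - x 2 * p 1) + m 1 * (x 2 * p 0 - x 0 * p 2)
      + m 2 * (x 0 * p 1 - x 1 * p 0)) * (n 0 * p 0 + n 1 * p 1 + n 2 * p 2)) =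
      d₀ * ((x 1 * p 2 - x 2 * p 1) * p 0) + d₁ * ((x 2 * p 0 - x 0 * p 2) * p 1)
        + d₂ * ((x 0 * p 1 - x 1 * p 0) * p 2)
        + om * ((x 1 * p 2 - x 2 * p 1) * p 2 - (x 0 * p 1 - x 1 * p 0) * p 0) := by
    intro x p
    have := h (x, p)
    simp [frameForm, freeHam, ang, mom, cross_apply, Matrix.vec3_dotProduct] at this
    rw [m0, m1, m2]
    linear_combination this
  have a1 := g ![1, 0, 0] ![0, 1, 0]
  have a2 := g ![1, 0, 0] ![0, 0, 1]
  have a3 := g ![1, 0, 0] ![1, 1, 0]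
  have a4 := g ![1, 0, 0] ![1, 0, 1]
  have a5 := g ![1, 0, 0] ![0, 1, 1]
  have b1 := g ![0, 1, 0] ![0, 0, 1]
  have b2 := g ![0, 1, 0] ![1, 0, 1]
  have b3 := g ![0, 1, 0] ![0, 1, 1]
  simp only [Matrix.cons_val_zero, Matrix.cons_val_one, Matrix.cons_val] at a1 a2 a3 a4 a5 b1 b2 b3
  have k21 : k * (m 2 * n 1) = 0 := by linear_combination a1
  have k12 : k * (m 1 * n 2) = 0 := by linear_combination -a2
  have k20 : k * (m 2 * n 0) = -om := by linear_combination a3 - k21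
  have k10 : k * (m 1 * n 0) = 0 := by linear_combination -a4 - k12
  have k02 : k * (m 0 * n 2) = om := by linear_combination b1
  have k01 : k * (m 0 * n 1) = 0 := by linear_combination b3 - k02
  have kD : k * (m 2 * n 2) - k * (m 1 * n 1) = d₂ - d₁ := by linear_combination a5 - k21 + k12
  have kE : k * (m 0 * n 0) - k * (m 2 * n 2) = d₀ - d₂ := by linear_combination b2 - k02 + k20
  -- `m` is parallel to `n`, so the rank one matrix is symmetric and its antisymmetric entry `om`
  -- must vanish.
  have sym : m 0 * n 2 = m 2 * n 0 := by
    rw [m0, m2]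
    linear_combination r 1 * hF.sn - s 1 * hF.rn
  have om0 : om = 0 := by
    rw [sym, k20] at k02
    linarith
  rw [om0] at k02 k20
  refine ⟨om0, k * (m 0 * n 0), k * (m 1 * n 1), k * (m 2 * n 2), ?_, ?_, ?_, kE, ?_, ?_⟩
  · linear_combination k * (m 1 * n 0) * k01
  · linear_combination k * (m 1 * n 2) * k21
  · linear_combination k * (m 0 * n 2) * k20
  · linear_combination -kD - kE
  · intro hA hB hC
    have hm2 : m 0 ^ 2 + m 1 ^ 2 + m 2 ^ 2 = 1 := by
      rw [m0, m1, m2]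
      linear_combination (s 0 ^ 2 + s 1 ^ 2 + s 2 ^ 2) * hF.rr + hF.ss
        - (r 0 * s 0 + r 1 * s 1 + r 2 * s 2) * hF.rs
    have : k ^ 2 = 0 := by
      have e : k ^ 2 = (k * (m 0 * n 0)) ^ 2 + (k * (m 0 * n 1)) ^ 2 + (k * (m 0 * n 2)) ^ 2
          + (k * (m 1 * n 0)) ^ 2 + (k * (m 1 * n 1)) ^ 2 + (k * (m 1 * n 2)) ^ 2
          + (k * (m 2 * n 0)) ^ 2 + (k * (m 2 * n 1)) ^ 2 + (k * (m 2 * n 2)) ^ 2 := by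
        linear_combination -k ^ 2 * hF.nn - k ^ 2 * (n 0 ^ 2 + n 1 ^ 2 + n 2 ^ 2) * hm2
      rw [e, hA, hB, hC, k01, k02, k10, k12, k20, k21]
      ring
    exact pow_eq_zero_iff (two_ne_zero) |>.1 this

end

lemma eq_i_of_frameForm {κ : PairClass} {a b : ℝ} {r s n t : Vec} {N₁ N₂ : Phase → ℝ}
    (hF : Frame r s n) (hN : IsNormalForm κ N₁ N₂)
    (h₁ : ∃ c k f, N₁ = frameForm a b r s n t c k f)
    (h₂ : ∃ c k f, N₂ = frameForm a b r s n t c k f) : κ = .i := by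
  obtain ⟨c₁, k₁, f₁, e₁⟩ := h₁
  obtain ⟨c₂, k₂, f₂, e₂⟩ := h₂
  -- For this position and momentum only `l₃` is non-zero among the angular momenta, and the second
  -- difference of `l₃²` is `2`.
  have haff : N₁ (2 • ![1, 0, 0], ![0, 1, 0]) - 2 * N₁ (![1, 0, 0], ![0, 1, 0])
      + N₁ (0, ![0, 1, 0]) = 0 := by
    rw [e₁]; exact frameForm_affine _ _
  cases κ with
  | a =>
    obtain ⟨α, β, hN₁, -⟩ := hN
    rw [hN₁, hN₁, hN₁] at haff
    simp [ang, mom, cross_apply] at haff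
    linarith
  | b =>
    obtain ⟨α, β, -, -, hN₁, -⟩ := hN
    rw [hN₁, hN₁, hN₁] at haff
    simp [ang, mom, cross_apply] at haff
    linarith
  | c =>
    obtain ⟨α, β, -, -, -, hN₁, -⟩ := hN
    rw [hN₁, hN₁, hN₁] at haff
    simp [ang, mom, cross_apply] at haff
    linarith
  | d =>
    obtain ⟨α, -, hN₁, -⟩ := hN
    rw [hN₁, hN₁, hN₁] at haff
    simp [ang, cross_apply] at haff
    linarith
  | e =>
    obtain ⟨α, -, hN₁, -⟩ := hN
    rw [hN₁, hN₁, hN₁] at haff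
    simp [ang, mom, cross_apply] at haff
    linarith
  | f =>
    obtain ⟨α, β, γ, δ, -, -, hN₁, -⟩ := hN
    rw [hN₁, hN₁, hN₁] at haff
    simp [ang, mom, cross_apply] at haff
    linarith
  | g =>
    obtain ⟨α, β, hN₁, -⟩ := hN
    rw [hN₁, hN₁, hN₁] at haff
    simp [ang, mom, cross_apply] at haff
    linarith
  | h =>
    exfalso
    obtain ⟨α, β, hα, hα', hN₁, -⟩ := hN
    obtain ⟨-, A, B, C, hAB, hBC, hAC, h1, h2, -⟩ := frameForm_rank_one (a := a) (b := b) (t := t)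
      (c := c₁) (k := k₁) (f := f₁) hF (d₀ := 1) (d₁ := α) (d₂ := -(α + 1)) (om := 0) fun ξ => by
        rw [← e₁, hN₁, hN₁]
        simp [ang, mom, cross_apply]
        ring
    -- At least two of `A, B, C` vanish. The three possibilities require `α = 1`, `α = -2` or `α =
    -- -1/2`, all outside the admitted range.
    rcases mul_eq_zero.1 hAB with hA | hB
    · rcases mul_eq_zero.1 hBC with hB | hC
      · linarith
      · linarith
    · rcases mul_eq_zero.1 hAC with hA | hC
      · linarith
      · linarith
  | i => rfl
  | j =>
    exfalso
    obtain ⟨α, β, γ, om, hα, hα', -, hom, hN₁, -⟩ := hN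
    obtain ⟨h0, -⟩ := frameForm_rank_one (a := a) (b := b) (t := t)
      (c := c₁) (k := k₁) (f := f₁) hF (d₀ := 1) (d₁ := α) (d₂ := -(α + 1)) (om := om) fun ξ => by
        rw [← e₁, hN₁, hN₁]
        simp [ang, mom, cross_apply]
        ring
    rw [h0] at hom
    -- The radicand is `(1 - α)(1 + 2 α)`, positive for `-1/2 < α ≤ 0`.
    have : 0 < Real.sqrt (1 + α - 2 * α ^ 2) := Real.sqrt_pos.2 (by nlinarith)
    linarith
  | k =>
    exfalso
    obtain ⟨α, β, γ, δ, hα, hα', -, -, hN₁, hN₂⟩ := hN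
    have vanish : ∀ A B C : ℝ, A * B = 0 → A - C = (0 : ℝ) - 0 → B - A = (0 : ℝ) - 0 →
        A = 0 ∧ B = 0 ∧ C = 0 := fun A B C h h1 h2 => by
      have hB : B = A := by linarith
      have hA : A = 0 := by rw [hB] at h; exact mul_self_eq_zero.1 h
      exact ⟨hA, by linarith, by linarith⟩
    obtain ⟨-, A, B, C, hAB, -, -, h1, h2, hk⟩ := frameForm_rank_one (a := a) (b := b) (t := t)
      (c := c₁) (k := k₁) (f := f₁) hF (d₀ := 0) (d₁ := 0) (d₂ := 0) (om := 0) fun ξ => by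
        rw [← e₁, hN₁, hN₁]
        simp [mom]
    obtain ⟨hA, hB, hC⟩ := vanish A B C hAB h1 h2
    have hk₁ := hk hA hB hC
    obtain ⟨-, A, B, C, hAB, -, -, h1, h2, hk⟩ := frameForm_rank_one (a := a) (b := b) (t := t)
      (c := c₂) (k := k₂) (f := f₂) hF (d₀ := 0) (d₁ := 0) (d₂ := 0) (om := 0) fun ξ => by
        rw [← e₂, hN₂, hN₂]
        simp [mom]
    obtain ⟨hA, hB, hC⟩ := vanish A B C hAB h1 h2
    have hk₂ := hk hA hB hC
    -- With no part linear in the position, both normal forms are combinations of `p²` and `(n·p)²`.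
    -- The first forces `n` onto the first axis. The second would then treat `p₂²` and `p₃²` alike,
    -- which its coefficients `1` and `0` contradict.
    have g₁ : ∀ p : Vec, p 0 ^ 2 + α * p 1 ^ 2 = c₁ * (1 / 2 * (p 0 ^ 2 + p 1 ^ 2 + p 2 ^ 2))
        + f₁ * (n 0 * p 0 + n 1 * p 1 + n 2 * p 2) ^ 2 := fun p => by
      have h := hN₁ (0, p)
      rw [e₁, hk₁] at h
      simp [frameForm, freeHam, mom, Matrix.vec3_dotProduct, Fin.sum_univ_three] at h
      linear_combination -h
    have g₂ : ∀ p : Vec, p 1 ^ 2 + β * p 0 * p 1 + γ * p 0 * p 2 + δ * p 1 * p 2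
        = c₂ * (1 / 2 * (p 0 ^ 2 + p 1 ^ 2 + p 2 ^ 2))
        + f₂ * (n 0 * p 0 + n 1 * p 1 + n 2 * p 2) ^ 2 := fun p => by
      have h := hN₂ (0, p)
      rw [e₂, hk₂] at h
      simp [frameForm, freeHam, mom, Matrix.vec3_dotProduct, Fin.sum_univ_three] at h
      linear_combination -h
    have a0 := g₁ ![1, 0, 0]
    have a1 := g₁ ![0, 1, 0]
    have a2 := g₁ ![0, 0, 1]
    have a01 := g₁ ![1, 1, 0]
    have a02 := g₁ ![1, 0, 1]
    have a12 := g₁ ![0, 1, 1]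
    have b1 := g₂ ![0, 1, 0]
    have b2 := g₂ ![0, 0, 1]
    simp only [Matrix.cons_val_zero, Matrix.cons_val_one, Matrix.cons_val]
      at a0 a1 a2 a01 a02 a12 b1 b2
    have n01 : f₁ * (n 0 * n 1) = 0 := by linear_combination (a0 + a1 - a01) / 2
    have n02 : f₁ * (n 0 * n 2) = 0 := by linear_combination (a0 + a2 - a02) / 2
    have n12 : f₁ * (n 1 * n 2) = 0 := by linear_combination (a1 + a2 - a12) / 2
    -- If `f₁ n₁ = 0` in the first direction, the other two diagonal entries of `f₁ n nᵀ` are `α -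
    -- 1` and `-1`, with non-zero product although the off-diagonal entry is zero.
    have hne : f₁ * n 0 ≠ 0 := fun h0 => by
      have hc : c₁ = 2 := by linear_combination -2 * a0 - 2 * n 0 * h0
      rw [hc] at a1 a2
      have q1 : f₁ * n 1 ^ 2 = α - 1 := by linear_combination -a1
      have q2 : f₁ * n 2 ^ 2 = -1 := by linear_combination -a2
      have : (α - 1) * -1 = 0 := by rw [← q1, ← q2]; linear_combination f₁ * n 1 * n 2 * n12
      linarith
    have hn1 : n 1 = 0 := (mul_eq_zero.1 (by linear_combination n01)).resolve_left hne
    have hn2 : n 2 = 0 := (mul_eq_zero.1 (by linear_combination n02)).resolve_left hne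
    rw [hn1] at b1
    rw [hn2] at b2
    linarith

theorem belongsToClass_iff_i {bφ bZ : ℝ} {A : Vec → Vec} (hA : ContDiff ℝ ∞ A)
    (hB : ∀ x, curl A x = famB bφ bZ x) (hφ : bφ ≠ 0) (hZ : bZ ≠ 0) {a b w₁ w₂ w₃ : ℝ}
    (hne : ¬ (a = 0 ∧ b = 0 ∧ w₁ = 0 ∧ w₂ = 0)) (κ : PairClass) :
    BelongsToClass κ A (famW a b bφ bZ w₁ w₂ w₃) ↔ κ = .i := by
  refine ⟨?_, fun h => h ▸ belongsToClass_i hA hB a b w₁ w₂ w₃⟩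
  rintro ⟨X₁, X₂, Q₁, Q₂, hQ₁, hL₁, hI₁, hQ₂, hL₂, hI₂, -, hκ⟩
  obtain ⟨r, s, n, t, N₁, N₂, hF, hN, h₁, h₂⟩ := exists_frameForm
    (exists_lead_eq hA hB hφ hZ hne hQ₁ hL₁ hI₁) (exists_lead_eq hA hB hφ hZ hne hQ₂ hL₂ hI₂) hκ
  exact eq_i_of_frameForm hF hN h₁ h₂

end MagneticHamiltonian
end

/-! ### The theorem. -/

open MagneticHamiltonian in
theorem theorem2 :
    -- the magnetic field of the family has a smooth vector potential
    (∀ bφ bZ : ℝ, ContDiff ℝ ∞ (famA bφ bZ) ∧ ∀ x, curl (famA bφ bZ) x = famB bφ bZ x) ∧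
    -- existence: every member of the family is integrable with integrals of the required form
    (∀ (a b bφ bZ w₁ w₂ w₃ : ℝ) (A : Vec → Vec), ContDiff ℝ ∞ A →
      (∀ x, curl A x = famB bφ bZ x) →
      ∃ X₁ X₂ : Phase → ℝ, IsPair a b A (famW a b bφ bZ w₁ w₂ w₃) X₁ X₂ ∧
        FunctionallyIndependent ![ham A (famW a b bφ bZ w₁ w₂ w₃), X₁, X₂]) ∧
    -- uniqueness: any system with such integrals and a non-vanishing magnetic field is a member of
    -- the family, unless `a = b = 0` and the system is of the standard cylindrical type
    (∀ (a b : ℝ) (A : Vec → Vec) (W : Vec → ℝ), ContDiff ℝ ∞ A → ContDiff ℝ ∞ W →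
      (∃ x, curl A x ≠ 0) → (∃ X₁ X₂ : Phase → ℝ, IsPair a b A W X₁ X₂) →
      (∃ bφ bZ w₁ w₂ w₃ w₀ : ℝ, (∀ x, curl A x = famB bφ bZ x) ∧
        ∀ x, W x = famW a b bφ bZ w₁ w₂ w₃ x + w₀) ∨
      (a = 0 ∧ b = 0 ∧ HasCylindricalIntegrals A W)) ∧
    -- generic parameters: no further independent quadratic integral, class (i) and no other class
    (∀ (a b bφ bZ w₁ w₂ w₃ : ℝ) (A : Vec → Vec), ContDiff ℝ ∞ A →
      (∀ x, curl A x = famB bφ bZ x) → bφ ≠ 0 → bZ ≠ 0 →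
      NoIndependentQuadratic 4 A (famW a b bφ bZ w₁ w₂ w₃) ∧
      (¬ (a = 0 ∧ b = 0 ∧ w₁ = 0 ∧ w₂ = 0) →
        ∀ κ : PairClass, BelongsToClass κ A (famW a b bφ bZ w₁ w₂ w₃) ↔ κ = PairClass.i)) ∧
    -- the limit `b_Z = 0`
    (∀ (a b bφ w₁ w₂ w₃ : ℝ) (A : Vec → Vec) (W : Vec → ℝ) (H P Xa Xb : Phase → ℝ)
        (Xc : ℝ → Phase → ℝ), ContDiff ℝ ∞ A →
      (∀ x, curl A x = famB bφ 0 x) → bφ ≠ 0 →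
      W = famW a b bφ 0 w₁ w₂ w₃ → H = ham A W → P = intP bφ A → Xa = intA bφ w₁ w₃ A →
      Xb = intB bφ w₁ w₂ w₃ A → (∀ s, Xc s = intC bφ w₁ w₂ w₃ s A) →
      QuadraticallyMinimallySuperintegrable A W ∧
      BelongsToClass PairClass.i A W ∧ BelongsToClass PairClass.k A W ∧
      IsQuadraticIntegral A W P ∧ IsQuadraticIntegral A W Xa ∧ IsQuadraticIntegral A W Xb ∧
      (∀ s, IsQuadraticIntegral A W (Xc s)) ∧
      FunctionallyIndependent ![H, Xa, Xb, P] ∧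
      (∀ s, FunctionallyIndependent ![H, Xa, Xc s, P]) ∧
      -- the Poisson algebra
      (∀ (s : ℝ) (ξ : Phase),
        poisson Xa Xb ξ = 2 * bφ * (s * P ξ - Xc s ξ) ∧
        poisson Xa (Xc s) ξ = -2 * (P ξ - 2 * w₃) * Xb ξ + 2 * bφ * w₁ * w₂ ∧
        poisson Xb (Xc s) ξ = (P ξ - 2 * w₃) * (P ξ ^ 2 + 2 * Xa ξ - 2 * H ξ)
          + bφ * (w₂ ^ 2 - w₁ ^ 2) ∧
        poisson Xa P ξ = 0 ∧ poisson Xb P ξ = 0 ∧ poisson (Xc s) P ξ = 0) ∧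
      -- the further limit `w₁ = w₂ = 0`, with the additional first order integral `L = l_3^A`
      (w₁ = 0 → w₂ = 0 →
        BelongsToClass PairClass.f A W ∧ IsQuadraticIntegral A W (covAng A 2) ∧
        FunctionallyIndependent ![H, Xa, P, covAng A 2] ∧
        ∀ (s : ℝ) (ξ : Phase),
          poisson P (covAng A 2) ξ = 0 ∧
          poisson (covAng A 2) (Xc s) ξ = 0 ∧
          poisson (covAng A 2) Xa ξ = 2 * Xb ξ ∧
          poisson (covAng A 2) Xb ξ = -(P ξ ^ 2 - 2 * H ξ) - 2 * Xa ξ ∧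
          Xc s ξ = P ξ * covAng A 2 ξ - 2 * w₃ * covAng A 2 ξ + s * P ξ ∧
          Xb ξ ^ 2 = (2 * H ξ - P ξ ^ 2 - Xa ξ) * Xa ξ
            + bφ * (P ξ - 2 * w₃) * covAng A 2 ξ ^ 2)) ∧
    -- the limit `b_φ = 0`
    (∀ (a b bZ w₁ w₂ w₃ : ℝ) (A : Vec → Vec), ContDiff ℝ ∞ A →
      (∀ x, curl A x = famB 0 bZ x) → bZ ≠ 0 →
      QuadraticallyMinimallySuperintegrable A (famW a b 0 bZ w₁ w₂ w₃) ∧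
      BelongsToClass PairClass.i A (famW a b 0 bZ w₁ w₂ w₃) ∧
      BelongsToClass PairClass.k A (famW a b 0 bZ w₁ w₂ w₃) ∧
      BelongsToClass PairClass.f A (famW a b 0 bZ w₁ w₂ w₃)) := by
  refine ⟨fun bφ bZ => ⟨contDiff_famA bφ bZ, curl_famA bφ bZ⟩,
    fun a b bφ bZ w₁ w₂ w₃ A hA hB => existence hA hB a b w₁ w₂ w₃, uniqueness,
    fun a b bφ bZ w₁ w₂ w₃ A hA hB hφ hZ => ⟨noIndependentQuadratic_four hA hB hφ hZ a b w₁ w₂ w₃,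
      fun hne => belongsToClass_iff_i hA hB hφ hZ hne⟩, ?_,
    fun a b bZ w₁ w₂ w₃ A hA hB hZ =>
      ⟨quadraticallyMinimallySuperintegrable_of_bφ_eq_zero hA hB hZ a b w₁ w₂ w₃,
        belongsToClass_i hA hB a b w₁ w₂ w₃, belongsToClass_k_homogeneous hA hB a b w₁ w₂ w₃,
        belongsToClass_f_homogeneous hA hB a b w₁ w₂ w₃⟩⟩
  intro a b bφ w₁ w₂ w₃ A W H P Xa Xb Xc hA hB hφ hW hH hP hXa hXb hXc
  obtain rfl : Xc = fun s => intC bφ w₁ w₂ w₃ s A := funext hXc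
  subst hW hH hP hXa hXb
  refine ⟨quadraticallyMinimallySuperintegrable_of_bZ_eq_zero hA hB hφ a b w₁ w₂ w₃,
    belongsToClass_i hA hB a b w₁ w₂ w₃, belongsToClass_k hA hB a b w₁ w₂ w₃,
    isQuadraticIntegral_intP hA hB a b w₁ w₂ w₃, isQuadraticIntegral_intA hA hB a b w₁ w₂ w₃,
    isQuadraticIntegral_intB hA hB a b w₁ w₂ w₃, isQuadraticIntegral_intC hA hB a b w₁ w₂ w₃,
    functionallyIndependent_ABP hA hφ a b w₁ w₂ w₃, functionallyIndependent_ACP hA a b w₁ w₂ w₃,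
    poissonAlgebra hA hB a b w₁ w₂ w₃, ?_⟩
  rintro rfl rfl
  exact ⟨belongsToClass_f hA hB a b w₃, isQuadraticIntegral_covAng hA hB a b w₃,
    functionallyIndependent_APL hA a b w₃, poissonAlgebra_axial hA hB a b w₃⟩
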